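/- Let $K$ be an algebraically closed field of characteristic $0$. For $l\in\mathbb N=\{1,2,\dots\}$ let $A_1^{(l)}$ be the Ore extension $K[Z,Z^{-1}][Y,\mathrm{id},\delta]$ with $\delta(Z)=\frac1l Z^{1-l}$; write $X^{i/l}:=Z^i$, so that $[Y,X]=1$, and for $l\mid h$ regard $A_1^{(l)}\subseteq A_1^{(h)}$ via $X^{i/l}\mapsto X^{i/l}$, $Y\mapsto Y$. The subalgebra of $A_1^{(l)}$ generated by $X$ and $Y$ is the Weyl algebra $A_1$. Let $L^{(l)}=K[x^{1/l},x^{-1/l},y]$ (commutative) and let $\Psi\colon A_1^{(l)}\to L^{(l)}$ be the $K$-linear bijection $X^{i/l}Y^j\mapsto x^{i/l}y^j$. *Notation.* Let $\overline{\mathfrak V}$ (resp. $\mathfrak V$) be the set of pairs $(\rho,\sigma)$ of coprime integers with $\rho+\sigma\ge 0$ (resp. $\rho+\sigma>0$). On $\overline{\mathfrak V}$ put $(\rho_1,\sigma_1)<(\rho_2,\sigma_2)$ if $\rho_1\sigma_2-\sigma_1\rho_2>0$, and also $(1,-1)<(-1,1)$. Put $v_{\rho,\sigma}(a,b)=\rho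 a+\sigma b$ for $(a,b)\in\mathbb Q^2$. For $0\ne P=\sum a_{i/l,j}x^{i/l}y^j\in L^{(l)}$ let $\mathrm{Supp}(P)=\{(i/l,j):a_{i/l,j}\neq0\}$, let $v_{\rho,\sigma}(P)$ be the maximum of $v_{\rho,\sigma}$ on $\mathrm{Supp}(P)$, and let $\ell_{\rho,\sigma}(P)$ be the sum of the terms of $P$ of degree $v_{\rho,\sigma}(P)$; put $v_{\rho,\sigma}(0)=-\infty$. Let $w(P)$ be the point of $\mathrm{Supp}(\ell_{1,-1}(P))$ with maximal first coordinate and $\overline w(P)$ the point of $\mathrm{Supp}(\ell_{-1,1}(P))$ with maximal second coordinate. For $P\in A_1^{(l)}$ these notions are those of $\Psi(P)$ (in particular $\ell_{\rho,\sigma}(P)\in L^{(l)}$). For $0\ne P\in A_1^{(l)}$ and $(\rho,\sigma)\in\mathfrak V$ put $\mathrm{st}_{\rho,\sigma}(P)=w(\ell_{\rho,\sigma}(P))$ and $\mathrm{en}_{\rho,\sigma}(P)=\overline w(\ell_{\rho,\sigma}(P))$, and let $\mathrm{Dir}(P)$ be the set of $(\rho,\sigma)\in\mathfrak V$ for which $\ell_{\rho,\sigma}(P)$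 has more than one term. An element $F\in A_1^{(l)}$ is $(\rho,\sigma)$-homogeneous if $F=0$ or $\Psi(F)=\ell_{\rho,\sigma}(F)$. For $P,Q\neq0$ put $[P,Q]_{\rho,\sigma}=0$ if $v_{\rho,\sigma}([P,Q])<v_{\rho,\sigma}(P)+v_{\rho,\sigma}(Q)-(\rho+\sigma)$, and $[P,Q]_{\rho,\sigma}=\ell_{\rho,\sigma}([P,Q])\in L^{(l)}$ otherwise. *Setting.* Let $P,Q\in A_1^{(l)}$ and let $(\rho,\sigma)\in\mathfrak V$ with $\rho>0$. Assume - (a) $[Q,P]=1$; - (b) $(\rho,\sigma)\in\mathrm{Dir}(P)\cap\mathrm{Dir}(Q)$; - (c) $v_{\rho,\sigma}(P)>0$ and $v_{\rho,\sigma}(Q)>0$; - (d) $[P,Q]_{\rho,\sigma}=0$; - (e) $\frac{v_{\rho,\sigma}(Q)}{v_{\rho,\sigma}(P)}\notin\mathbb N$ and $\frac{v_{\rho,\sigma}(P)}{v_{\rho,\sigma}(Q)}\notin\mathbb N$; - (f) $v_{1,-1}(\mathrm{en}_{\rho,\sigma}(P))<0$ and $v_{1,-1}(\mathrm{en}_{\rho,\sigma}(Q))<0$.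 Write $\mathrm{st}_{\rho,\sigma}(P)=(r/l,s)$ and $\ell_{\rho,\sigma}(P)=\sum_{i=0}^{\gamma}a_i\,x^{r/l-i\sigma/\rho}y^{s+i}$, and put $\mathfrak f(x)=x^s\sum_{i=0}^{\gamma}a_ix^i\in K[x]$. Let $\lambda\in K$ be any element for which the multiplicity $m_\lambda$ of $x-\lambda$ in $\mathfrak f$ is maximal, put $l'=\mathrm{lcm}(l,\rho)$, and let $\varphi$ be the automorphism of $A_1^{(l')}$ with $\varphi(X^{1/l'})=X^{1/l'}$ and $\varphi(Y)=Y+\lambda X^{\sigma/\rho}$. *Conclusion.* There is $(\rho',\sigma')\in\mathfrak V$ such that 1. $(\rho',\sigma')<(\rho,\sigma)$ and $(\rho',\sigma')\in\mathrm{Dir}(\varphi(P))\cap\mathrm{Dir}(\varphi(Q))$; 2. $v_{1,-1}(\mathrm{en}_{\rho',\sigma'}(\varphi(P)))<0$ and $v_{1,-1}(\mathrm{en}_{\rho',\sigma'}(\varphi(Q)))<0$; 3. $v_{\rho',\sigma'}(\varphi(P))>0$ and $v_{\rho',\sigma'}(\varphi(Q))>0$; 4. $\dfrac{v_{\rho',\sigma'}(\varphi(P))}{v_{\rho',\sigma'}(\varphi(Q))}=\dfrac{v_{\rho,\sigma}(P)}{v_{\rho,\sigma}(Q)}$;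 5. $\ell_{\rho'',\sigma''}(\varphi(P))=\ell_{\rho'',\sigma''}(P)$ and $\ell_{\rho'',\sigma''}(\varphi(Q))=\ell_{\rho'',\sigma''}(Q)$ for all $(\rho'',\sigma'')\in\overline{\mathfrak V}$ with $(\rho,\sigma)<(\rho'',\sigma'')<(-1,1)$; 6. $\mathrm{en}_{\rho',\sigma'}(\varphi(P))=\mathrm{st}_{\rho,\sigma}(\varphi(P))=\left(\frac rl+\frac{s\sigma}\rho-m_\lambda\frac\sigma\rho,\;m_\lambda\right)$; 7. $\mathrm{en}_{\rho',\sigma'}(\varphi(Q))=\mathrm{st}_{\rho,\sigma}(\varphi(Q))$ and $\mathrm{en}_{\rho',\sigma'}(\varphi(P))=\frac{v_{\rho,\sigma}(P)}{v_{\rho,\sigma}(Q)}\,\mathrm{en}_{\rho',\sigma'}(\varphi(Q))$; 8. $v_{0,1}(\mathrm{en}_{\rho',\sigma'}(\varphi(P)))<v_{0,1}(\mathrm{en}_{\rho,\sigma}(P))$ or $\mathrm{en}_{\rho',\sigma'}(\varphi(P))=\mathrm{en}_{\rho,\sigma}(P)$; in the second case, moreover, $\mathrm{en}_{\rho,\sigma}(P)+(\sigma/\rho,-1)\in\mathrm{Supp}(P)$;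 9. $v_{\rho,\sigma}(\varphi(P))=v_{\rho,\sigma}(P)$ and $v_{\rho,\sigma}(\varphi(Q))=v_{\rho,\sigma}(Q)$; 10. $[\varphi(Q),\varphi(P)]_{\rho,\sigma}=0$; 11. there is a $(\rho,\sigma)$-homogeneous element $F\in A_1^{(l)}$ whose support has more than one point, such that $[P,F]_{\rho,\sigma}=\ell_{\rho,\sigma}(P)$ and $v_{\rho,\sigma}(F)=\rho+\sigma$, and such that $\mathrm{st}_{\rho,\sigma}(\varphi(P))=\mathrm{en}_{\rho,\sigma}(P)$ if $\mathrm{en}_{\rho,\sigma}(F)=(1,1)$. Moreover $\rho'>0$; in (11), $\mathrm{st}_{\rho,\sigma}(F)\neq(0,0)\neq\mathrm{en}_{\rho,\sigma}(F)$; and if $l'=1$, then $\varphi$ maps $A_1$ onto itself. -/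

import Mathlib

open Polynomial
open scoped LaurentPolynomial

noncomputable section

namespace WeylFrac

/-! ### Ore extensions `A[Y, id, δ]` -/

section Ore

variable {K A : Type*} [Field K] [CommRing A] [Algebra K A]

/-- The underlying `K`-module of the Ore extension `A[Y, id, δ]` of a commutative `K`-algebra `A`
by a derivation `δ`: every element is written uniquely as a finite sum `∑ aⱼ Yʲ` with coefficients
`aⱼ ∈ A` on the left, and is represented by the polynomial with these coefficients.
The multiplication, defined below, is *not* that of polynomials. -/
def Ore (_δ : Derivation K A A) : Type _ := A[X]

variable (δ : Derivation K A A)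

instance : AddCommGroup (Ore δ) := inferInstanceAs (AddCommGroup A[X])

instance : Module K (Ore δ) := inferInstanceAs (Module K A[X])

namespace Ore

/-- The `K`-linear identification of the Ore extension with the commutative polynomials over `A`,
`∑ aⱼ Yʲ ↦ ∑ aⱼ yʲ`. -/
def toPoly : Ore δ ≃ₗ[K] A[X] := LinearEquiv.refl K A[X]

/-- Left multiplication by `Y`: `a Yʲ ↦ a Yʲ⁺¹ + δ(a) Yʲ`. -/
def leftY : A[X] →ₗ[K] A[X] :=
  Polynomial.lsum (R := K) fun j =>
    ((Polynomial.monomial (R := A) (j + 1)).restrictScalars K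
      + (Polynomial.monomial (R := A) j).restrictScalars K ∘ₗ (δ : A →ₗ[K] A))

/-- Left multiplication by an element: `∑ aⱼ Yʲ` acts by applying `j` times the left
multiplication by `Y`, and then multiplying the coefficients by `aⱼ`. -/
def leftMul : A[X] →ₗ[K] Module.End K A[X] :=
  Polynomial.lsum (R := K) fun j =>
    (LinearMap.mulRight K (leftY δ ^ j)) ∘ₗ (Algebra.lmul K A[X]).toLinearMap ∘ₗ
      (Polynomial.CAlgHom (R := K) (A := A)).toLinearMap

theorem leftY_monomial (j : ℕ) (a : A) :
    leftY δ (monomial j a) = monomial (j + 1) a + monomial j (δ a) := by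
  simp [leftY, Polynomial.sum_monomial_index]

theorem leftMul_monomial (j : ℕ) (a : A) (q : A[X]) :
    leftMul δ (monomial j a) q = C a * ((leftY δ ^ j) q) := by
  simp [leftMul, Polynomial.sum_monomial_index]

theorem leftY_C_mul (a : A) (q : A[X]) :
    leftY δ (C a * q) = C a * leftY δ q + C (δ a) * q := by
  induction q using Polynomial.induction_on' with
  | add p q hp hq => simp only [mul_add, map_add, hp, hq]; ring
  | monomial n b =>
    simp only [C_mul_monomial, leftY_monomial, Derivation.leibniz, smul_eq_mul, map_add, mul_add,
      mul_comm b]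
    ring

theorem leftMul_leftY (q r : A[X]) :
    leftMul δ (leftY δ q) r = leftY δ (leftMul δ q r) := by
  induction q using Polynomial.induction_on' with
  | add p q hp hq => simp only [map_add, LinearMap.add_apply, hp, hq]
  | monomial n b =>
    simp only [leftY_monomial, map_add, LinearMap.add_apply, leftMul_monomial, leftY_C_mul,
      pow_succ', Module.End.mul_apply]

theorem leftMul_C_mul (a : A) (q r : A[X]) :
    leftMul δ (C a * q) r = C a * leftMul δ q r := by
  induction q using Polynomial.induction_on' with
  | add p q hp hq => simp only [mul_add, map_add, LinearMap.add_apply, hp, hq]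
  | monomial n b => simp only [C_mul_monomial, leftMul_monomial, map_mul, mul_assoc]

theorem leftMul_assoc (p q r : A[X]) :
    leftMul δ (leftMul δ p q) r = leftMul δ p (leftMul δ q r) := by
  induction p using Polynomial.induction_on' with
  | add p q hp hq => simp only [map_add, LinearMap.add_apply, hp, hq]
  | monomial n b =>
    simp only [leftMul_monomial, leftMul_C_mul]
    congr 1
    induction n with
    | zero => simp
    | succ n ih => simp only [pow_succ', Module.End.mul_apply, leftMul_leftY, ih]

theorem leftMul_one (p : A[X]) : leftMul δ p 1 = p := by
  have h : ∀ n : ℕ, (leftY δ ^ n) (1 : A[X]) = X ^ n := by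
    intro n
    induction n with
    | zero => simp
    | succ n ih =>
      rw [pow_succ', Module.End.mul_apply, ih, ← monomial_one_right_eq_X_pow, leftY_monomial]
      simp [monomial_one_right_eq_X_pow]
  induction p using Polynomial.induction_on' with
  | add p q hp hq => simp only [map_add, LinearMap.add_apply, hp, hq]
  | monomial n b => rw [leftMul_monomial, h, C_mul_X_pow_eq_monomial]

theorem one_leftMul (p : A[X]) : leftMul δ 1 p = p := by
  rw [← monomial_zero_one, leftMul_monomial]; simp

end Ore

/-- The ring structure of the Ore extension `A[Y, id, δ]`; it is the one in which `Y a = a Y + δ(a)`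
for `a ∈ A`, see `Ore.Y_mul_ofA` below. -/
instance : Ring (Ore δ) :=
  { (inferInstance : AddCommGroup (Ore δ)) with
    mul := fun p q => Ore.leftMul δ p q
    one := (1 : A[X])
    mul_assoc := Ore.leftMul_assoc δ
    one_mul := Ore.one_leftMul δ
    mul_one := Ore.leftMul_one δ
    zero_mul := fun q => LinearMap.congr_fun (map_zero (Ore.leftMul δ)) q
    mul_zero := fun p => map_zero (Ore.leftMul δ p)
    left_distrib := fun p => map_add (Ore.leftMul δ p)
    right_distrib := fun p q r => LinearMap.congr_fun (map_add (Ore.leftMul δ) p q) r }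

instance : Algebra K (Ore δ) :=
  Algebra.ofModule
    (fun c p q => LinearMap.congr_fun (map_smul (Ore.leftMul δ) c p) q)
    (fun c p q => map_smul (Ore.leftMul δ p) c q)

namespace Ore

theorem mul_def (p q : Ore δ) : p * q = (toPoly δ).symm (leftMul δ (toPoly δ p) (toPoly δ q)) := rfl

/-- The coefficient algebra `A` as a subalgebra of the Ore extension. -/
def ofA : A →ₐ[K] Ore δ :=
  AlgHom.ofLinearMap ((toPoly δ).symm.toLinearMap ∘ₗ (CAlgHom (R := K) (A := A)).toLinearMap)
    (by show (C (1 : A) : A[X]) = 1; simp)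
    (by
      intro a b
      show (C (a * b) : A[X]) = leftMul δ (C a) (C b)
      rw [← monomial_zero_left (a := a), leftMul_monomial]
      simp)

/-- The variable `Y` of the Ore extension. -/
def Y : Ore δ := (toPoly δ).symm (X : A[X])

theorem Y_mul_ofA (a : A) : Y δ * ofA δ a = ofA δ a * Y δ + ofA δ (δ a) := by
  show leftMul δ X (C a) = leftMul δ (C a) X + C (δ a)
  have h₁ : leftMul δ X (C a) = leftY δ (C a) := by
    rw [← monomial_one_one_eq_X, leftMul_monomial]; simp
  have h₂ : leftMul δ (C a) X = C a * X := by
    rw [← monomial_zero_left (a := a), leftMul_monomial]; simp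
  rw [h₁, h₂, ← monomial_zero_left (a := a), leftY_monomial]
  simp [C_mul_X_eq_monomial]

theorem Y_mul (p : A[X]) : Y δ * (toPoly δ).symm p = (toPoly δ).symm (leftY δ p) := by
  show leftMul δ X p = leftY δ p
  rw [← monomial_one_one_eq_X, leftMul_monomial]
  simp

theorem ofA_mul (a : A) (p : A[X]) : ofA δ a * (toPoly δ).symm p = (toPoly δ).symm (C a * p) := by
  show leftMul δ (C a) p = C a * p
  rw [← monomial_zero_left (a := a), leftMul_monomial]
  simp

theorem ofA_mul_Y_pow (a : A) (j : ℕ) :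
    ofA δ a * Y δ ^ j = (toPoly δ).symm (monomial j a) := by
  have h : Y δ ^ j = (toPoly δ).symm (X ^ j) := by
    induction j with
    | zero => rfl
    | succ n ih =>
      rw [pow_succ', ih, Y_mul, ← monomial_one_right_eq_X_pow, leftY_monomial]
      simp [monomial_one_right_eq_X_pow]
  rw [h, ofA_mul, C_mul_X_pow_eq_monomial]

section Lift

variable {δ} {B : Type*} [Ring B] [Algebra K B] (f : A →ₐ[K] B) (y : B)

/-- The linear map `∑ aⱼ Yʲ ↦ ∑ f(aⱼ) yʲ`. -/
def liftLin : A[X] →ₗ[K] B :=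
  Polynomial.lsum (R := K) fun j => (LinearMap.mulRight K (y ^ j)) ∘ₗ f.toLinearMap

theorem liftLin_monomial (j : ℕ) (a : A) : liftLin f y (monomial j a) = f a * y ^ j := by
  simp [liftLin, Polynomial.sum_monomial_index]

theorem liftLin_C_mul (a : A) (q : A[X]) : liftLin f y (C a * q) = f a * liftLin f y q := by
  induction q using Polynomial.induction_on' with
  | add p q hp hq => simp only [mul_add, map_add, hp, hq]
  | monomial n b => simp only [C_mul_monomial, liftLin_monomial, map_mul, mul_assoc]

theorem liftLin_leftY (h : ∀ a, y * f a = f a * y + f (δ a)) (q : A[X]) :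
    liftLin f y (leftY δ q) = y * liftLin f y q := by
  induction q using Polynomial.induction_on' with
  | add p q hp hq => simp only [mul_add, map_add, hp, hq]
  | monomial n b =>
    simp only [leftY_monomial, map_add, liftLin_monomial, ← mul_assoc, h, add_mul, pow_succ']

theorem liftLin_leftMul (h : ∀ a, y * f a = f a * y + f (δ a)) (p q : A[X]) :
    liftLin f y (leftMul δ p q) = liftLin f y p * liftLin f y q := by
  induction p using Polynomial.induction_on' with
  | add p q hp hq => simp only [add_mul, map_add, LinearMap.add_apply, hp, hq]
  | monomial n b =>
    simp only [leftMul_monomial, liftLin_C_mul, liftLin_monomial, mul_assoc]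
    congr 1
    induction n with
    | zero => simp
    | succ n ih => simp only [pow_succ', Module.End.mul_apply, liftLin_leftY f y h, ih, mul_assoc]

/-- The algebra homomorphism from the Ore extension given by `f` on the coefficients and by
`Y ↦ y`. -/
def lift (h : ∀ a, y * f a = f a * y + f (δ a)) : Ore δ →ₐ[K] B :=
  AlgHom.ofLinearMap (liftLin f y ∘ₗ (toPoly δ).toLinearMap)
    (by
      show liftLin f y (1 : A[X]) = 1
      rw [← monomial_zero_one, liftLin_monomial]; simp)
    (fun p q => liftLin_leftMul f y h p q)

theorem lift_ofA (h : ∀ a, y * f a = f a * y + f (δ a)) (a : A) : lift f y h (ofA δ a) = f a := by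
  show liftLin f y (C a) = f a
  rw [← monomial_zero_left, liftLin_monomial]; simp

theorem lift_Y (h : ∀ a, y * f a = f a * y + f (δ a)) : lift f y h (Y δ) = y := by
  show liftLin f y X = y
  rw [← monomial_one_one_eq_X, liftLin_monomial]; simp

theorem algHom_ext {g₁ g₂ : Ore δ →ₐ[K] B} (hA : ∀ a, g₁ (ofA δ a) = g₂ (ofA δ a))
    (hY : g₁ (Y δ) = g₂ (Y δ)) : g₁ = g₂ := by
  have key : ∀ p : A[X], g₁ ((toPoly δ).symm p) = g₂ ((toPoly δ).symm p) := by
    intro p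
    induction p using Polynomial.induction_on' with
    | add p q hp hq => simp only [map_add, hp, hq]
    | monomial n b => simp only [← ofA_mul_Y_pow, map_mul, map_pow, hA, hY]
  exact AlgHom.ext key

end Lift

theorem shiftHom_aux (a b : A) :
    (Y δ + ofA δ a) * ofA δ b = ofA δ b * (Y δ + ofA δ a) + ofA δ (δ b) := by
  rw [add_mul, mul_add, Y_mul_ofA, ← map_mul, ← map_mul, mul_comm a b]
  abel

/-- The endomorphism of the Ore extension which fixes `A` and maps `Y` to `Y + a`. -/
def shiftHom (a : A) : Ore δ →ₐ[K] Ore δ :=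
  lift (ofA δ) (Y δ + ofA δ a) (shiftHom_aux δ a)

theorem shiftHom_comp (a b : A) (hab : a + b = 0) :
    (shiftHom δ a).comp (shiftHom δ b) = AlgHom.id K (Ore δ) := by
  apply algHom_ext
  · intro c
    simp only [AlgHom.comp_apply, shiftHom, lift_ofA, AlgHom.id_apply]
  · rw [AlgHom.comp_apply, shiftHom, shiftHom, lift_Y, map_add, lift_Y, lift_ofA, add_assoc,
      ← map_add, hab, map_zero, add_zero, AlgHom.id_apply]

/-- The automorphism of the Ore extension which fixes `A` and maps `Y` to `Y + a`. -/
def shift (a : A) : Ore δ ≃ₐ[K] Ore δ :=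
  AlgEquiv.ofAlgHom (shiftHom δ a) (shiftHom δ (-a))
    (shiftHom_comp δ a (-a) (add_neg_cancel a)) (shiftHom_comp δ (-a) a (neg_add_cancel a))

theorem shift_ofA (a b : A) : shift δ a (ofA δ b) = ofA δ b := lift_ofA _ _ (shiftHom_aux δ a) b

theorem shift_Y (a : A) : shift δ a (Y δ) = Y δ + ofA δ a := lift_Y _ _ (shiftHom_aux δ a)

end Ore

end Ore

/-! ### The algebras `A₁^(l)` and `L^(l)` -/

section Algebras

variable (K : Type*) [Field K]

/-- The linear map `Zⁱ ↦ (i/l) Zⁱ⁻ˡ` on Laurent polynomials. -/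
def derLin (l : ℕ) : K[T;T⁻¹] →ₗ[K] K[T;T⁻¹] :=
  (Finsupp.lsum K fun i : ℤ =>
      LinearMap.toSpanSingleton K K[T;T⁻¹]
        (((i : K) / (l : K)) • LaurentPolynomial.T (i - l))) ∘ₗ
    (AddMonoidAlgebra.coeffLinearEquiv K).toLinearMap

theorem derLin_single (l : ℕ) (i : ℤ) (c : K) :
    derLin K l (.single i c) = .single (i - l) (c * ((i : K) / (l : K))) := by
  show (Finsupp.lsum K fun i : ℤ => LinearMap.toSpanSingleton K K[T;T⁻¹]
    (((i : K) / (l : K)) • LaurentPolynomial.T (i - l))) (Finsupp.single i c) = _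
  rw [Finsupp.lsum_single, LinearMap.toSpanSingleton_apply, LaurentPolynomial.T,
    AddMonoidAlgebra.smul_single, AddMonoidAlgebra.smul_single, smul_eq_mul, smul_eq_mul, mul_one]

theorem derLin_mul (l : ℕ) (a b : K[T;T⁻¹]) :
    derLin K l (a * b) = a • derLin K l b + b • derLin K l a := by
  simp only [smul_eq_mul]
  induction a using AddMonoidAlgebra.induction_linear with
  | zero => simp
  | add p q hp hq => simp only [add_mul, mul_add, map_add, hp, hq]; abel
  | single i c =>
    induction b using AddMonoidAlgebra.induction_linear with
    | zero => simp
    | add p q hp hq => simp only [add_mul, mul_add, map_add, hp, hq]; abel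
    | single j e =>
      simp only [derLin_single, AddMonoidAlgebra.single_mul_single]
      rw [show j + (i - (l : ℤ)) = i + j - l by ring, show i + (j - (l : ℤ)) = i + j - l by ring,
        ← AddMonoidAlgebra.single_add]
      congr 1
      push_cast
      ring

/-- The derivation of `K[Z, Z⁻¹]` with `Z ↦ (1/l) Z^(1-l)`, that is `Zⁱ ↦ (i/l) Zⁱ⁻ˡ`. -/
def der (l : ℕ) : Derivation K K[T;T⁻¹] K[T;T⁻¹] := Derivation.mk' (derLin K l) (derLin_mul K l)

/-- The algebra `A₁^(l)`: the Ore extension of `K[Z, Z⁻¹]`, where `Z = X^(1/l)`, by the derivation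
`Z ↦ (1/l) Z^(1-l)`. -/
abbrev A1 (l : ℕ) : Type _ := Ore (der K l)

variable {K}

/-- The power `X^(i/l)` in `A₁^(l)`. -/
def Xpow (l : ℕ) (i : ℤ) : A1 K l := Ore.ofA (der K l) (LaurentPolynomial.T i)

/-- The automorphism of `A₁^(l)`, for `ρ ∣ l`, which fixes `X^(1/l)` and maps `Y` to
`Y + lam • X^(σ/ρ)`. -/
def shear (l : ℕ) (ρ σ : ℤ) (lam : K) : A1 K l ≃ₐ[K] A1 K l :=
  Ore.shift (der K l) (lam • LaurentPolynomial.T ((l : ℤ) / ρ * σ))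

/-- The map `X^(i/l) ↦ X^(i/l)` from the coefficients of `A₁^(l)` to those of `A₁^(h)`. -/
def inclCoeff (l h : ℕ) : K[T;T⁻¹] →ₐ[K] K[T;T⁻¹] :=
  AddMonoidAlgebra.mapDomainAlgHom K K (AddMonoidHom.mulLeft ((h / l : ℕ) : ℤ))

theorem der_inclCoeff [CharZero K] {l h : ℕ} (hd : l ∣ h) (hh : 0 < h) (a : K[T;T⁻¹]) :
    der K h (inclCoeff l h a) = inclCoeff l h (der K l a) := by
  obtain ⟨d, rfl⟩ := hd
  have hl : 0 < l := Nat.pos_of_mul_pos_right hh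
  have hd : 0 < d := Nat.pos_of_mul_pos_left hh
  show derLin K _ _ = inclCoeff _ _ (derLin K _ _)
  induction a using AddMonoidAlgebra.induction_linear with
  | zero => simp
  | add p q hp hq => simp only [map_add, hp, hq]
  | single i c =>
    have hl' : (l : K) ≠ 0 := by exact_mod_cast hl.ne'
    have hd' : (d : K) ≠ 0 := by exact_mod_cast hd.ne'
    simp only [inclCoeff, AddMonoidAlgebra.mapDomainAlgHom_apply, AddMonoidAlgebra.mapDomain_single,
      derLin_single, Nat.mul_div_cancel_left d hl, AddMonoidHom.coe_mulLeft]
    congr 1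
    · push_cast; ring
    · push_cast; field_simp

/-- The inclusion `A₁^(l) ⊆ A₁^(h)`, for `l ∣ h`, which maps `X^(i/l)` to `X^(i/l)` and `Y` to
`Y`. -/
def incl [CharZero K] {l h : ℕ} (hd : l ∣ h) (hh : 0 < h) : A1 K l →ₐ[K] A1 K h :=
  Ore.lift ((Ore.ofA (der K h)).comp (inclCoeff l h)) (Ore.Y (der K h)) (by
    intro a
    rw [AlgHom.comp_apply, AlgHom.comp_apply, Ore.Y_mul_ofA, der_inclCoeff hd hh])

variable (K) in
/-- The Weyl algebra `A₁` inside `A₁^(l)`: the subalgebra generated by `X` and `Y`. -/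
def weyl (l : ℕ) : Subalgebra K (A1 K l) :=
  Algebra.adjoin K {Xpow l (l : ℤ), Ore.Y (der K l)}

variable (K) in
/-- The commutative algebra `L^(l) = K[x^(1/l), x^(-1/l), y]`; the monomial `x^(i/l) yʲ` is
`Polynomial.monomial j (LaurentPolynomial.T i)`. The number `l` only enters in the exponents of
`x`, see `suppL`. -/
abbrev L (_l : ℕ) : Type _ := K[T;T⁻¹][X]

/-- The `K`-linear bijection `Ψ : A₁^(l) → L^(l)`, `X^(i/l) Yʲ ↦ x^(i/l) yʲ`. -/
def Psi {l : ℕ} (P : A1 K l) : L K l := Ore.toPoly (der K l) P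

end Algebras

/-! ### Directions -/

/-- The set of directions `(ρ, σ)` with `gcd(ρ, σ) = 1` and `ρ + σ ≥ 0`. -/
def Vbar : Set (ℤ × ℤ) := {d | Int.gcd d.1 d.2 = 1 ∧ 0 ≤ d.1 + d.2}

/-- The set of directions `(ρ, σ)` with `gcd(ρ, σ) = 1` and `ρ + σ > 0`. -/
def V : Set (ℤ × ℤ) := {d | Int.gcd d.1 d.2 = 1 ∧ 0 < d.1 + d.2}

/-- The strict order on `Vbar`: the directions grow counterclockwise, from `(1, -1)` to
`(-1, 1)`. -/
def dirLT (a b : ℤ × ℤ) : Prop :=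
  0 < a.1 * b.2 - a.2 * b.1 ∨ (a = (1, -1) ∧ b = (-1, 1))

/-- The degree `v_{ρ,σ}(p) = ρ p₁ + σ p₂` of a point. -/
def vPt (d : ℤ × ℤ) (p : ℚ × ℚ) : ℚ := d.1 * p.1 + d.2 * p.2

/-! ### Supports, degrees, leading terms and end points in `L^(l)` -/

section Commutative

variable {K : Type*} [Field K] (l : ℕ)

/-- The support: the set of the points `(i/l, j)` such that `x^(i/l) yʲ` occurs in `P`. -/
def suppL (P : L K l) : Finset (ℚ × ℚ) :=
  P.support.biUnion fun j =>
    (P.coeff j).coeff.support.image fun i : ℤ => ((i : ℚ) / (l : ℚ), (j : ℚ))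

/-- The `(ρ, σ)`-degree, with the value `-∞` at `0`. -/
def degL (d : ℤ × ℤ) (P : L K l) : WithBot ℚ :=
  (suppL l P).sup fun p => (vPt d p : WithBot ℚ)

/-- The `(ρ, σ)`-degree `v_{ρ,σ}(P)` of `P ≠ 0`, as a rational number. -/
def vL (d : ℤ × ℤ) (P : L K l) : ℚ := (degL l d P).unbotD 0

/-- The `(ρ, σ)`-leading term `ℓ_{ρ,σ}(P)`: the sum of the terms of `P` of maximal degree. -/
def ellL (d : ℤ × ℤ) (P : L K l) : L K l :=
  ∑ j ∈ P.support,
    ∑ i ∈ (P.coeff j).coeff.support.filter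
        fun i : ℤ => vPt d ((i : ℚ) / (l : ℚ), (j : ℚ)) = vL l d P,
      monomial j (AddMonoidAlgebra.single i ((P.coeff j).coeff i))

/-- The point `w(P)`, for `P ≠ 0`: the one with maximal first coordinate in the support of
`ℓ_{1,-1}(P)`. -/
def wL (P : L K l) : ℚ × ℚ :=
  let a : ℚ := ((suppL l (ellL l (1, -1) P)).sup fun p => (p.1 : WithBot ℚ)).unbotD 0
  (a, a - vL l (1, -1) P)

/-- The point `w̄(P)`, for `P ≠ 0`: the one with maximal second coordinate in the support of
`ℓ_{-1,1}(P)`. -/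
def wbarL (P : L K l) : ℚ × ℚ :=
  let b : ℚ := ((suppL l (ellL l (-1, 1) P)).sup fun p => (p.2 : WithBot ℚ)).unbotD 0
  (b - vL l (-1, 1) P, b)

end Commutative

/-! ### The corresponding notions in `A₁^(l)` -/

section Noncommutative

variable {K : Type*} [Field K] {l : ℕ}

/-- The support of `P`. -/
def supp (P : A1 K l) : Finset (ℚ × ℚ) := suppL l (Psi P)

/-- The `(ρ, σ)`-degree of `P`, with the value `-∞` at `0`. -/
def deg (d : ℤ × ℤ) (P : A1 K l) : WithBot ℚ := degL l d (Psi P)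

/-- The `(ρ, σ)`-degree `v_{ρ,σ}(P)` of `P ≠ 0`, as a rational number. -/
def v (d : ℤ × ℤ) (P : A1 K l) : ℚ := vL l d (Psi P)

/-- The `(ρ, σ)`-leading term `ℓ_{ρ,σ}(P) ∈ L^(l)`. -/
def ell (d : ℤ × ℤ) (P : A1 K l) : L K l := ellL l d (Psi P)

/-- The starting point `st_{ρ,σ}(P)` of the leading term. -/
def st (d : ℤ × ℤ) (P : A1 K l) : ℚ × ℚ := wL l (ell d P)

/-- The end point `en_{ρ,σ}(P)` of the leading term. -/
def en (d : ℤ × ℤ) (P : A1 K l) : ℚ × ℚ := wbarL l (ell d P)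

/-- `P` is `(ρ, σ)`-homogeneous. -/
def IsHomog (d : ℤ × ℤ) (P : A1 K l) : Prop := Psi P = 0 ∨ Psi P = ell d P

/-- The set `Dir(P)` of the directions in `V` for which the leading term of `P` has more than one
term. -/
def Dir (P : A1 K l) : Set (ℤ × ℤ) := {d | d ∈ V ∧ 1 < (suppL l (ell d P)).card}

/-- `P, Q ≠ 0` are `(ρ, σ)`-proportional if `v([P, Q]) < v(P) + v(Q) - (ρ + σ)`. -/
def Proportional (d : ℤ × ℤ) (P Q : A1 K l) : Prop :=
  deg d ⁅P, Q⁆ < ((v d P + v d Q - (d.1 + d.2) : ℚ) : WithBot ℚ)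

open Classical in
/-- The bracket `[P, Q]_{ρ,σ} ∈ L^(l)` of two elements `P, Q ≠ 0`. -/
def bracket (d : ℤ × ℤ) (P Q : A1 K l) : L K l :=
  if Proportional d P Q then 0 else ell d ⁅P, Q⁆

/-- The polynomial `f_{P,ρ,σ} = ∑ aₖ xᵏ`, for `ρ > 0` and `P ≠ 0`, where
`ℓ_{ρ,σ}(P) = ∑ aₖ x^(r/l - kσ/ρ) y^(s+k)` and `st_{ρ,σ}(P) = (r/l, s)`: a term of the leading term
with coefficient `a` and with exponent `j` of `y` contributes `a x^(j-s)`. -/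
def assocPoly (d : ℤ × ℤ) (P : A1 K l) : K[X] :=
  ∑ j ∈ (ell d P).support, ∑ i ∈ ((ell d P).coeff j).coeff.support,
    monomial (j - ⌊(st d P).2⌋₊) (((ell d P).coeff j).coeff i)

/-- The polynomial `x^s f_{P,ρ,σ}(x)`, where `st_{ρ,σ}(P) = (r/l, s)`. -/
def cutPoly (d : ℤ × ℤ) (P : A1 K l) : K[X] := X ^ ⌊(st d P).2⌋₊ * assocPoly d P

end Noncommutative

/-- The number `l' = lcm(l, ρ)`. -/
def lvl (l : ℕ) (ρ : ℤ) : ℕ := Nat.lcm l ρ.natAbs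

theorem dvd_lvl (l : ℕ) (ρ : ℤ) : l ∣ lvl l ρ := Nat.dvd_lcm_left l ρ.natAbs

theorem lvl_pos {l : ℕ} {ρ : ℤ} (hl : 0 < l) (hρ : 0 < ρ) : 0 < lvl l ρ :=
  Nat.lcm_pos hl (Int.natAbs_pos.mpr hρ.ne')

end WeylFrac

end

open WeylFrac

/-! For a direction with `ρ ≠ 0`, a monomial of given weight is determined by its exponent of `y`. A
leading term can therefore be recorded as a polynomial in one variable (`hom`, `Lead`), with
starting and end points read off from its lowest and highest degrees. Let `(u, f)` and `(w, g)` be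
the degrees and leading polynomials of `P` and `Q`. To leading order the commutator is a Poisson
bracket, and Euler's identity eliminates `∂/∂x`: the leading part of `[P, Q]` is, up to the factor
`ρ`, the weighted Wronskian `w f' g - u f g'` (`hom_lie`). Condition (d) makes it vanish, so root
multiplicities in `f` and `g` are in the ratio `u : w`.

The key point is that the maximal multiplicity `m` satisfies `u < (ρ + σ) m`. It comes from a
homogeneous `F` of degree `ρ + σ` whose bracket with `P` has leading term that of `P`
(`exists_homogeneous_solution`). Among polynomials in `P` and `Q` whose leading term does not
commute with that of `P`, take one, `G`, of least degree in `Q`. Since `ad P` lowers this degree,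
the leading term of `[P, G]` commutes with that of `P`, and the quotient `g₀ f / g₁` of leading
polynomials solves the equation and is a polynomial. Such a `G` exists by a dimension count: the
products `PⁱQʲ` with `i, j < n` span a space of dimension `n²`, whereas commuting leading terms
would allow only linear growth in `n`. Every root of `f` is a root of `F`, and comparison of degrees
gives the bound (`lt_mul_rootMultiplicity_of_wron_eq`).

The automorphism `φ` translates `f` by `λ`, so `m` becomes the lowest degree and the starting point
of `φ(P)` has negative `v_{1,-1}`. Now rotate the direction downwards from `(ρ, σ)` until a new
support point of `φ(P)` or `φ(Q)` meets the supporting line through its starting point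
(`exists_next_direction`). This happens while the degrees are still positive: otherwise both would
have degree at most `0` in a direction for which their commutator must have negative degree,
contradicting `[Q, P] = 1`. Condition (e) forces both leading terms to acquire a second monomial
simultaneously. -/

noncomputable section

namespace WeylFrac

/-! ### Monomials, weights and the weight filtration -/

section Filtration

variable {K : Type*} [Field K]

/-- The monomial `c x^(i/l) yʲ`. -/
def mono (i : ℤ) (j : ℕ) (c : K) : K[T;T⁻¹][X] := monomial j (AddMonoidAlgebra.single i c)

/-- The coefficient of `x^(i/l) yʲ`. -/
def cf (p : K[T;T⁻¹][X]) (i : ℤ) (j : ℕ) : K := (p.coeff j).coeff i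

theorem cf_mono (i i' : ℤ) (j j' : ℕ) (c : K) :
    cf (mono i j c) i' j' = if i = i' ∧ j = j' then c else 0 := by
  classical
  unfold cf mono
  rw [coeff_monomial]
  by_cases hj : j = j' <;> by_cases hi : i = i' <;>
    simp [hi, hj, -LaurentPolynomial.single_eq_C_mul_T]

theorem cf_add (p q : K[T;T⁻¹][X]) (i : ℤ) (j : ℕ) : cf (p + q) i j = cf p i j + cf q i j := by
  simp [cf]

theorem cf_smul (c : K) (p : K[T;T⁻¹][X]) (i : ℤ) (j : ℕ) : cf (c • p) i j = c * cf p i j := by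
  simp [cf]

theorem cf_zero (i : ℤ) (j : ℕ) : cf (0 : K[T;T⁻¹][X]) i j = 0 := by
  simp [cf]

theorem cf_ext {p q : K[T;T⁻¹][X]} (h : ∀ i j, cf p i j = cf q i j) : p = q := by
  ext j i
  exact h i j

theorem eq_sum_mono (p : K[T;T⁻¹][X]) :
    p = ∑ j ∈ p.support, ∑ i ∈ (p.coeff j).coeff.support, mono i j (cf p i j) := by
  conv_lhs => rw [p.as_sum_support]
  refine Finset.sum_congr rfl fun j _ => ?_
  unfold mono cf
  rw [← map_sum]
  congr 1
  conv_lhs => rw [← AddMonoidAlgebra.sum_coeff_single (p.coeff j)]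
  rfl

variable (l : ℕ) (α β : ℚ)

/-- The weight of `x^(i/l) yʲ`. -/
def wt (i : ℤ) (j : ℕ) : ℚ := α * ((i : ℚ) / (l : ℚ)) + β * (j : ℚ)

variable (K) in
/-- The subspace of the elements all of whose monomials have weight at most `u`. -/
def Fil (u : ℚ) : Submodule K K[T;T⁻¹][X] where
  carrier := {p | ∀ i j, cf p i j ≠ 0 → wt l α β i j ≤ u}
  zero_mem' := fun i j h => absurd (cf_zero i j) h
  add_mem' := by
    intro p q hp hq i j h
    by_contra hc
    apply h
    rw [cf_add, not_not.mp fun h' => hc (hp i j h'), not_not.mp fun h' => hc (hq i j h'), add_zero]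
  smul_mem' := by
    intro c p hp i j h
    rw [cf_smul] at h
    exact hp i j (right_ne_zero_of_mul h)

variable {l α β}

theorem Fil_mono {u w : ℚ} (h : u ≤ w) : Fil K l α β u ≤ Fil K l α β w :=
  fun _ hp i j hij => (hp i j hij).trans h

theorem mono_mem_Fil {u : ℚ} {i : ℤ} {j : ℕ} (c : K) (h : wt l α β i j ≤ u) :
    mono i j c ∈ Fil K l α β u := by
  intro i' j' hij
  rw [cf_mono] at hij
  split_ifs at hij with h'
  · obtain ⟨rfl, rfl⟩ := h'
    exact h
  · exact absurd rfl hij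

theorem mono_zero (i : ℤ) (j : ℕ) : mono i j (0 : K) = 0 := by simp [mono]

/-- Membership in `Fil` is tested on each monomial separately, so the monomial expansion never
leaves the subspace. Weight estimates thus reduce to monomials. -/
theorem Fil_induction {u : ℚ} {motive : ∀ p : K[T;T⁻¹][X], p ∈ Fil K l α β u → Prop}
    (zero : motive 0 (zero_mem _))
    (add : ∀ p q hp hq, motive p hp → motive q hq → motive (p + q) (add_mem hp hq))
    (mon : ∀ i j c (h : wt l α β i j ≤ u), motive (mono i j c) (mono_mem_Fil c h))
    {p : K[T;T⁻¹][X]} (hp : p ∈ Fil K l α β u) : motive p hp := by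
  suffices h : ∃ h : p ∈ Fil K l α β u, motive p h from h.2
  rw [eq_sum_mono p]
  have hadd : ∀ p q : K[T;T⁻¹][X], (∃ h, motive p h) → (∃ h, motive q h) →
      ∃ h, motive (p + q) h := fun p q ⟨h, h'⟩ ⟨k, k'⟩ => ⟨_, add p q h k h' k'⟩
  refine Finset.sum_induction _ (fun p => ∃ h, motive p h) hadd ⟨_, zero⟩ fun j _ =>
    Finset.sum_induction _ (fun p => ∃ h, motive p h) hadd ⟨_, zero⟩ fun i hi =>
      ⟨_, mon i j _ (hp i j ?_)⟩
  simpa [cf] using hi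

theorem mono_induction {motive : K[T;T⁻¹][X] → Prop} (zero : motive 0)
    (add : ∀ p q, motive p → motive q → motive (p + q))
    (mon : ∀ i j c, motive (mono i j c)) (p : K[T;T⁻¹][X]) : motive p := by
  rw [eq_sum_mono p]
  exact Finset.sum_induction _ motive add zero fun j _ =>
    Finset.sum_induction _ motive add zero fun i _ => mon i j _

theorem mono_mul_mono (i i' : ℤ) (j j' : ℕ) (c c' : K) :
    mono i j c * mono i' j' c' = mono (i + i') (j + j') (c * c') := by
  simp only [mono, monomial_mul_monomial, AddMonoidAlgebra.single_mul_single]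

theorem wt_add (i i' : ℤ) (j j' : ℕ) :
    wt l α β (i + i') (j + j') = wt l α β i j + wt l α β i' j' := by
  simp only [wt]; push_cast; ring

theorem mul_mem_Fil {a b : ℚ} {p q : K[T;T⁻¹][X]} (hp : p ∈ Fil K l α β a)
    (hq : q ∈ Fil K l α β b) : p * q ∈ Fil K l α β (a + b) := by
  induction hp using Fil_induction with
  | zero => simp
  | add p q _ _ hp hq => rw [add_mul]; exact add_mem hp hq
  | mon i j c h =>
    induction hq using Fil_induction with
    | zero => simp
    | add p q _ _ hp hq => rw [mul_add]; exact add_mem hp hq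
    | mon i' j' c' h' =>
      rw [mono_mul_mono]
      exact mono_mem_Fil _ (by rw [wt_add]; exact add_le_add h h')

/-- The derivation `∂/∂x`, applied to the coefficients. -/
def dX (l : ℕ) : K[T;T⁻¹][X] →ₗ[K] K[T;T⁻¹][X] :=
  Polynomial.lsum (R := K) fun j =>
    (Polynomial.monomial (R := K[T;T⁻¹]) j).restrictScalars K ∘ₗ (der K l : K[T;T⁻¹] →ₗ[K] K[T;T⁻¹])

theorem dX_mono (i : ℤ) (j : ℕ) (c : K) :
    dX l (mono i j c) = mono (i - l) j (c * ((i : K) / (l : K))) := by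
  have h : der K l (AddMonoidAlgebra.single i c) = _ := derLin_single K l i c
  simp [dX, mono, Polynomial.sum_monomial_index, h, -LaurentPolynomial.single_eq_C_mul_T]

theorem X_mul_mono (i : ℤ) (j : ℕ) (c : K) : X * mono i j c = mono i (j + 1) c := by
  simp [mono, X_mul_monomial]

theorem X_pow_mul_mono (i : ℤ) (j k : ℕ) (c : K) : X ^ k * mono i j c = mono i (j + k) c := by
  simp [mono, X_pow_mul_monomial]

theorem leftY_eq (q : K[T;T⁻¹][X]) : Ore.leftY (der K l) q = X * q + dX l q := by
  induction q using mono_induction with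
  | zero => simp
  | add p q hp hq => simp only [map_add, hp, hq, mul_add]; abel
  | mon i j c =>
    rw [X_mul_mono, dX_mono, mono, Ore.leftY_monomial]
    congr 2
    exact derLin_single K l i c

theorem dX_X_pow_mul (k : ℕ) (q : K[T;T⁻¹][X]) : dX l (X ^ k * q) = X ^ k * dX l q := by
  induction q using mono_induction with
  | zero => simp
  | add p q hp hq => simp only [map_add, hp, hq, mul_add]
  | mon i j c => rw [X_pow_mul_mono, dX_mono, dX_mono, X_pow_mul_mono]

theorem dX_mem_Fil (hl : 0 < l) {b : ℚ} {q : K[T;T⁻¹][X]} (hq : q ∈ Fil K l α β b) :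
    dX l q ∈ Fil K l α β (b - α) := by
  induction hq using Fil_induction with
  | zero => simp
  | add p q _ _ hp hq => rw [map_add]; exact add_mem hp hq
  | mon i j c h =>
    rw [dX_mono]
    refine mono_mem_Fil _ ?_
    have : (l : ℚ) ≠ 0 := by positivity
    have h2 : wt l α β (i - l) j = wt l α β i j - α := by
      simp only [wt]; push_cast; field_simp; ring
    rw [h2]; linarith

theorem X_pow_mul_mem_Fil {b : ℚ} (k : ℕ) {q : K[T;T⁻¹][X]} (hq : q ∈ Fil K l α β b) :
    X ^ k * q ∈ Fil K l α β (b + k * β) := by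
  induction hq using Fil_induction with
  | zero => simp
  | add p q _ _ hp hq => rw [mul_add]; exact add_mem hp hq
  | mon i j c h =>
    rw [X_pow_mul_mono]
    refine mono_mem_Fil _ ?_
    have h2 : wt l α β i (j + k) = wt l α β i j + k * β := by
      simp only [wt]; push_cast; ring
    rw [h2]; linarith

theorem leftY_mem_Fil (hl : 0 < l) (hαβ : 0 ≤ α + β) {b : ℚ} {q : K[T;T⁻¹][X]}
    (hq : q ∈ Fil K l α β b) : Ore.leftY (der K l) q ∈ Fil K l α β (b + β) := by
  rw [leftY_eq]
  refine add_mem ?_ (Fil_mono (by linarith) (dX_mem_Fil hl hq))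
  simpa using X_pow_mul_mem_Fil 1 hq

/-- Left multiplication by `Y` is `y + ∂/∂x`, a sum of commuting operators. In its `j`-th power each
`∂/∂x` taken in place of `y` costs weight `α + β`; only the terms with at most one such factor are
kept. For `j = 0` the truncated exponent `j - 1` is harmless because of the factor `j`. -/
theorem leftY_pow_sub_mem_Fil (hl : 0 < l) (hαβ : 0 ≤ α + β) {b : ℚ} {q : K[T;T⁻¹][X]}
    (hq : q ∈ Fil K l α β b) (j : ℕ) :
    (Ore.leftY (der K l) ^ j) q - X ^ j * q - j • (X ^ (j - 1) * dX l q)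
      ∈ Fil K l α β (b + j * β - 2 * (α + β)) := by
  induction j with
  | zero => simp
  | succ j ih =>
    have key : (Ore.leftY (der K l) ^ (j + 1)) q - X ^ (j + 1) * q
        - (j + 1) • (X ^ (j + 1 - 1) * dX l q)
        = Ore.leftY (der K l) ((Ore.leftY (der K l) ^ j) q - X ^ j * q
            - j • (X ^ (j - 1) * dX l q)) + j • (X ^ (j - 1) * dX l (dX l q)) := by
      rw [pow_succ', Module.End.mul_apply, map_sub, map_sub, map_nsmul, leftY_eq (X ^ j * q),
        leftY_eq (X ^ (j - 1) * _), dX_X_pow_mul, dX_X_pow_mul]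
      rcases j with _ | j
      · simp; ring
      · simp only [Nat.add_sub_cancel, nsmul_eq_mul]; push_cast; ring
    rw [key]
    refine add_mem ?_ ?_
    · convert leftY_mem_Fil hl hαβ ih using 2
      push_cast; ring
    · rcases j with _ | j
      · simp
      · refine nsmul_mem (Fil_mono ?_ (X_pow_mul_mem_Fil (j + 1 - 1)
          (dX_mem_Fil hl (dX_mem_Fil hl hq)))) _
        rw [Nat.add_sub_cancel]; push_cast; linarith

theorem derivative_mono (i : ℤ) (j : ℕ) (c : K) :
    derivative (mono i j c) = mono i (j - 1) (c * j) := by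
  rw [mono, derivative_monomial, mono]
  congr 1
  rw [← map_natCast (algebraMap K K[T;T⁻¹]), mul_comm, ← Algebra.smul_def,
    AddMonoidAlgebra.smul_single, smul_eq_mul, mul_comm]

/-- The product of the Ore extension agrees up to second order with the commutative product and its
first order correction. -/
theorem leftMul_sub_mem_Fil (hl : 0 < l) (hαβ : 0 ≤ α + β) {a b : ℚ} {p q : K[T;T⁻¹][X]}
    (hp : p ∈ Fil K l α β a) (hq : q ∈ Fil K l α β b) :
    Ore.leftMul (der K l) p q - p * q - derivative p * dX l q
      ∈ Fil K l α β (a + b - 2 * (α + β)) := by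
  induction hp using Fil_induction with
  | zero => simp
  | add p p' _ _ hp hp' =>
    convert add_mem hp hp' using 1
    simp only [map_add, LinearMap.add_apply]; ring
  | mon i j c h =>
    have e : Ore.leftMul (der K l) (mono i j c) q - mono i j c * q
        - derivative (mono i j c) * dX l q = mono i 0 c *
        ((Ore.leftY (der K l) ^ j) q - X ^ j * q - j • (X ^ (j - 1) * dX l q)) := by
      rw [mono, Ore.leftMul_monomial, derivative_monomial, mono, monomial_zero_left,
        ← C_mul_X_pow_eq_monomial, ← C_mul_X_pow_eq_monomial, C_mul, nsmul_eq_mul, map_natCast]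
      ring
    rw [e]
    refine Fil_mono ?_ (mul_mem_Fil (mono_mem_Fil (l := l) (α := α) (β := β) c le_rfl)
      (leftY_pow_sub_mem_Fil hl hαβ hq j))
    have h2 : wt l α β i j = wt l α β i 0 + j * β := by
      simp only [wt]; push_cast; ring
    linarith

theorem derivative_mem_Fil {a : ℚ} {p : K[T;T⁻¹][X]} (hp : p ∈ Fil K l α β a) :
    derivative p ∈ Fil K l α β (a - β) := by
  induction hp using Fil_induction with
  | zero => simp
  | add p q _ _ hp hq => rw [map_add]; exact add_mem hp hq
  | mon i j c h =>
    rw [derivative_mono]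
    rcases j with _ | j
    · simp [mono_zero]
    · refine mono_mem_Fil _ ?_
      have h2 : wt l α β i (j + 1) = wt l α β i j + β := by
        simp only [wt]; push_cast; ring
      rw [Nat.add_sub_cancel]; linarith

theorem leftMul_mem_Fil (hl : 0 < l) (hαβ : 0 ≤ α + β) {a b : ℚ} {p q : K[T;T⁻¹][X]}
    (hp : p ∈ Fil K l α β a) (hq : q ∈ Fil K l α β b) :
    Ore.leftMul (der K l) p q ∈ Fil K l α β (a + b) := by
  have h := add_mem (add_mem (Fil_mono (by linarith) (leftMul_sub_mem_Fil hl hαβ hp hq) :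
    _ ∈ Fil K l α β (a + b)) (Fil_mono (by linarith)
      (mul_mem_Fil (derivative_mem_Fil hp) (dX_mem_Fil hl hq)) : _ ∈ Fil K l α β (a + b)))
    (mul_mem_Fil hp hq)
  convert h using 1
  ring

/-! ### Homogeneous components as polynomials in one variable -/

variable (K l α β) in
/-- The component of weight `u`, as a polynomial: `x^(i/l) yʲ` is mapped to `Xʲ` if it has weight
`u` and to `0` otherwise. -/
def hom (u : ℚ) : K[T;T⁻¹][X] →ₗ[K] K[X] :=
  Polynomial.lsum (R := K) fun j =>
    (Finsupp.lsum K fun i : ℤ =>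
      if wt l α β i j = u then Polynomial.monomial (R := K) j else 0) ∘ₗ
    (AddMonoidAlgebra.coeffLinearEquiv K).toLinearMap

theorem hom_mono (u : ℚ) (i : ℤ) (j : ℕ) (c : K) :
    hom K l α β u (mono i j c) = if wt l α β i j = u then monomial j c else 0 := by
  have h : (AddMonoidAlgebra.coeffLinearEquiv K) (AddMonoidAlgebra.single i c : K[T;T⁻¹])
      = Finsupp.single i c := rfl
  simp only [hom, mono, lsum_apply, LinearMap.coe_comp, LinearEquiv.coe_coe, Function.comp_apply]
  rw [Polynomial.sum_monomial_index _ _ (by simp), h, Finsupp.lsum_single]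
  split_ifs <;> simp

theorem hom_eq_zero_of_mem {u w : ℚ} (h : u < w) {p : K[T;T⁻¹][X]} (hp : p ∈ Fil K l α β u) :
    hom K l α β w p = 0 := by
  induction hp using Fil_induction with
  | zero => simp
  | add p q _ _ hp hq => rw [map_add, hp, hq, add_zero]
  | mon i j c h' => rw [hom_mono, if_neg (by linarith)]

theorem hom_mul {a b : ℚ} {p q : K[T;T⁻¹][X]} (hp : p ∈ Fil K l α β a)
    (hq : q ∈ Fil K l α β b) :
    hom K l α β (a + b) (p * q) = hom K l α β a p * hom K l α β b q := by
  induction hp using Fil_induction with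
  | zero => simp
  | add p q _ _ hp hq => simp only [add_mul, map_add, hp, hq]
  | mon i j c h =>
    induction hq using Fil_induction with
    | zero => simp
    | add p q _ _ hp hq => simp only [mul_add, map_add, hp, hq]
    | mon i' j' c' h' =>
      rw [mono_mul_mono, hom_mono, hom_mono, hom_mono, wt_add]
      by_cases h1 : wt l α β i j = a
      · by_cases h2 : wt l α β i' j' = b
        · simp [h1, h2, monomial_mul_monomial]
        · rw [if_neg (by rw [h1]; simpa using h2), if_neg h2, mul_zero]
      · rw [if_neg (by
          intro h3; exact h1 (by linarith)), if_neg h1, zero_mul]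

theorem hom_derivative (a : ℚ) (p : K[T;T⁻¹][X]) :
    hom K l α β (a - β) (derivative p) = derivative (hom K l α β a p) := by
  induction p using mono_induction with
  | zero => simp
  | add p q hp hq => simp only [map_add, hp, hq]
  | mon i j c =>
    rw [derivative_mono, hom_mono, hom_mono]
    rcases j with _ | j
    · simp only [Nat.cast_zero, mul_zero, monomial_zero_right, ite_self]
      split_ifs <;> simp
    · have h2 : wt l α β i (j + 1) = wt l α β i j + β := by
        simp only [wt]; push_cast; ring
      rw [Nat.add_sub_cancel, h2, apply_ite derivative, derivative_monomial, map_zero]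
      exact if_congr ⟨fun h => by linarith, fun h => by linarith⟩ rfl rfl

/-- Euler's identity: `α x ∂/∂x + β y ∂/∂y` acts on the component of weight `b` as multiplication by
`b`. It expresses `∂/∂x` through the derivative in the single remaining variable. -/
theorem hom_dX [CharZero K] (hl : 0 < l) (b : ℚ) (q : K[T;T⁻¹][X]) :
    (α : K) • hom K l α β (b - α) (dX l q)
      = (b : K) • hom K l α β b q - (β : K) • (X * derivative (hom K l α β b q)) := by
  induction q using mono_induction with
  | zero => simp
  | add p q hp hq => simp only [map_add, smul_add, hp, hq, mul_add]; ring
  | mon i j c =>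
    rw [dX_mono, hom_mono, hom_mono]
    have hl' : (l : ℚ) ≠ 0 := by positivity
    have h2 : wt l α β (i - l) j = wt l α β i j - α := by
      simp only [wt]; push_cast; field_simp; ring
    rw [h2]
    by_cases h : wt l α β i j = b
    · rw [if_pos (by rw [h]), if_pos h, derivative_monomial, X_mul_monomial]
      -- For `j = 0` the truncated exponent differs from `j`, but the coefficient is then zero.
      have e : (monomial (j - 1 + 1) (c * (j : K)) : K[X]) = monomial j (c * (j : K)) := by
        rcases j with _ | j <;> simp
      rw [e, smul_monomial, smul_monomial, smul_monomial, ← map_sub, ← h]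
      congr 1
      simp only [wt, smul_eq_mul]
      push_cast
      ring
    · rw [if_neg (by intro h3; exact h (by linarith)), if_neg h]; simp

/-- Monomials of the component of weight `u`, for a direction with `α ≠ 0`. -/
theorem hom_coeff (hl : 0 < l) (hα : α ≠ 0) (u : ℚ) (p : K[T;T⁻¹][X]) {i : ℤ} {j : ℕ}
    (h : wt l α β i j = u) : (hom K l α β u p).coeff j = cf p i j := by
  induction p using mono_induction with
  | zero => simp [cf_zero]
  | add p q hp hq => rw [map_add, coeff_add, cf_add, hp, hq]
  | mon i' j' c =>
    rw [hom_mono, cf_mono]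
    have hl' : (l : ℚ) ≠ 0 := by positivity
    by_cases hj : j' = j
    · subst hj
      by_cases hi : i' = i
      · subst hi; simp [h]
      · rw [if_neg, if_neg (by simp [hi]), coeff_zero]
        intro h3
        apply hi
        rw [← h] at h3
        simp only [wt] at h3
        have : α * ((i' : ℚ) / l) = α * (i / l) := by linarith
        have := mul_left_cancel₀ hα this
        field_simp at this
        exact_mod_cast this
    · rw [if_neg (by simp [hj] : ¬(i' = i ∧ j' = j))]
      split_ifs
      · rw [coeff_monomial, if_neg hj]
      · simp

theorem exists_of_hom_coeff_ne_zero (u : ℚ) (p : K[T;T⁻¹][X]) {j : ℕ}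
    (h : (hom K l α β u p).coeff j ≠ 0) : ∃ i, wt l α β i j = u ∧ cf p i j ≠ 0 := by
  by_contra hc
  push Not at hc
  apply h
  rw [eq_sum_mono p]
  simp only [map_sum, hom_mono, finsetSum_coeff]
  refine Finset.sum_eq_zero fun j' _ => Finset.sum_eq_zero fun i _ => ?_
  split_ifs with h1
  · rw [coeff_monomial]
    split_ifs with h2
    · subst h2; exact hc i h1
    · rfl
  · simp

end Filtration

/-! ### Products, commutators and automorphisms of `A₁^(l)` -/

section NoncommutativeFiltration

variable {K : Type*} [Field K] {l : ℕ} {α β : ℚ}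

theorem Psi_mem_mul (hl : 0 < l) (hαβ : 0 ≤ α + β) {a b : ℚ} {P Q : A1 K l}
    (hP : Psi P ∈ Fil K l α β a) (hQ : Psi Q ∈ Fil K l α β b) :
    Psi (P * Q) ∈ Fil K l α β (a + b) :=
  leftMul_mem_Fil hl hαβ hP hQ

theorem Psi_add (P Q : A1 K l) : Psi (P + Q) = Psi P + Psi Q := rfl

theorem Psi_sub (P Q : A1 K l) : Psi (P - Q) = Psi P - Psi Q := rfl

theorem Psi_smul (c : K) (P : A1 K l) : Psi (c • P) = c • Psi P := rfl

theorem Psi_zero : Psi (0 : A1 K l) = 0 := rfl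

theorem Psi_injective : Function.Injective (Psi : A1 K l → L K l) :=
  (Ore.toPoly (der K l)).injective

theorem Psi_one : Psi (1 : A1 K l) = mono 0 0 1 := by
  show (1 : K[T;T⁻¹][X]) = _
  rfl

/-- All corrections to the commutative product have weight lower by at least `α + β > 0`, hence do
not reach the leading component. -/
theorem hom_mulA (hl : 0 < l) (hαβ : 0 < α + β) {a b : ℚ} {P Q : A1 K l}
    (hP : Psi P ∈ Fil K l α β a) (hQ : Psi Q ∈ Fil K l α β b) :
    hom K l α β (a + b) (Psi (P * Q)) = hom K l α β a (Psi P) * hom K l α β b (Psi Q) := by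
  have h := leftMul_sub_mem_Fil hl hαβ.le hP hQ
  have h' := mul_mem_Fil (derivative_mem_Fil hP) (dX_mem_Fil hl hQ)
  have h0 := hom_eq_zero_of_mem (w := a + b) (by linarith) h
  have h0' := hom_eq_zero_of_mem (w := a + b) (by linarith) h'
  rw [map_sub, map_sub, h0', hom_mul hP hQ, sub_zero, sub_eq_zero] at h0
  exact h0

theorem lie_sub_mem_Fil (hl : 0 < l) (hαβ : 0 ≤ α + β) {a b : ℚ} {P Q : A1 K l}
    (hP : Psi P ∈ Fil K l α β a) (hQ : Psi Q ∈ Fil K l α β b) :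
    Psi ⁅P, Q⁆ - (derivative (Psi P) * dX l (Psi Q) - derivative (Psi Q) * dX l (Psi P))
      ∈ Fil K l α β (a + b - 2 * (α + β)) := by
  have h := leftMul_sub_mem_Fil hl hαβ hP hQ
  have h' := leftMul_sub_mem_Fil hl hαβ hQ hP
  rw [add_comm b a] at h'
  convert sub_mem h h' using 1
  rw [Ring.lie_def]
  show Ore.leftMul (der K l) (Psi P) (Psi Q) - Ore.leftMul (der K l) (Psi Q) (Psi P) - _ = _
  ring

theorem lie_mem_Fil (hl : 0 < l) (hαβ : 0 ≤ α + β) {a b : ℚ} {P Q : A1 K l}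
    (hP : Psi P ∈ Fil K l α β a) (hQ : Psi Q ∈ Fil K l α β b) :
    Psi ⁅P, Q⁆ ∈ Fil K l α β (a + b - (α + β)) := by
  have h := Fil_mono (by linarith : _ ≤ a + b - (α + β)) (lie_sub_mem_Fil hl hαβ hP hQ)
  have h1 := Fil_mono (by linarith : _ ≤ a + b - (α + β))
    (mul_mem_Fil (derivative_mem_Fil hP) (dX_mem_Fil hl hQ))
  have h2 := Fil_mono (by linarith : _ ≤ a + b - (α + β))
    (mul_mem_Fil (derivative_mem_Fil hQ) (dX_mem_Fil hl hP))
  have h3 := add_mem h (sub_mem h1 h2)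
  rwa [sub_add_cancel] at h3

/-- The leading term of a commutator is the Poisson bracket of the leading terms. -/
theorem hom_lie [CharZero K] (hl : 0 < l) (hαβ : 0 < α + β) {a b : ℚ} {P Q : A1 K l}
    (hP : Psi P ∈ Fil K l α β a) (hQ : Psi Q ∈ Fil K l α β b) :
    (α : K) • hom K l α β (a + b - (α + β)) (Psi ⁅P, Q⁆)
      = (b : K) • (derivative (hom K l α β a (Psi P)) * hom K l α β b (Psi Q))
        - (a : K) • (hom K l α β a (Psi P) * derivative (hom K l α β b (Psi Q))) := by
  have h := hom_eq_zero_of_mem (w := a + b - (α + β)) (by linarith) (lie_sub_mem_Fil hl hαβ.le hP hQ)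
  rw [map_sub, sub_eq_zero] at h
  have e1 := hom_mul (derivative_mem_Fil hP) (dX_mem_Fil hl hQ)
  have e2 := hom_mul (derivative_mem_Fil hQ) (dX_mem_Fil hl hP)
  rw [show a - β + (b - α) = a + b - (α + β) by ring, hom_derivative] at e1
  rw [show b - β + (a - α) = a + b - (α + β) by ring, hom_derivative] at e2
  -- Once `hom_dX` replaces both occurrences of `∂/∂x`, the two terms with coefficient `β X` are
  -- equal and cancel.
  rw [h, map_sub, e1, e2, smul_sub, ← mul_smul_comm, ← mul_smul_comm, hom_dX hl, hom_dX hl]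
  simp only [mul_sub, mul_smul_comm]
  rw [mul_comm (hom K l α β a (Psi P)) (derivative (hom K l α β b (Psi Q)))]
  ring_nf

theorem Psi_Y_mem_Fil : Psi (Ore.Y (der K l)) ∈ Fil K l α β β := by
  have h : Psi (Ore.Y (der K l)) = mono 0 1 1 := by
    show (X : K[T;T⁻¹][X]) = _
    rw [mono, ← monomial_one_one_eq_X]; rfl
  rw [h]
  exact mono_mem_Fil _ (by simp [wt])

theorem hom_Psi_Y : hom K l α β β (Psi (Ore.Y (der K l))) = X := by
  have h : Psi (Ore.Y (der K l)) = mono 0 1 1 := by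
    show (X : K[T;T⁻¹][X]) = _
    rw [mono, ← monomial_one_one_eq_X]; rfl
  rw [h, hom_mono, if_pos (by simp [wt]), monomial_one_one_eq_X]

theorem symm_mono (i : ℤ) (j : ℕ) (c : K) : (Ore.toPoly (der K l)).symm (mono i j c)
    = Ore.ofA (der K l) (AddMonoidAlgebra.single i c) * Ore.Y (der K l) ^ j :=
  (Ore.ofA_mul_Y_pow _ _ _).symm

theorem Psi_ofA_single (i : ℤ) (c : K) :
    Psi (Ore.ofA (der K l) (AddMonoidAlgebra.single i c)) = mono i 0 c := rfl

theorem Psi_one_mem_Fil : Psi (1 : A1 K l) ∈ Fil K l α β 0 := by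
  rw [Psi_one]; exact mono_mem_Fil _ (by simp [wt])

theorem Psi_one_notMem_Fil {u : ℚ} (hu : u < 0) : Psi (1 : A1 K l) ∉ Fil K l α β u := by
  intro h
  rw [Psi_one] at h
  have := h 0 0 (by simp [cf_mono])
  simp [wt] at this
  linarith

theorem hom_Psi_one (u : ℚ) : ∃ κ : K, hom K l α β u (Psi (1 : A1 K l)) = C κ := by
  rw [Psi_one, hom_mono]
  split_ifs
  · exact ⟨1, rfl⟩
  · exact ⟨0, by simp⟩

theorem Psi_pow_mem (hl : 0 < l) (hαβ : 0 ≤ α + β) {a : ℚ} {P : A1 K l}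
    (hP : Psi P ∈ Fil K l α β a) (j : ℕ) : Psi (P ^ j) ∈ Fil K l α β (j * a) := by
  induction j with
  | zero => simpa using Psi_one_mem_Fil
  | succ j ih =>
    rw [pow_succ]
    convert Psi_mem_mul hl hαβ ih hP using 2
    push_cast; ring

theorem hom_pow (hl : 0 < l) (hαβ : 0 < α + β) {a : ℚ} {P : A1 K l}
    (hP : Psi P ∈ Fil K l α β a) (j : ℕ) :
    hom K l α β (j * a) (Psi (P ^ j)) = hom K l α β a (Psi P) ^ j := by
  induction j with
  | zero => simp [Psi_one, hom_mono, wt]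
  | succ j ih =>
    rw [pow_succ, pow_succ, ← ih, ← hom_mulA hl hαβ (Psi_pow_mem hl hαβ.le hP j) hP]
    congr 2
    push_cast; ring

variable {A : K[T;T⁻¹]}

theorem shift_symm_mono (i : ℤ) (j : ℕ) (c : K) :
    Ore.shift (der K l) A ((Ore.toPoly (der K l)).symm (mono i j c))
      = Ore.ofA (der K l) (AddMonoidAlgebra.single i c)
        * (Ore.Y (der K l) + Ore.ofA (der K l) A) ^ j := by
  rw [symm_mono, map_mul, map_pow, Ore.shift_ofA, Ore.shift_Y]

theorem shift_mem_Fil (hl : 0 < l) (hαβ : 0 ≤ α + β) (hA : C A ∈ Fil K l α β β) {u : ℚ}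
    {P : A1 K l} (hP : Psi P ∈ Fil K l α β u) :
    Psi (Ore.shift (der K l) A P) ∈ Fil K l α β u := by
  suffices h : ∀ p ∈ Fil K l α β u,
      Psi (Ore.shift (der K l) A ((Ore.toPoly (der K l)).symm p)) ∈ Fil K l α β u from h _ hP
  intro p hp
  induction hp using Fil_induction with
  | zero => simp [Psi_zero]
  | add p q _ _ hp hq => rw [map_add, map_add, Psi_add]; exact add_mem hp hq
  | mon i j c h =>
    rw [shift_symm_mono]
    refine Fil_mono ?_ (Psi_mem_mul hl hαβ
      (mono_mem_Fil (α := α) (β := β) (l := l) (i := i) (j := 0) c le_rfl)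
      (Psi_pow_mem hl hαβ (add_mem Psi_Y_mem_Fil hA : Psi (_ + _) ∈ _) j))
    simp only [wt] at *
    push_cast; linarith

/-- The leading component of `Y + A` is `X + λ`, and leading components are multiplicative. The
automorphism therefore acts as a translation, which moves the root `λ` to `0`. -/
theorem hom_shift (hl : 0 < l) (hαβ : 0 < α + β) {lam : K} (hA : C A ∈ Fil K l α β β)
    (hlam : hom K l α β β (C A) = C lam) {u : ℚ}
    {P : A1 K l} (hP : Psi P ∈ Fil K l α β u) :
    hom K l α β u (Psi (Ore.shift (der K l) A P)) = (hom K l α β u (Psi P)).comp (X + C lam) := by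
  suffices h : ∀ p ∈ Fil K l α β u,
      hom K l α β u (Psi (Ore.shift (der K l) A ((Ore.toPoly (der K l)).symm p)))
        = (hom K l α β u p).comp (X + C lam) from h _ hP
  intro p hp
  induction hp using Fil_induction with
  | zero => simp [Psi_zero]
  | add p q _ _ hp hq => rw [map_add, map_add, Psi_add, map_add, hp, hq, map_add, add_comp]
  | mon i j c h =>
    have hYA : Psi (Ore.Y (der K l) + Ore.ofA (der K l) A) ∈ Fil K l α β β :=
      add_mem Psi_Y_mem_Fil hA
    have hm := mono_mem_Fil (α := α) (β := β) (l := l) (i := i) (j := 0) c le_rfl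
    have e : wt l α β i 0 + j * β = wt l α β i j := by simp only [wt]; push_cast; ring
    have h1 := hom_mulA (P := Ore.ofA (der K l) (AddMonoidAlgebra.single i c)) hl hαβ hm
      (Psi_pow_mem hl hαβ.le hYA j)
    rw [hom_pow hl hαβ hYA, Psi_ofA_single, hom_mono, if_pos rfl, e, Psi_add, map_add, hom_Psi_Y,
      show hom K l α β β (Psi (Ore.ofA (der K l) A)) = C lam from hlam] at h1
    rw [shift_symm_mono, hom_mono]
    split_ifs with h2
    · rw [← h2, h1, monomial_comp, monomial_zero_left]
    · rw [zero_comp]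
      refine hom_eq_zero_of_mem (lt_of_le_of_ne h h2) ?_
      rw [← e]
      exact Psi_mem_mul hl hαβ.le hm (Psi_pow_mem hl hαβ.le hYA j)

/-- Each replacement of a factor `Y` by `A` lowers the weight bound by `β - w`, and every term of
the difference contains at least one such replacement. -/
theorem shift_sub_mem_Fil (hl : 0 < l) (hαβ : 0 ≤ α + β) {w : ℚ} (hw : w ≤ β)
    (hA : C A ∈ Fil K l α β w) {u : ℚ} {P : A1 K l} (hP : Psi P ∈ Fil K l α β u) :
    Psi (Ore.shift (der K l) A P) - Psi P ∈ Fil K l α β (u - (β - w)) := by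
  suffices h : ∀ p ∈ Fil K l α β u,
      Psi (Ore.shift (der K l) A ((Ore.toPoly (der K l)).symm p)) - p ∈ Fil K l α β (u - (β - w))
    from h _ hP
  have hYA : Psi (Ore.Y (der K l) + Ore.ofA (der K l) A) ∈ Fil K l α β β :=
    add_mem Psi_Y_mem_Fil (Fil_mono hw hA)
  have hpow : ∀ j : ℕ, Psi ((Ore.Y (der K l) + Ore.ofA (der K l) A) ^ j - Ore.Y (der K l) ^ j)
      ∈ Fil K l α β (j * β - (β - w)) := by
    intro j
    induction j with
    | zero => simp [Psi_zero]
    | succ j ih =>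
      have e : (Ore.Y (der K l) + Ore.ofA (der K l) A) ^ (j + 1) - Ore.Y (der K l) ^ (j + 1)
          = (Ore.Y (der K l) + Ore.ofA (der K l) A)
              * ((Ore.Y (der K l) + Ore.ofA (der K l) A) ^ j - Ore.Y (der K l) ^ j)
            + Ore.ofA (der K l) A * Ore.Y (der K l) ^ j := by
        rw [pow_succ', pow_succ']; noncomm_ring
      rw [e, Psi_add]
      refine add_mem (Fil_mono ?_ (Psi_mem_mul hl hαβ hYA ih))
        (Fil_mono ?_ (Psi_mem_mul hl hαβ (show Psi (Ore.ofA (der K l) A) ∈ _ from hA)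
          (Psi_pow_mem hl hαβ Psi_Y_mem_Fil j)))
      · push_cast; linarith
      · push_cast; linarith
  intro p hp
  induction hp using Fil_induction with
  | zero => simp [Psi_zero]
  | add p q _ _ hp hq =>
    rw [map_add, map_add, Psi_add]
    convert add_mem hp hq using 1
    ring
  | mon i j c h =>
    rw [shift_symm_mono]
    have e : mono i j c = Psi (Ore.ofA (der K l) (AddMonoidAlgebra.single i c)
        * Ore.Y (der K l) ^ j) := by
      rw [← symm_mono]; rfl
    rw [e, ← Psi_sub, ← mul_sub]
    refine Fil_mono ?_ (Psi_mem_mul hl hαβ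
      (mono_mem_Fil (α := α) (β := β) (l := l) (i := i) (j := 0) c le_rfl) (hpow j))
    simp only [wt] at *
    push_cast; linarith

/-! ### Invariance of weights and components under the inclusions of `A₁^(l)` -/

section Inclusion

variable [CharZero K] {h : ℕ} (hd : l ∣ h) (hh : 0 < h)

theorem Psi_incl_symm_mono (i : ℤ) (j : ℕ) (c : K) :
    Psi (incl hd hh ((Ore.toPoly (der K l)).symm (mono i j c)))
      = mono (((h / l : ℕ) : ℤ) * i) j c := by
  have e : inclCoeff l h (AddMonoidAlgebra.single i c : K[T;T⁻¹])
      = AddMonoidAlgebra.single (((h / l : ℕ) : ℤ) * i) c := by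
    simp only [inclCoeff, AddMonoidAlgebra.mapDomainAlgHom_apply, AddMonoidAlgebra.mapDomain_single,
      AddMonoidHom.coe_mulLeft]
  rw [symm_mono, map_mul, map_pow, incl, Ore.lift_ofA, Ore.lift_Y, AlgHom.comp_apply, e,
    ← symm_mono]
  rfl

theorem wt_incl {l : ℕ} (hd : l ∣ h) (hh : 0 < h) (i : ℤ) (j : ℕ) :
    wt h α β (((h / l : ℕ) : ℤ) * i) j = wt l α β i j := by
  obtain ⟨d, rfl⟩ := hd
  have hl : 0 < l := Nat.pos_of_mul_pos_right hh
  have hd : 0 < d := Nat.pos_of_mul_pos_left hh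
  rw [Nat.mul_div_cancel_left d hl]
  simp only [wt]
  push_cast
  field_simp

theorem incl_mem_Fil {u : ℚ} {P : A1 K l} (hP : Psi P ∈ Fil K l α β u) :
    Psi (incl hd hh P) ∈ Fil K h α β u := by
  suffices H : ∀ p ∈ Fil K l α β u,
      Psi (incl hd hh ((Ore.toPoly (der K l)).symm p)) ∈ Fil K h α β u from H _ hP
  intro p hp
  induction hp using Fil_induction with
  | zero => simp [Psi_zero]
  | add p q _ _ hp hq => rw [map_add, map_add, Psi_add]; exact add_mem hp hq
  | mon i j c h =>
    rw [Psi_incl_symm_mono]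
    exact mono_mem_Fil _ (by rwa [wt_incl hd hh])

theorem hom_incl (u : ℚ) (P : A1 K l) :
    hom K h α β u (Psi (incl hd hh P)) = hom K l α β u (Psi P) := by
  suffices H : ∀ p, hom K h α β u (Psi (incl hd hh ((Ore.toPoly (der K l)).symm p)))
      = hom K l α β u p from H _
  intro p
  induction p using mono_induction with
  | zero => simp [Psi_zero]
  | add p q hp hq => rw [map_add, map_add, Psi_add, map_add, hp, hq, map_add]
  | mon i j c => rw [Psi_incl_symm_mono, hom_mono, hom_mono, wt_incl hd hh]

end Inclusion

end NoncommutativeFiltration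

/-! ### The weighted Wronskian of two polynomials -/

section Wronskian

variable {K : Type*} [Field K]

/-- The weighted Wronskian `b f' g - a f g'`. -/
def wron (a b : ℚ) (f g : K[X]) : K[X] :=
  (b : K) • (derivative f * g) - (a : K) • (f * derivative g)

theorem wron_swap (a b : ℚ) (f g : K[X]) : wron b a g f = -wron a b f g := by
  simp only [wron, mul_comm g, mul_comm (derivative g)]
  ring

theorem wron_add_right (a b : ℚ) (f g h : K[X]) :
    wron a b f (g + h) = wron a b f g + wron a b f h := by
  simp only [wron, mul_add, map_add, smul_add]; ring

theorem wron_comp (a b : ℚ) (f g : K[X]) (μ : K) :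
    wron a b (f.comp (X + C μ)) (g.comp (X + C μ)) = (wron a b f g).comp (X + C μ) := by
  simp [wron, derivative_comp]

/-- The factor `X` turns derivatives into the Euler operator, which is diagonal on monomials;
coefficient comparisons then need no shifted or truncated indices. -/
theorem X_mul_wron (a b : ℚ) (f g : K[X]) :
    X * wron a b f g = (b : K) • ((X * derivative f) * g) - (a : K) • (f * (X * derivative g)) := by
  simp only [wron, mul_sub, mul_smul_comm]
  ring_nf

theorem coeff_X_mul_derivative (f : K[X]) (k : ℕ) :
    (X * derivative f).coeff k = f.coeff k * k := by
  rcases k with _ | k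
  · simp
  · rw [coeff_X_mul, coeff_derivative]; push_cast; rfl

theorem coeff_mul_of_lt {f g : K[X]} {m n : ℕ} (hf : ∀ k < m, f.coeff k = 0)
    (hg : ∀ k < n, g.coeff k = 0) : (f * g).coeff (m + n) = f.coeff m * g.coeff n := by
  rw [coeff_mul]
  refine Finset.sum_eq_single (m, n) ?_ (by simp)
  rintro ⟨i, j⟩ hij hne
  rw [Finset.HasAntidiagonal.mem_antidiagonal] at hij
  simp only at hij ⊢
  rcases lt_trichotomy i m with h | h | h
  · rw [hf i h, zero_mul]
  · exact absurd (by ext <;> simp <;> omega) hne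
  · rw [hg j (by omega), mul_zero]

/-- Here `m` and `n` need only be lower bounds for the orders of vanishing. This is used with `n =
0` and `n = 1` for a factor whose order is unknown. -/
theorem coeff_X_mul_wron_of_lt (a b : ℚ) {f g : K[X]} {m n : ℕ} (hf : ∀ k < m, f.coeff k = 0)
    (hg : ∀ k < n, g.coeff k = 0) :
    (X * wron a b f g).coeff (m + n) = (b * m - a * n) * (f.coeff m * g.coeff n) := by
  have hf' : ∀ k < m, (X * derivative f).coeff k = 0 := fun k hk => by
    rw [coeff_X_mul_derivative, hf k hk, zero_mul]
  have hg' : ∀ k < n, (X * derivative g).coeff k = 0 := fun k hk => by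
    rw [coeff_X_mul_derivative, hg k hk, zero_mul]
  rw [X_mul_wron, coeff_sub, coeff_smul, coeff_smul, coeff_mul_of_lt hf' hg, coeff_mul_of_lt hf hg',
    coeff_X_mul_derivative, coeff_X_mul_derivative, smul_eq_mul, smul_eq_mul]
  ring

theorem coeff_X_mul_wron_natDegree (a b : ℚ) (f g : K[X]) :
    (X * wron a b f g).coeff (f.natDegree + g.natDegree)
      = (b * f.natDegree - a * g.natDegree) * (f.leadingCoeff * g.leadingCoeff) := by
  have h : ∀ f : K[X], (X * derivative f).natDegree ≤ f.natDegree := by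
    intro f
    rw [natDegree_le_iff_coeff_eq_zero]
    intro k hk
    rw [coeff_X_mul_derivative, coeff_eq_zero_of_natDegree_lt hk, zero_mul]
  rw [X_mul_wron, coeff_sub, coeff_smul, coeff_smul, coeff_mul_add_eq_of_natDegree_le (h f) le_rfl,
    coeff_mul_add_eq_of_natDegree_le le_rfl (h g),
    coeff_X_mul_derivative, coeff_X_mul_derivative, smul_eq_mul, smul_eq_mul, leadingCoeff,
    leadingCoeff]
  ring

theorem exists_of_coeff_wron_ne_zero {a b : ℚ} {f g : K[X]} {n : ℕ}
    (h : (wron a b f g).coeff n ≠ 0) :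
    ∃ i j, i + j = n + 1 ∧ f.coeff i ≠ 0 ∧ g.coeff j ≠ 0 := by
  by_contra hc
  push Not at hc
  apply h
  rw [← coeff_X_mul, X_mul_wron, coeff_sub, coeff_smul, coeff_smul, coeff_mul, coeff_mul,
    Finset.sum_eq_zero, Finset.sum_eq_zero]
  · simp
  · rintro ⟨i, j⟩ hij
    rw [Finset.HasAntidiagonal.mem_antidiagonal] at hij
    rw [coeff_X_mul_derivative]
    by_cases h0 : f.coeff i = 0
    · simp [h0]
    · simp [hc i j hij h0]
  · rintro ⟨i, j⟩ hij
    rw [Finset.HasAntidiagonal.mem_antidiagonal] at hij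
    rw [coeff_X_mul_derivative]
    by_cases h0 : f.coeff i = 0
    · simp [h0]
    · simp [hc i j hij h0]

theorem comp_X_add_C_ne_zero {f : K[X]} (hf : f ≠ 0) (μ : K) : f.comp (X + C μ) ≠ 0 := by
  rwa [ne_eq, comp_X_add_C_eq_zero_iff]

section AlgClosed

variable [IsAlgClosed K]

/-- A split polynomial whose only root is `0` is a monomial. -/
theorem exists_root_ne_zero {f : K[X]} (hf : 1 < f.support.card) : ∃ μ, μ ≠ 0 ∧ f.IsRoot μ := by
  have hf0 : f ≠ 0 := by rintro rfl; simp at hf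
  by_contra hc
  push Not at hc
  have hr : f.roots = Multiset.replicate (Multiset.card f.roots) 0 := by
    rw [Multiset.eq_replicate]
    refine ⟨rfl, fun μ hμ => ?_⟩
    by_contra h0
    exact hc μ h0 (isRoot_of_mem_roots hμ)
  have e := (IsAlgClosed.splits f).eq_prod_roots
  rw [hr, Multiset.map_replicate, Multiset.prod_replicate, C_0, sub_zero,
    C_mul_X_pow_eq_monomial] at e
  have : f.support.card ≤ 1 := by
    rw [e]; exact card_support_le_one_iff_monomial.mpr ⟨_, _, rfl⟩
  omega

/-- There are at most `deg F` distinct roots of `f`, each counted at most `M` times. -/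
theorem natDegree_le_card_mul_of_rootMultiplicity_le {f F : K[X]} (hF : F ≠ 0) {M : ℕ}
    (hM : ∀ μ, f.rootMultiplicity μ ≤ M) (hroot : ∀ μ, f ≠ 0 → f.IsRoot μ → F.IsRoot μ) :
    f.natDegree ≤ F.natDegree * M := by
  classical
  by_cases hf : f = 0
  · simp [hf]
  rw [(IsAlgClosed.splits f).natDegree_eq_card_roots, ← Multiset.toFinset_sum_count_eq]
  calc ∑ μ ∈ f.roots.toFinset, f.roots.count μ ≤ ∑ μ ∈ f.roots.toFinset, M :=
        Finset.sum_le_sum fun μ _ => by rw [count_roots]; exact hM μ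
    _ = f.roots.toFinset.card * M := by simp
    _ ≤ F.roots.toFinset.card * M := by
        refine Nat.mul_le_mul_right _ (Finset.card_le_card fun μ hμ => ?_)
        rw [Multiset.mem_toFinset, mem_roots hf] at hμ
        rw [Multiset.mem_toFinset, mem_roots hF]
        exact hroot μ hf hμ
    _ ≤ F.natDegree * M :=
        Nat.mul_le_mul_right _ ((Multiset.toFinset_card_le _).trans (card_roots' F))

end AlgClosed

variable [CharZero K]

theorem natDegree_of_wron_eq_zero {a b : ℚ} {f g : K[X]} (hf : f ≠ 0) (hg : g ≠ 0)
    (h : wron a b f g = 0) : b * f.natDegree = a * g.natDegree := by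
  have e := coeff_X_mul_wron_natDegree a b f g
  rw [h, mul_zero, coeff_zero, eq_comm, mul_eq_zero_iff_right (by simp [hf, hg]), sub_eq_zero] at e
  exact_mod_cast e

theorem natTrailingDegree_of_wron_eq_zero {a b : ℚ} {f g : K[X]} (hf : f ≠ 0) (hg : g ≠ 0)
    (h : wron a b f g = 0) : b * f.natTrailingDegree = a * g.natTrailingDegree := by
  have e := coeff_X_mul_wron_of_lt a b
    (fun k (hk : k < f.natTrailingDegree) => coeff_eq_zero_of_lt_natTrailingDegree hk)
    (fun k (hk : k < g.natTrailingDegree) => coeff_eq_zero_of_lt_natTrailingDegree hk)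
  rw [h, mul_zero, coeff_zero, eq_comm, mul_eq_zero_iff_right, sub_eq_zero] at e
  · exact_mod_cast e
  · exact mul_ne_zero (trailingCoeff_nonzero_iff_nonzero.mpr hf)
      (trailingCoeff_nonzero_iff_nonzero.mpr hg)

/-- If `b f' g - a f g' = κ` is constant and `f` is a monomial but `g` is not, where `f` and `g`
have degrees proportional to `a` and `b`, then `f` has degree one. -/
theorem natDegree_eq_one_of_wron_eq_C {a b : ℚ} (ha : 0 < a) {f g : K[X]}
    (hf : f ≠ 0) (hdeg : b * f.natDegree = a * g.natDegree) {κ : K} (h : wron a b f g = C κ)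
    (hf1 : f.support.card ≤ 1) (hg1 : 1 < g.support.card) : f.natDegree = 1 := by
  obtain ⟨m, c, rfl⟩ := card_support_le_one_iff_monomial.mp hf1
  have hc : c ≠ 0 := by rintro rfl; simp at hf
  rw [natDegree_monomial_eq m hc] at hdeg ⊢
  obtain ⟨k, hk, hkn⟩ := Finset.exists_mem_ne hg1 g.natDegree
  have hlt : k < g.natDegree := lt_of_le_of_ne (le_natDegree_of_mem_supp k hk) hkn
  -- As `f` is a monomial, only the `k`-th coefficient of `g` contributes in degree `m + k`. For `k`
  -- below the degree of `g` the factor `b m - a k` is non-zero, whereas `X * C κ` lives in degree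
  -- `1` only.
  have e : (X * wron a b (monomial m c) g).coeff (m + k) = (b * m - a * k) * (c * g.coeff k) := by
    have e0 : (X * derivative (monomial m c) : K[X]) = monomial m (c * m) := by
      rcases m with _ | m <;> simp [X_mul_monomial]
    rw [X_mul_wron, e0, coeff_sub, coeff_smul, coeff_smul, add_comm m k, coeff_monomial_mul,
      coeff_monomial_mul, coeff_X_mul_derivative, smul_eq_mul, smul_eq_mul]
    ring
  have hne : (b * m - a * k : K) * (c * g.coeff k) ≠ 0 := by
    refine mul_ne_zero ?_ (mul_ne_zero hc (mem_support_iff.mp hk))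
    have : b * m - a * k ≠ 0 := by
      rw [hdeg, ← mul_sub]
      have : (k : ℚ) < g.natDegree := by exact_mod_cast hlt
      exact mul_ne_zero ha.ne' (by linarith)
    exact_mod_cast this
  rw [← e, h, mul_comm, coeff_C_mul, coeff_X] at hne
  have h1 : m + k = 1 := by
    by_contra h'
    rw [if_neg (by omega), mul_zero] at hne
    exact hne rfl
  have hm : m ≠ 0 := by
    rintro rfl
    rw [Nat.cast_zero, mul_zero, eq_comm, mul_eq_zero] at hdeg
    rcases hdeg with h | h
    · exact ha.ne' h
    · have : g.natDegree = 0 := by exact_mod_cast h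
      omega
  omega

/-- Translation of `μ` to the origin turns multiplicity into trailing degree, where the lowest
coefficient of the Wronskian gives the relation. -/
theorem rootMultiplicity_of_wron_eq_zero {a b : ℚ} {f g : K[X]} (hf : f ≠ 0) (hg : g ≠ 0)
    (h : wron a b f g = 0) (μ : K) : b * f.rootMultiplicity μ = a * g.rootMultiplicity μ := by
  rw [rootMultiplicity_eq_natTrailingDegree, rootMultiplicity_eq_natTrailingDegree]
  refine natTrailingDegree_of_wron_eq_zero (comp_X_add_C_ne_zero hf μ) (comp_X_add_C_ne_zero hg μ) ?_
  rw [wron_comp, h, zero_comp]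

/-! ### The equation `c f' F - u f F' = r f` -/

section Equation

variable {u c r : ℚ} {f F : K[X]}

theorem ne_zero_of_wron_eq (hr : r ≠ 0) (hf : f ≠ 0) (h : wron u c f F = (r : K) • f) : F ≠ 0 := by
  rintro rfl
  have : (r : K) • f = 0 := by rw [← h]; simp [wron]
  rw [smul_eq_zero] at this
  rcases this with h | h
  · exact hr (by exact_mod_cast h)
  · exact hf h

/-- Translate `μ` to `0` and let `m > 0` be the order of `f`. After multiplication by `X`, degree
`m` gives `c m f_m F_0 = 0`, so `F_0 = 0`; degree `m + 1` then gives `(c m - u) f_m F_1 = r f_m ≠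
0`, which excludes `c m = u`. -/
theorem isRoot_and_ne_of_wron_eq (hc : c ≠ 0) (hr : r ≠ 0) (hf : f ≠ 0)
    (h : wron u c f F = (r : K) • f) {μ : K} (hμ : f.IsRoot μ) :
    F.IsRoot μ ∧ c * f.rootMultiplicity μ ≠ u := by
  have hm : 0 < f.rootMultiplicity μ := (rootMultiplicity_pos hf).mpr hμ
  rw [rootMultiplicity_eq_natTrailingDegree] at hm ⊢
  have h' : wron u c (f.comp (X + C μ)) (F.comp (X + C μ)) = (r : K) • f.comp (X + C μ) := by
    rw [wron_comp, h, smul_comp]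
  have hf' := comp_X_add_C_ne_zero hf μ
  have hroot : F.IsRoot μ ↔ (F.comp (X + C μ)).coeff 0 = 0 := by
    rw [coeff_zero_eq_eval_zero, eval_comp]; simp
  rw [hroot]
  generalize f.comp (X + C μ) = f' at *
  generalize F.comp (X + C μ) = F' at *
  have hlow : ∀ k < f'.natTrailingDegree, f'.coeff k = 0 :=
    fun k hk => coeff_eq_zero_of_lt_natTrailingDegree hk
  have htr : f'.coeff f'.natTrailingDegree ≠ 0 := trailingCoeff_nonzero_iff_nonzero.mpr hf'
  have e0 := coeff_X_mul_wron_of_lt u c hlow (n := 0) (g := F') (by simp)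
  obtain ⟨m, hm'⟩ := Nat.exists_eq_succ_of_ne_zero hm.ne'
  rw [h', add_zero, Nat.cast_zero, mul_zero, sub_zero, mul_smul_comm, coeff_smul] at e0
  nth_rw 1 [hm'] at e0
  rw [coeff_X_mul, hlow m (by omega), smul_zero, eq_comm, mul_eq_zero, mul_eq_zero] at e0
  have hF0 : F'.coeff 0 = 0 := by
    rcases e0 with (e0 | e0) | e0
    · exact absurd (by exact_mod_cast e0) hc
    · exact absurd (by exact_mod_cast e0) hm.ne'
    · exact (mul_eq_zero.mp e0).resolve_left htr
  refine ⟨hF0, fun hcu => ?_⟩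
  have e1 := coeff_X_mul_wron_of_lt u c hlow (n := 1) (g := F') (by simpa using hF0)
  have hcu' : (c * f'.natTrailingDegree : K) = u := by exact_mod_cast congrArg (Rat.cast : ℚ → K) hcu
  rw [h', hcu', Nat.cast_one, mul_one, sub_self, zero_mul, mul_smul_comm, coeff_smul,
    coeff_X_mul, smul_eq_mul, mul_eq_zero] at e1
  rcases e1 with e1 | e1
  · exact hr (by exact_mod_cast e1)
  · exact htr e1

/-- The right-hand side has degree `deg f`, below the formal top degree `deg f + deg F - 1` of the
Wronskian, whose coefficient there must vanish. -/
theorem natDegree_of_wron_eq (hf : f ≠ 0) (hF : 2 ≤ F.natDegree)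
    (h : wron u c f F = (r : K) • f) : c * f.natDegree = u * F.natDegree := by
  have e := coeff_X_mul_wron_natDegree u c f F
  have hF0 : F ≠ 0 := by rintro rfl; simp at hF
  obtain ⟨k, hk⟩ := Nat.exists_eq_succ_of_ne_zero (by omega : F.natDegree ≠ 0)
  rw [h, mul_smul_comm, coeff_smul] at e
  nth_rw 1 [hk] at e
  rw [Nat.add_succ, coeff_X_mul, coeff_eq_zero_of_natDegree_lt (by omega), smul_zero, eq_comm,
    mul_eq_zero_iff_right (by simp [hf, hF0]), sub_eq_zero] at e
  exact_mod_cast e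

/-- A polynomial `f` with several terms has a non-zero root, which `F` inherits; a non-zero monomial
has none. -/
theorem one_lt_card_support_of_wron_eq [IsAlgClosed K] (hc : c ≠ 0) (hr : r ≠ 0)
    (hf : 1 < f.support.card) (h : wron u c f F = (r : K) • f) : 1 < F.support.card := by
  have hf0 : f ≠ 0 := by rintro rfl; simp at hf
  obtain ⟨μ, hμ0, hμ⟩ := exists_root_ne_zero hf
  have hF := (isRoot_and_ne_of_wron_eq hc hr hf0 h hμ).1
  have hF0 := ne_zero_of_wron_eq hr hf0 h
  by_contra hle
  obtain ⟨m, a, rfl⟩ := card_support_le_one_iff_monomial.mp (not_lt.mp hle)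
  rw [IsRoot, eval_monomial, mul_eq_zero] at hF
  rcases hF with rfl | hF
  · simp at hF0
  · exact hμ0 (eq_zero_of_pow_eq_zero hF)

end Equation

end Wronskian

/-! ### The multiplicity bound and the solution by division -/

section Equation

variable {K : Type*} [Field K] [CharZero K] {u c r : ℚ} {f F : K[X]}

/-- A solution `F` of the equation forces a root of `f` of large multiplicity. -/
theorem lt_mul_rootMultiplicity_of_wron_eq [IsAlgClosed K] (hu : 0 < u) (hc : 0 < c) (hr : r ≠ 0)
    (hf : f ≠ 0) (h : wron u c f F = (r : K) • f) (hdeg : u < c * f.natDegree) {lam : K}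
    (hlam : ∀ μ, f.rootMultiplicity μ ≤ f.rootMultiplicity lam) :
    u < c * f.rootMultiplicity lam ∧ (F.natDegree = 1 → f.rootMultiplicity lam = f.natDegree) := by
  have hF := ne_zero_of_wron_eq hr hf h
  have hle := natDegree_le_card_mul_of_rootMultiplicity_le hF hlam
    fun μ _ hμ => (isRoot_and_ne_of_wron_eq hc.ne' hr hf h hμ).1
  have hD : 0 < f.natDegree := by
    rw [Nat.pos_iff_ne_zero]
    intro h0
    rw [h0, Nat.cast_zero, mul_zero] at hdeg
    linarith
  have hMD : f.rootMultiplicity lam ≤ f.natDegree := by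
    classical
    rw [← count_roots]
    exact (Multiset.count_le_card _ _).trans (card_roots' f)
  have h1 : F.natDegree = 1 → f.rootMultiplicity lam = f.natDegree := by
    intro h1
    rw [h1] at hle
    omega
  refine ⟨?_, h1⟩
  have hM : 0 < f.rootMultiplicity lam := by
    by_contra h0
    rw [Nat.pos_iff_ne_zero, not_not] at h0
    rw [h0] at hle
    omega
  have hne := (isRoot_and_ne_of_wron_eq hc.ne' hr hf h ((rootMultiplicity_pos hf).mp hM)).2
  -- A constant `F` has no roots, so `f` would have none. A linear `F` makes `λ` the only root of
  -- `f`, and the hypothesis on the degree applies. Otherwise `c deg f = u deg F` and `deg f ≤ M deg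
  -- F` give `u ≤ c M`, and equality is excluded by `hne`.
  rcases lt_trichotomy F.natDegree 1 with h2 | h2 | h2
  · rw [show F.natDegree = 0 by omega] at hle
    omega
  · rwa [h1 h2]
  · refine lt_of_le_of_ne ?_ hne.symm
    have e := natDegree_of_wron_eq hf h2 h
    have hk : (0 : ℚ) < F.natDegree := by exact_mod_cast (by omega : 0 < F.natDegree)
    have hle' : (f.natDegree : ℚ) ≤ F.natDegree * f.rootMultiplicity lam := by exact_mod_cast hle
    have h3 := mul_le_mul_of_nonneg_left hle' hc.le
    rw [e] at h3
    refine le_of_mul_le_mul_right ?_ hk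
    linarith

/-- The quotient `F = g₀ f / g₁` is a polynomial and solves the equation. -/
theorem exists_wron_eq [IsAlgClosed K] {w : ℚ} {g₀ g₁ : K[X]} (hu : 0 < u) (hc : 0 ≤ c)
    (hr : r ≠ 0) (hf : f ≠ 0)
    (hg₁ : g₁ ≠ 0) (h₀ : wron u w f g₀ = (r : K) • g₁) (h₁ : wron u (u + w - c) f g₁ = 0) :
    ∃ F : K[X], wron u c f F = (r : K) • f := by
  have hrK : (r : K) ≠ 0 := by exact_mod_cast hr
  have hg₀ : g₀ ≠ 0 := by
    rintro rfl
    have : (r : K) • g₁ = 0 := by rw [← h₀]; simp [wron]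
    rcases smul_eq_zero.mp this with h | h
    · exact hrK h
    · exact hg₁ h
  have hdvd : g₁ ∣ g₀ * f := by
    classical
    rw [IsAlgClosed.dvd_iff_roots_le_roots hg₁ (mul_ne_zero hg₀ hf), Multiset.le_iff_count]
    intro μ
    rw [count_roots, count_roots, rootMultiplicity_mul (mul_ne_zero hg₀ hf)]
    have e1 := rootMultiplicity_of_wron_eq_zero hf hg₁ h₁ μ
    simp only [rootMultiplicity_eq_natTrailingDegree] at e1 ⊢
    have hf' := comp_X_add_C_ne_zero hf μ
    have hg₀' := comp_X_add_C_ne_zero hg₀ μ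
    have h₀' : wron u w (f.comp (X + C μ)) (g₀.comp (X + C μ)) = (r : K) • g₁.comp (X + C μ) := by
      rw [wron_comp, h₀, smul_comp]
    generalize f.comp (X + C μ) = f' at *
    generalize g₀.comp (X + C μ) = g₀' at *
    generalize g₁.comp (X + C μ) = g₁' at *
    have e := coeff_X_mul_wron_of_lt u w
      (fun k (hk : k < f'.natTrailingDegree) => coeff_eq_zero_of_lt_natTrailingDegree hk)
      (fun k (hk : k < g₀'.natTrailingDegree) => coeff_eq_zero_of_lt_natTrailingDegree hk)
    -- If the lowest Wronskian coefficient cancels, then `w ord f = u ord g₀`, and `e1` gives `u ord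
    -- g₁ = u (ord g₀ + ord f) - c ord f`. If not, that coefficient is visible in `g₁`, whose order
    -- is at most `ord f + ord g₀ - 1`.
    by_cases hz : w * f'.natTrailingDegree - u * g₀'.natTrailingDegree = 0
    · have hcm : 0 ≤ c * f'.natTrailingDegree := by positivity
      have : u * (g₁'.natTrailingDegree : ℚ)
          ≤ u * (g₀'.natTrailingDegree + f'.natTrailingDegree : ℚ) := by linarith
      exact_mod_cast le_of_mul_le_mul_left this hu
    · have hz' : (w * f'.natTrailingDegree - u * g₀'.natTrailingDegree : K) ≠ 0 := by
        exact_mod_cast hz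
      have hne : (X * wron u w f' g₀').coeff (f'.natTrailingDegree + g₀'.natTrailingDegree) ≠ 0 := by
        rw [e]
        exact mul_ne_zero hz' (mul_ne_zero (trailingCoeff_nonzero_iff_nonzero.mpr hf')
          (trailingCoeff_nonzero_iff_nonzero.mpr hg₀'))
      rw [h₀', mul_smul_comm, coeff_smul] at hne
      have hne := right_ne_zero_of_smul hne
      rcases hs : f'.natTrailingDegree + g₀'.natTrailingDegree with _ | s
      · rw [hs] at hne; simp at hne
      · rw [hs, coeff_X_mul] at hne
        have := natTrailingDegree_le_of_ne_zero hne
        omega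
  obtain ⟨F, hF⟩ := hdvd
  -- With the denominator `g₁²` cleared, this is the quotient rule for `F = g₀ f / g₁`: bracketing
  -- with `f` annihilates `f` and `g₁` and sends `g₀` to `r g₁`.
  refine ⟨F, mul_left_cancel₀ (mul_ne_zero hg₁ hg₁) ?_⟩
  have hd := congrArg derivative hF
  rw [derivative_mul, derivative_mul] at hd
  simp only [wron, smul_eq_C_mul] at h₀ h₁ ⊢
  have hw : (C ((u + w - c : ℚ) : K) : K[X]) = C (u : K) + C (w : K) - C (c : K) := by
    push_cast; simp
  rw [hw] at h₁
  linear_combination (-(C (u : K) + C (w : K)) * derivative f * g₁) * hF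
    + (C (u : K) * f * g₁) * hd - (g₁ * F) * h₁ + (f * g₁) * h₀

end Equation

/-! ### Restriction of a solution to admissible exponents -/

section Coset

variable {K : Type*} [Field K] {u c r : ℚ} {f F : K[X]}

/-- The solution may be chosen with exponents in a prescribed coset. -/
theorem exists_wron_eq_of_coset {s : ℚ} (H : AddSubgroup ℚ) (hrH : r ∈ H)
    (hcr : c = r + s)
    (hfH : ∀ k, f.coeff k ≠ 0 → u - s * k ∈ H) (h : wron u c f F = (r : K) • f) :
    ∃ F' : K[X], wron u c f F' = (r : K) • f ∧ ∀ k, F'.coeff k ≠ 0 → c - s * k ∈ H := by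
  classical
  -- The part of `F` supported in the prescribed coset.
  let G : K[X] := ∑ k ∈ F.support.filter fun k : ℕ => c - s * (k : ℚ) ∈ H, monomial k (F.coeff k)
  have hG : ∀ k, G.coeff k = if c - s * (k : ℚ) ∈ H then F.coeff k else 0 := by
    intro k
    simp only [G, finsetSum_coeff, coeff_monomial]
    rw [Finset.sum_ite_eq']
    simp only [Finset.mem_filter, mem_support_iff]
    by_cases h0 : F.coeff k = 0 <;> simp [h0]
  have hGH : ∀ k, G.coeff k ≠ 0 → c - s * (k : ℚ) ∈ H := by
    intro k hk
    by_contra hc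
    rw [hG, if_neg hc] at hk
    exact hk rfl
  refine ⟨G, ?_, hGH⟩
  have hB : ∀ k, (F - G).coeff k ≠ 0 → c - s * (k : ℚ) ∉ H := by
    intro k hk hc
    rw [coeff_sub, hG, if_pos hc, sub_self] at hk
    exact hk rfl
  have hsum : wron u c f G + wron u c f (F - G) = (r : K) • f := by
    rw [← wron_add_right, add_sub_cancel, h]
  ext n
  by_cases hn : u - s * (n : ℚ) ∈ H
  -- Exponents add up to `n + 1` in the Wronskian. Since those of `f` are admissible, `G`
  -- contributes only to admissible `n` and `F - G` only to the others, so the equation splits.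
  · have h0 : (wron u c f (F - G)).coeff n = 0 := by
      by_contra hne
      obtain ⟨i, j, hij, hi, hj⟩ := exists_of_coeff_wron_ne_zero hne
      apply hB j hj
      have hij' : (i : ℚ) + j = n + 1 := by exact_mod_cast hij
      have := H.add_mem (H.sub_mem hn (hfH i hi)) hrH
      convert this using 1
      rw [hcr]
      linear_combination s * (-hij')
    rw [← hsum, coeff_add, h0, add_zero]
  · have h0 : (wron u c f G).coeff n = 0 := by
      by_contra hne
      obtain ⟨i, j, hij, hi, hj⟩ := exists_of_coeff_wron_ne_zero hne
      apply hn
      have hij' : (i : ℚ) + j = n + 1 := by exact_mod_cast hij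
      have := H.sub_mem (H.add_mem (hGH j hj) (hfH i hi)) hrH
      convert this using 1
      rw [hcr]
      linear_combination s * hij'
    rw [h0, coeff_smul, not_not.mp fun h' => hn (hfH n h'), smul_zero]

end Coset

/-! ### Leading terms, end points and brackets in terms of one-variable polynomials -/

section Leading

variable {K : Type*} [Field K] {l : ℕ} {d : ℤ × ℤ} {p : K[T;T⁻¹][X]} {u : ℚ} {f : K[X]}

theorem mem_suppL {q : ℚ × ℚ} :
    q ∈ suppL l p ↔ ∃ i j, cf p i j ≠ 0 ∧ q = ((i : ℚ) / (l : ℚ), (j : ℚ)) := by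
  simp only [suppL, Finset.mem_biUnion, Finset.mem_image, Finsupp.mem_support_iff]
  constructor
  · rintro ⟨j, -, i, hi, rfl⟩
    exact ⟨i, j, hi, rfl⟩
  · rintro ⟨i, j, hi, rfl⟩
    refine ⟨j, ?_, i, hi, rfl⟩
    rw [mem_support_iff]
    intro h
    apply hi
    rw [cf, h]
    rfl

theorem mem_Fil_iff_suppL : p ∈ Fil K l d.1 d.2 u ↔ ∀ q ∈ suppL l p, vPt d q ≤ u := by
  constructor
  · intro h q hq
    obtain ⟨i, j, hij, rfl⟩ := mem_suppL.mp hq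
    exact h i j hij
  · intro h i j hij
    exact h _ (mem_suppL.mpr ⟨i, j, hij, rfl⟩)

theorem sup_coe_eq {ι : Type*} {s : Finset ι} {g : ι → ℚ} {M : ℚ} (h : ∀ q ∈ s, g q ≤ M)
    (h' : ∃ q ∈ s, g q = M) : (s.sup fun q => (g q : WithBot ℚ)) = (M : WithBot ℚ) := by
  obtain ⟨q, hq, rfl⟩ := h'
  exact le_antisymm (Finset.sup_le fun r hr => WithBot.coe_le_coe.mpr (h r hr))
    (Finset.le_sup (f := fun q => (g q : WithBot ℚ)) hq)

theorem degL_eq (h : p ∈ Fil K l d.1 d.2 u) (h' : ∃ q ∈ suppL l p, vPt d q = u) :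
    degL l d p = (u : WithBot ℚ) :=
  sup_coe_eq (mem_Fil_iff_suppL.mp h) h'

theorem vL_eq (h : p ∈ Fil K l d.1 d.2 u) (h' : ∃ q ∈ suppL l p, vPt d q = u) :
    vL l d p = u := by
  rw [vL, degL_eq h h']; rfl

theorem suppL_nonempty (hp : p ≠ 0) : (suppL l p).Nonempty := by
  by_contra h
  apply hp
  apply cf_ext
  intro i j
  rw [cf_zero]
  by_contra hij
  exact h ⟨_, mem_suppL.mpr ⟨i, j, hij, rfl⟩⟩

theorem vL_spec (d : ℤ × ℤ) (hp : p ≠ 0) :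
    p ∈ Fil K l d.1 d.2 (vL l d p) ∧ ∃ q ∈ suppL l p, vPt d q = vL l d p := by
  obtain ⟨q, hq, h⟩ := Finset.exists_max_image (suppL l p) (vPt d) (suppL_nonempty hp)
  have h1 : p ∈ Fil K l d.1 d.2 (vPt d q) := mem_Fil_iff_suppL.mpr h
  rw [vL_eq h1 ⟨q, hq, rfl⟩]
  exact ⟨h1, q, hq, rfl⟩

theorem cf_ellL (i : ℤ) (j : ℕ) :
    cf (ellL l d p) i j = if wt l d.1 d.2 i j = vL l d p then cf p i j else 0 := by
  classical
  have e : ellL l d p = ∑ j' ∈ p.support, ∑ i' ∈ (p.coeff j').coeff.support,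
      if wt l d.1 d.2 i' j' = vL l d p then mono i' j' (cf p i' j') else 0 := by
    unfold ellL
    refine Finset.sum_congr rfl fun j' _ => ?_
    rw [Finset.sum_filter]
    rfl
  have hadd : ∀ p q : K[T;T⁻¹][X], cf (p + q) i j = cf p i j + cf q i j := fun p q => cf_add p q i j
  let ev : K[T;T⁻¹][X] →+ K := ⟨⟨fun p => cf p i j, cf_zero i j⟩, hadd⟩
  have e1 : cf (ellL l d p) i j = ev (ellL l d p) := rfl
  have e2 : cf p i j = ev p := rfl
  have e3 : ev p = ∑ j' ∈ p.support, ∑ i' ∈ (p.coeff j').coeff.support,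
      ev (mono i' j' (cf p i' j')) := by
    conv_lhs => rw [eq_sum_mono p]
    simp only [map_sum]
  rw [e1, e2, e, e3]
  simp only [map_sum]
  have hev : ∀ i' j' c, ev (mono i' j' c) = if i' = i ∧ j' = j then c else 0 :=
    fun i' j' c => cf_mono i' i j' j c
  split_ifs with h
  · refine Finset.sum_congr rfl fun j' _ => Finset.sum_congr rfl fun i' _ => ?_
    split_ifs with h'
    · rfl
    · rw [map_zero, hev, if_neg]
      rintro ⟨rfl, rfl⟩
      exact h' h
  · refine Finset.sum_eq_zero fun j' _ => Finset.sum_eq_zero fun i' _ => ?_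
    split_ifs with h'
    · rw [hev, if_neg]
      rintro ⟨rfl, rfl⟩
      exact h h'
    · exact map_zero _

theorem mem_suppL_ellL {q : ℚ × ℚ} :
    q ∈ suppL l (ellL l d p) ↔ q ∈ suppL l p ∧ vPt d q = vL l d p := by
  simp only [mem_suppL, cf_ellL]
  constructor
  · rintro ⟨i, j, hij, rfl⟩
    split_ifs at hij with h
    · exact ⟨⟨i, j, hij, rfl⟩, h⟩
    · exact absurd rfl hij
  · rintro ⟨⟨i, j, hij, rfl⟩, h⟩
    exact ⟨i, j, by rwa [if_pos (show wt l d.1 d.2 i j = _ from h)], rfl⟩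

theorem ellL_ne_zero (hp : p ≠ 0) : ellL l d p ≠ 0 := by
  obtain ⟨q, hq, h⟩ := (vL_spec (l := l) d hp).2
  have := mem_suppL_ellL.mpr ⟨hq, h⟩
  intro h0
  obtain ⟨i, j, hij, -⟩ := mem_suppL.mp this
  rw [h0] at hij
  exact hij (cf_zero i j)

theorem hom_congr {α β : ℚ} {q : K[T;T⁻¹][X]}
    (h : ∀ i j, wt l α β i j = u → cf p i j = cf q i j) :
    hom K l α β u p = hom K l α β u q := by
  rw [← sub_eq_zero, ← map_sub]
  ext j
  by_contra hne
  obtain ⟨i, hi, hij⟩ := exists_of_hom_coeff_ne_zero u _ hne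
  apply hij
  have : cf (p - q) i j = cf p i j - cf q i j := by simp [cf]
  rw [this, h i j hi, sub_self]

theorem hom_ellL : hom K l d.1 d.2 (vL l d p) (ellL l d p) = hom K l d.1 d.2 (vL l d p) p :=
  hom_congr fun i j h => by rw [cf_ellL, if_pos h]

variable (l d p u f) in
/-- The `d`-degree of `p` is `u` and its leading term corresponds to the polynomial `f`. -/
structure Lead : Prop where
  mem : p ∈ Fil K l d.1 d.2 u
  hom_eq : hom K l d.1 d.2 u p = f
  ne_zero : f ≠ 0

theorem Lead.p_ne_zero (h : Lead l d p u f) : p ≠ 0 := by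
  rintro rfl
  exact h.ne_zero (by rw [← h.hom_eq, map_zero])

theorem Lead.exists_mem (h : Lead l d p u f) {j : ℕ} (hj : f.coeff j ≠ 0) :
    ∃ q ∈ suppL l p, vPt d q = u ∧ q.2 = j := by
  rw [← h.hom_eq] at hj
  obtain ⟨i, hi, hij⟩ := exists_of_hom_coeff_ne_zero u p hj
  exact ⟨_, mem_suppL.mpr ⟨i, j, hij, rfl⟩, hi, rfl⟩

theorem Lead.degL_eq (h : Lead l d p u f) : degL l d p = (u : WithBot ℚ) := by
  obtain ⟨q, hq, hu, -⟩ := h.exists_mem (leadingCoeff_ne_zero.mpr h.ne_zero)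
  exact WeylFrac.degL_eq h.mem ⟨q, hq, hu⟩

theorem Lead.vL_eq (h : Lead l d p u f) : vL l d p = u := by
  rw [vL, h.degL_eq]; rfl

theorem lead_vL (hl : 0 < l) (hd : 0 < d.1) (hp : p ≠ 0) :
    Lead l d p (vL l d p) (hom K l d.1 d.2 (vL l d p) p) := by
  obtain ⟨h, q, hq, hu⟩ := vL_spec (l := l) d hp
  refine ⟨h, rfl, fun h0 => ?_⟩
  obtain ⟨i, j, hij, rfl⟩ := mem_suppL.mp hq
  apply hij
  rw [← hom_coeff hl (by exact_mod_cast hd.ne') _ p (show wt l d.1 d.2 i j = _ from hu), h0,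
    coeff_zero]

/-- Since `ρ ≠ 0`, the weight `u` and the exponent of `y` determine the exponent of `x`. -/
theorem Lead.mem_suppL_ellL_iff (h : Lead l d p u f) (hl : 0 < l) (hd : 0 < d.1) {q : ℚ × ℚ} :
    q ∈ suppL l (ellL l d p) ↔ ∃ j, f.coeff j ≠ 0 ∧ q = ((u - d.2 * j) / d.1, (j : ℚ)) := by
  have hd' : (d.1 : ℚ) ≠ 0 := by exact_mod_cast hd.ne'
  rw [mem_suppL_ellL, h.vL_eq]
  constructor
  · rintro ⟨hq, hu⟩
    obtain ⟨i, j, hij, rfl⟩ := mem_suppL.mp hq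
    refine ⟨j, ?_, ?_⟩
    · rwa [← h.hom_eq, hom_coeff hl hd' u p (show wt l d.1 d.2 i j = _ from hu)]
    · rw [← hu, vPt]
      ext
      · simp only; field_simp; ring
      · rfl
  · rintro ⟨j, hj, rfl⟩
    obtain ⟨q, hq, hu, h2⟩ := h.exists_mem hj
    have : q = ((u - d.2 * j) / d.1, (j : ℚ)) := by
      rw [← hu, vPt, ← h2]
      ext
      · simp only; field_simp; ring
      · rfl
    rw [← this]
    exact ⟨hq, hu⟩

theorem Lead.suppL_ellL (h : Lead l d p u f) (hl : 0 < l) (hd : 0 < d.1) :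
    suppL l (ellL l d p) = f.support.image fun j : ℕ => ((u - d.2 * j) / d.1, (j : ℚ)) := by
  ext q
  rw [h.mem_suppL_ellL_iff hl hd, Finset.mem_image]
  simp only [mem_support_iff, eq_comm]

theorem Lead.card_suppL_ellL (h : Lead l d p u f) (hl : 0 < l) (hd : 0 < d.1) :
    (suppL l (ellL l d p)).card = f.support.card := by
  rw [h.suppL_ellL hl hd, Finset.card_image_of_injective]
  intro i j hij
  simpa using congrArg Prod.snd hij

/-- On the line `ρ a + σ b = u` the difference `b - a` increases with `b`, because `ρ > 0` and `ρ +
σ > 0`. The end point is therefore the point of highest degree in `y`, and dually the starting point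
is the lowest. -/
theorem Lead.wbarL_eq (h : Lead l d p u f) (hl : 0 < l) (hd : 0 < d.1) (hd' : 0 < d.1 + d.2) :
    wbarL l (ellL l d p) = ((u - d.2 * f.natDegree) / d.1, (f.natDegree : ℚ)) := by
  have hρ : (0 : ℚ) < d.1 := by exact_mod_cast hd
  have hs : (0 : ℚ) < d.1 + d.2 := by exact_mod_cast hd'
  have htop : ((u - d.2 * f.natDegree) / d.1, (f.natDegree : ℚ)) ∈ suppL l (ellL l d p) :=
    (h.mem_suppL_ellL_iff hl hd).mpr ⟨_, leadingCoeff_ne_zero.mpr h.ne_zero, rfl⟩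
  have hle : ∀ q ∈ suppL l (ellL l d p), q.2 ≤ f.natDegree ∧ vPt d q = u := by
    intro q hq
    obtain ⟨j, hj, rfl⟩ := (h.mem_suppL_ellL_iff hl hd).mp hq
    refine ⟨Nat.cast_le.mpr (le_natDegree_of_ne_zero hj), ?_⟩
    simp only [vPt]; field_simp; ring
  have hv : vL l (-1, 1) (ellL l d p)
      = f.natDegree - (u - d.2 * f.natDegree) / d.1 := by
    refine WeylFrac.vL_eq (mem_Fil_iff_suppL.mpr fun q hq => ?_) ⟨_, htop, ?_⟩
    · obtain ⟨h1, h2⟩ := hle q hq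
      have h3 : q.1 = (u - d.2 * q.2) / d.1 := by
        rw [← h2, vPt]; field_simp; ring
      simp only [vPt]
      rw [h3]
      push_cast
      have h4 := mul_le_mul_of_nonneg_left h1 hs.le
      rw [← sub_nonneg]
      have : (f.natDegree - (u - d.2 * f.natDegree) / d.1
          - (-1 * ((u - d.2 * q.2) / d.1) + 1 * q.2) : ℚ)
          = ((d.1 + d.2) * f.natDegree - (d.1 + d.2) * q.2) / d.1 := by field_simp; ring
      rw [this]
      exact div_nonneg (by linarith) hρ.le
    · simp only [vPt]; push_cast; ring
  have hb : ((suppL l (ellL l (-1, 1) (ellL l d p))).sup fun p => (p.2 : WithBot ℚ))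
      = ((f.natDegree : ℚ) : WithBot ℚ) := by
    refine sup_coe_eq (fun q hq => (hle q (mem_suppL_ellL.mp hq).1).1) ⟨_, mem_suppL_ellL.mpr
      ⟨htop, ?_⟩, rfl⟩
    rw [hv]; simp only [vPt]; push_cast; ring
  simp only [wbarL, hb, WithBot.unbotD_coe, hv]
  ext
  · simp only; ring
  · rfl

theorem Lead.wL_eq (h : Lead l d p u f) (hl : 0 < l) (hd : 0 < d.1) (hd' : 0 < d.1 + d.2) :
    wL l (ellL l d p)
      = ((u - d.2 * f.natTrailingDegree) / d.1, (f.natTrailingDegree : ℚ)) := by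
  have hρ : (0 : ℚ) < d.1 := by exact_mod_cast hd
  have hs : (0 : ℚ) < d.1 + d.2 := by exact_mod_cast hd'
  have htop : ((u - d.2 * f.natTrailingDegree) / d.1, (f.natTrailingDegree : ℚ))
      ∈ suppL l (ellL l d p) :=
    (h.mem_suppL_ellL_iff hl hd).mpr ⟨_, trailingCoeff_nonzero_iff_nonzero.mpr h.ne_zero, rfl⟩
  have hle : ∀ q ∈ suppL l (ellL l d p), (f.natTrailingDegree : ℚ) ≤ q.2 ∧
      q.1 = (u - d.2 * q.2) / d.1 := by
    intro q hq
    obtain ⟨j, hj, rfl⟩ := (h.mem_suppL_ellL_iff hl hd).mp hq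
    exact ⟨Nat.cast_le.mpr (natTrailingDegree_le_of_ne_zero hj), rfl⟩
  have key : ∀ q : ℚ × ℚ, q.1 = (u - d.2 * q.2) / d.1 →
      (u - d.2 * f.natTrailingDegree) / d.1 - f.natTrailingDegree - (q.1 - q.2)
      = (d.1 + d.2) * (q.2 - f.natTrailingDegree) / d.1 := by
    intro q h3
    rw [h3]; field_simp; ring
  have hv : vL l (1, -1) (ellL l d p)
      = (u - d.2 * f.natTrailingDegree) / d.1 - f.natTrailingDegree := by
    refine WeylFrac.vL_eq (mem_Fil_iff_suppL.mpr fun q hq => ?_) ⟨_, htop, ?_⟩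
    · obtain ⟨h1, h3⟩ := hle q hq
      have h4 : 0 ≤ (d.1 + d.2) * (q.2 - f.natTrailingDegree) / (d.1 : ℚ) :=
        div_nonneg (mul_nonneg hs.le (by linarith)) hρ.le
      rw [← key q h3] at h4
      simp only [vPt]; push_cast; linarith
    · simp only [vPt]; push_cast; ring
  have hb : ((suppL l (ellL l (1, -1) (ellL l d p))).sup fun p => (p.1 : WithBot ℚ))
      = (((u - d.2 * f.natTrailingDegree) / d.1 : ℚ) : WithBot ℚ) := by
    refine sup_coe_eq (fun q hq => ?_) ⟨_, mem_suppL_ellL.mpr ⟨htop, ?_⟩, rfl⟩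
    · obtain ⟨hq, hq'⟩ := mem_suppL_ellL.mp hq
      obtain ⟨h1, h3⟩ := hle q hq
      have h4 := key q h3
      rw [hv] at hq'
      simp only [vPt] at hq'
      push_cast at hq'
      have h5 : (d.1 + d.2) * (q.2 - f.natTrailingDegree) / (d.1 : ℚ) = 0 := by
        rw [← h4]; linarith
      rw [div_eq_zero_iff, or_iff_left hρ.ne', mul_eq_zero, or_iff_right hs.ne', sub_eq_zero] at h5
      rw [h3, h5]
    · rw [hv]; simp only [vPt]; push_cast; ring
  simp only [wL, hb, WithBot.unbotD_coe, hv]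
  ext
  · rfl
  · simp only; ring

theorem ellL_eq_of_lead (hl : 0 < l) (hd : 0 < d.1) {q : K[T;T⁻¹][X]}
    (hp : Lead l d p u f) (hq : Lead l d q u f) : ellL l d p = ellL l d q := by
  have hd' : (d.1 : ℚ) ≠ 0 := by exact_mod_cast hd.ne'
  apply cf_ext
  intro i j
  rw [cf_ellL, cf_ellL, hp.vL_eq, hq.vL_eq]
  split_ifs with h
  · rw [← hom_coeff hl hd' u p h, ← hom_coeff hl hd' u q h, hp.hom_eq, hq.hom_eq]
  · rfl

theorem ellL_eq_of_sub_mem {q : K[T;T⁻¹][X]} {w : ℚ} (hp : p ≠ 0) (hw : w < vL l d p)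
    (h : q - p ∈ Fil K l d.1 d.2 w) : ellL l d q = ellL l d p := by
  obtain ⟨h1, s, hs, hs'⟩ := vL_spec (l := l) d hp
  have hcf : ∀ i j, wt l d.1 d.2 i j = vL l d p → cf q i j = cf p i j := by
    intro i j hij
    by_contra hne
    have : cf (q - p) i j = cf q i j - cf p i j := by simp [cf]
    have := h i j (by rw [this]; exact sub_ne_zero.mpr hne)
    linarith
  have hv : vL l d q = vL l d p := by
    obtain ⟨i, j, hij, rfl⟩ := mem_suppL.mp hs
    refine vL_eq ?_ ⟨_, mem_suppL.mpr ⟨i, j, ?_, rfl⟩, hs'⟩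
    · have := add_mem (Fil_mono hw.le h) h1
      rwa [sub_add_cancel] at this
    · rwa [hcf i j hs']
  apply cf_ext
  intro i j
  rw [cf_ellL, cf_ellL, hv]
  split_ifs with hij
  · exact hcf i j hij
  · rfl

end Leading

/-! ### Leading data of elements of `A₁^(l)` -/

section LeadingA

variable {K : Type*} [Field K] {l : ℕ} {d : ℤ × ℤ} {P Q : A1 K l} {u w : ℚ} {f g : K[X]}

theorem Lead.v_eq (h : Lead l d (Psi P) u f) : v d P = u := h.vL_eq

theorem Lead.en_eq (h : Lead l d (Psi P) u f) (hl : 0 < l) (hd : 0 < d.1) (hd' : 0 < d.1 + d.2) :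
    en d P = ((u - d.2 * f.natDegree) / d.1, (f.natDegree : ℚ)) := h.wbarL_eq hl hd hd'

theorem Lead.st_eq (h : Lead l d (Psi P) u f) (hl : 0 < l) (hd : 0 < d.1) (hd' : 0 < d.1 + d.2) :
    st d P = ((u - d.2 * f.natTrailingDegree) / d.1, (f.natTrailingDegree : ℚ)) := h.wL_eq hl hd hd'

/-- Every exponent of `y` in the leading term is at least `s`, so the subtraction `j - s` is not
truncated and the factor `X ^ s` undoes it. -/
theorem Lead.cutPoly_eq (h : Lead l d (Psi P) u f) (hl : 0 < l) (hd : 0 < d.1)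
    (hd' : 0 < d.1 + d.2) : cutPoly d P = f := by
  have hα : (d.1 : ℚ) ≠ 0 := by exact_mod_cast hd.ne'
  have hs : ⌊(st d P).2⌋₊ = f.natTrailingDegree := by
    rw [h.st_eq hl hd hd']; exact Nat.floor_natCast _
  have hf : f = hom K l d.1 d.2 u (ell d P) := by
    have := hom_ellL (l := l) (d := d) (p := Psi P)
    rw [h.vL_eq, h.hom_eq] at this
    exact this.symm
  have hmon : ∀ j ∈ (ell d P).support, ∀ i ∈ ((ell d P).coeff j).coeff.support,
      wt l d.1 d.2 i j = u ∧ f.natTrailingDegree ≤ j := by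
    intro j _ i hi
    have hi : cf (ell d P) i j ≠ 0 := Finsupp.mem_support_iff.mp hi
    have hw : wt l d.1 d.2 i j = u := by
      have hi' := hi
      rw [ell, cf_ellL, h.vL_eq] at hi'
      split_ifs at hi' with hw
      · exact hw
      · exact absurd rfl hi'
    refine ⟨hw, natTrailingDegree_le_of_ne_zero ?_⟩
    rw [hf, hom_coeff hl hα u _ hw]
    exact hi
  conv_rhs => rw [hf, eq_sum_mono (ell d P)]
  rw [cutPoly, assocPoly, hs, Finset.mul_sum, map_sum]
  refine Finset.sum_congr rfl fun j hj => ?_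
  rw [Finset.mul_sum, map_sum]
  refine Finset.sum_congr rfl fun i hi => ?_
  obtain ⟨h1, h2⟩ := hmon j hj i hi
  rw [hom_mono, if_pos h1, X_pow_mul_monomial, Nat.sub_add_cancel h2]
  rfl

theorem Lead.mem_Dir_iff (h : Lead l d (Psi P) u f) (hl : 0 < l) (hd : 0 < d.1) :
    d ∈ Dir P ↔ d ∈ V ∧ 1 < f.support.card := by
  rw [← h.card_suppL_ellL hl hd]; rfl

/-- The degree `v` takes the default value `0` at the zero element, so a non-zero value already
excludes it. -/
theorem exists_lead (hl : 0 < l) (hd : 0 < d.1) (hP : v d P ≠ 0) :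
    ∃ f, Lead l d (Psi P) (v d P) f := by
  refine ⟨_, lead_vL hl hd ?_⟩
  intro h
  apply hP
  simp [v, vL, degL, h, suppL]

theorem Lead.lead_incl [CharZero K] {h : ℕ} (hP : Lead l d (Psi P) u f) (hd : l ∣ h) (hh : 0 < h) :
    Lead h d (Psi (incl hd hh P)) u f :=
  ⟨incl_mem_Fil hd hh hP.mem, by rw [hom_incl, hP.hom_eq], hP.ne_zero⟩

theorem Lead.lead_shear {ρ σ : ℤ} {h : ℕ} {P : A1 K h} (hP : Lead h (ρ, σ) (Psi P) u f)
    (hh : 0 < h) (hρ : 0 < ρ) (hρσ : 0 < ρ + σ) (hdvd : ρ ∣ h) (lam : K) :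
    Lead h (ρ, σ) (Psi (shear h ρ σ lam P)) u (f.comp (X + C lam)) := by
  have hρσ' : (0 : ℚ) < ((ρ, σ) : ℤ × ℤ).1 + ((ρ, σ) : ℤ × ℤ).2 := by exact_mod_cast hρσ
  obtain ⟨e, he⟩ := hdvd
  have hwt : wt h ((ρ, σ) : ℤ × ℤ).1 ((ρ, σ) : ℤ × ℤ).2 ((h : ℤ) / ρ * σ) 0 = σ := by
    have : (h : ℚ) = ρ * e := by exact_mod_cast he
    have hh' : (h : ℚ) ≠ 0 := by positivity
    rw [he, Int.mul_ediv_cancel_left _ hρ.ne']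
    simp only [wt]
    push_cast
    rw [mul_zero, add_zero, mul_div_assoc', div_eq_iff hh', this]
    ring
  have hC : (C (lam • LaurentPolynomial.T ((h : ℤ) / ρ * σ)) : K[T;T⁻¹][X])
      = mono ((h : ℤ) / ρ * σ) 0 lam := by
    rw [mono, monomial_zero_left, LaurentPolynomial.T, AddMonoidAlgebra.smul_single, smul_eq_mul,
      mul_one]
  have hA : (C (lam • LaurentPolynomial.T ((h : ℤ) / ρ * σ)) : K[T;T⁻¹][X])
      ∈ Fil K h ((ρ, σ) : ℤ × ℤ).1 ((ρ, σ) : ℤ × ℤ).2 (((ρ, σ) : ℤ × ℤ).2 : ℚ) := by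
    rw [hC]; exact mono_mem_Fil _ hwt.le
  refine ⟨shift_mem_Fil hh hρσ'.le hA hP.mem, ?_, comp_X_add_C_ne_zero hP.ne_zero lam⟩
  rw [shear, hom_shift hh hρσ' hA (lam := lam) _ hP.mem, hP.hom_eq]
  rw [hC, hom_mono, if_pos hwt, monomial_zero_left]

/-- No non-vanishing is assumed of the right-hand side: it is the component in the expected top
weight, which may be zero. -/
theorem wron_of_lead [CharZero K] (hl : 0 < l) (hd' : 0 < d.1 + d.2) (hP : Lead l d (Psi P) u f)
    (hQ : Lead l d (Psi Q) w g) :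
    wron u w f g = (d.1 : K) • hom K l d.1 d.2 (u + w - (d.1 + d.2)) (Psi ⁅P, Q⁆) := by
  have := hom_lie (α := d.1) (β := d.2) hl (by exact_mod_cast hd') hP.mem hQ.mem
  rw [hP.hom_eq, hQ.hom_eq] at this
  rw [wron, ← this]
  simp

/-- The commutator `±1` has degree `0` in every direction, so proportionality is a comparison of `0`
with `u + w - (ρ + σ)`. -/
theorem bracket_eq_zero_iff (hP : v d P = u) (hQ : v d Q = w) (h : ⁅P, Q⁆ = 1 ∨ ⁅P, Q⁆ = -1) :
    bracket d P Q = 0 ↔ (d.1 + d.2 : ℚ) < u + w := by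
  have hmem : Psi ⁅P, Q⁆ ∈ Fil K l d.1 d.2 0 := by
    rcases h with h | h
    · rw [h]; exact Psi_one_mem_Fil
    · rw [h]; exact neg_mem (Psi_one_mem_Fil (K := K))
  have hsupp : ((0, 0) : ℚ × ℚ) ∈ suppL l (Psi ⁅P, Q⁆) := by
    refine mem_suppL.mpr ⟨0, 0, ?_, by simp⟩
    rcases h with h | h
    · rw [h, Psi_one, cf_mono]; simp
    · have : Psi (-1 : A1 K l) = -mono 0 0 1 := rfl
      rw [h, this, show cf (-mono 0 0 1 : K[T;T⁻¹][X]) 0 0 = -cf (mono 0 0 1) 0 0 by simp [cf],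
        cf_mono]
      simp
  have hdeg : deg d ⁅P, Q⁆ = ((0 : ℚ) : WithBot ℚ) :=
    degL_eq hmem ⟨_, hsupp, by simp [vPt]⟩
  have hne : ell d ⁅P, Q⁆ ≠ 0 := by
    refine ellL_ne_zero fun h0 => ?_
    rw [h0] at hsupp
    simp [suppL] at hsupp
  rw [bracket, Proportional, hdeg, hP, hQ, WithBot.coe_lt_coe]
  split_ifs with h'
  · simp only [true_iff]; linarith
  · simp only [hne, false_iff]
    intro h2
    exact h' (by linarith)

end LeadingA

/-! ### The subalgebra generated by `P` and `Q` with `[Q, P] = 1` -/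

section PQ

variable {K B : Type*} [Field K] [Ring B] [Algebra K B] {P Q : B}

variable (K P Q) in
/-- The linear map `∑ aⱼ(s) tʲ ↦ ∑ aⱼ(P) Qʲ`. -/
def evalPQ : K[X][X] →ₗ[K] B :=
  Polynomial.lsum (R := K) fun j => (LinearMap.mulRight K (Q ^ j)) ∘ₗ (aeval P).toLinearMap

theorem evalPQ_monomial (j : ℕ) (a : K[X]) :
    evalPQ K P Q (monomial j a) = aeval P a * Q ^ j := by
  simp [evalPQ, Polynomial.sum_monomial_index]

theorem lie_aeval (h : ⁅Q, P⁆ = 1) (a : K[X]) : ⁅Q, aeval P a⁆ = aeval P (derivative a) := by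
  rw [Ring.lie_def, sub_eq_iff_eq_add] at h
  induction a using Polynomial.induction_on' with
  | add p q hp hq =>
    rw [map_add, map_add, map_add, ← hp, ← hq]
    simp only [Ring.lie_def, mul_add, add_mul]
    abel
  | monomial n b =>
    rw [derivative_monomial, aeval_monomial, aeval_monomial, Ring.lie_def, ← mul_assoc Q,
      ← Algebra.commutes b Q, mul_assoc, mul_assoc, ← mul_sub, map_mul, mul_assoc]
    congr 1
    rw [map_natCast]
    induction n with
    | zero => simp
    | succ n ih =>
      rw [sub_eq_iff_eq_add] at ih
      rw [pow_succ', ← mul_assoc Q, h, add_mul, mul_assoc P, ih]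
      rcases n with _ | n
      · simp
      · rw [Nat.add_sub_cancel, Nat.add_sub_cancel, mul_add, one_mul, ← mul_assoc P (Nat.cast _),
          ← (Nat.cast_commute (n + 1) P).eq, mul_assoc _ P, ← pow_succ']
        push_cast
        noncomm_ring

theorem lie_pow (h : ⁅Q, P⁆ = 1) (j : ℕ) : ⁅P, Q ^ j⁆ = -(j * Q ^ (j - 1)) := by
  rw [Ring.lie_def, sub_eq_iff_eq_add] at h ⊢
  induction j with
  | zero => simp
  | succ j ih =>
    rw [pow_succ, ← mul_assoc, ih, add_mul, mul_assoc _ P, mul_assoc _ Q P, h]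
    rcases j with _ | j
    · simp
    · rw [Nat.add_sub_cancel, Nat.add_sub_cancel, neg_mul, mul_assoc, ← pow_succ]
      push_cast
      noncomm_ring

/-- The operator `ad P` acts as minus the derivative in the variable standing for `Q`, hence lowers
the degree in `Q`. Both the independence of the `PⁱQʲ` and the minimality argument below rest on
this. -/
theorem lie_evalPQ (h : ⁅Q, P⁆ = 1) (c : K[X][X]) :
    ⁅P, evalPQ K P Q c⁆ = evalPQ K P Q (-derivative c) := by
  induction c using Polynomial.induction_on' with
  | add p q hp hq =>
    rw [map_add, map_add, neg_add, map_add, ← hp, ← hq]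
    simp only [Ring.lie_def, mul_add, add_mul]
    abel
  | monomial n b =>
    rw [map_neg, derivative_monomial, evalPQ_monomial, evalPQ_monomial, map_mul, map_natCast,
      mul_assoc, ← mul_neg, ← lie_pow h, Ring.lie_def, Ring.lie_def, mul_sub, ← mul_assoc P,
      mul_assoc _ _ P]
    congr 1
    rw [← mul_assoc]
    congr 1
    have := congrArg (aeval P) (mul_comm X b)
    simpa using this

/-- Bracketing with `Q` differentiates a relation for `P`; in characteristic zero repeated
differentiation reduces it to a constant. -/
theorem aeval_injective_of_lie [CharZero K] [Nontrivial B] (h : ⁅Q, P⁆ = 1) :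
    Function.Injective (aeval P : K[X] →ₐ[K] B) := by
  rw [injective_iff_map_eq_zero]
  suffices H : ∀ n, ∀ a : K[X], a.natDegree = n → aeval P a = 0 → a = 0 from fun a => H _ a rfl
  intro n
  induction n using Nat.strong_induction_on with
  | _ n ih =>
    intro a ha h0
    have hd : a.natDegree = 0 := by
      by_contra hn
      have h1 : aeval P (derivative a) = 0 := by rw [← lie_aeval h, h0, Ring.lie_def, mul_zero, zero_mul, sub_zero]
      have := ih _ (by rw [← ha]; exact natDegree_derivative_lt hn) _ rfl h1
      exact hn (derivative_eq_zero.mp this)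
    rw [eq_C_of_natDegree_eq_zero hd] at h0 ⊢
    rw [aeval_C, map_eq_zero_iff _ (algebraMap K B).injective] at h0
    rw [h0, C_0]

theorem evalPQ_injective [CharZero K] [Nontrivial B] (h : ⁅Q, P⁆ = 1) :
    Function.Injective (evalPQ K P Q) := by
  rw [injective_iff_map_eq_zero]
  suffices H : ∀ n, ∀ c : K[X][X], c.natDegree = n → evalPQ K P Q c = 0 → c = 0 from
    fun c => H _ c rfl
  intro n
  induction n using Nat.strong_induction_on with
  | _ n ih =>
    intro c hc h0
    have hd : c.natDegree = 0 := by
      by_contra hn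
      have h1 : evalPQ K P Q (derivative c) = 0 := by
        rw [← neg_eq_zero, ← map_neg, ← lie_evalPQ h, h0, Ring.lie_def, mul_zero, zero_mul, sub_zero]
      have := ih _ (by rw [← hc]; exact natDegree_derivative_lt hn) _ rfl h1
      exact hn (derivative_eq_zero.mp this)
    rw [eq_C_of_natDegree_eq_zero hd] at h0 ⊢
    rw [← monomial_zero_left, evalPQ_monomial, pow_zero, mul_one,
      map_eq_zero_iff _ (aeval_injective_of_lie h)] at h0
    rw [h0, C_0]

variable (K) in
/-- Polynomials in two variables with degrees less than `n` and prescribed coefficients. -/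
def boxPoly (n : ℕ) : (Fin n × Fin n → K) →ₗ[K] K[X][X] :=
  Fintype.linearCombination K fun q : Fin n × Fin n => monomial (q.2 : ℕ) (monomial (q.1 : ℕ) (1 : K))

theorem boxPoly_injective (n : ℕ) : Function.Injective (boxPoly K n) := by
  rw [injective_iff_map_eq_zero]
  intro x hx
  ext ⟨i, j⟩
  have h := congrArg (fun c : K[X][X] => (c.coeff j).coeff i) hx
  simp only [boxPoly, Fintype.linearCombination_apply, finsetSum_coeff, coeff_smul, coeff_zero,
    coeff_monomial] at h
  rw [Finset.sum_eq_single (i, j)] at h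
  · simpa using h
  · rintro ⟨i', j'⟩ - hne
    by_cases hj : (j' : ℕ) = j
    · have hi : (i' : ℕ) ≠ i := by
        intro hi
        exact hne (Prod.ext (Fin.ext hi) (Fin.ext hj))
      simp [hj, coeff_monomial, hi]
    · simp [hj]
  · simp

end PQ

/-! ### Existence of the homogeneous element `F` -/

section ExistsF

variable {K : Type*} [Field K] {l : ℕ} {d : ℤ × ℤ} {P Q : A1 K l} {u : ℚ} {f : K[X]}

instance : Nontrivial (A1 K l) := by
  refine ⟨1, 0, fun h => ?_⟩
  have : cf (Psi (1 : A1 K l)) 0 0 = 0 := by rw [h]; exact cf_zero 0 0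
  rw [Psi_one, cf_mono] at this
  simp at this

theorem Psi_mem_Fil_natDegree (P : A1 K l) :
    Psi P ∈ Fil K l 0 1 ((Psi P).natDegree : ℚ) := by
  intro i j hij
  have : j ≤ (Psi P).natDegree := by
    refine le_natDegree_of_ne_zero fun h0 => hij ?_
    rw [cf, h0]; rfl
  simp only [wt]
  have : (j : ℚ) ≤ (Psi P).natDegree := by exact_mod_cast this
  linarith

/-- The weights `(0, 1)` measure the degree in `Y`; it grows only linearly in `n`, against the `n²`
free coefficients. -/
theorem Psi_evalPQ_boxPoly_mem (hl : 0 < l) (n : ℕ) (x : Fin n × Fin n → K) :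
    Psi (evalPQ K P Q (boxPoly K n x)) ∈ Fil K l 0 1
      ((n * ((Psi P).natDegree + (Psi Q).natDegree) : ℕ) : ℚ) := by
  have e : Psi (evalPQ K P Q (boxPoly K n x)) = ∑ q : Fin n × Fin n,
      x q • Psi (P ^ (q.1 : ℕ) * Q ^ (q.2 : ℕ)) := by
    rw [boxPoly, Fintype.linearCombination_apply, map_sum]
    have : ∀ s : Finset (Fin n × Fin n), ∀ y : Fin n × Fin n → A1 K l,
        Psi (∑ q ∈ s, y q) = ∑ q ∈ s, Psi (y q) := fun s y => map_sum (Ore.toPoly (der K l)) _ _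
    rw [this]
    refine Finset.sum_congr rfl fun q _ => ?_
    rw [map_smul, evalPQ_monomial, Psi_smul, aeval_monomial, map_one, one_mul]
  rw [e]
  refine sum_mem fun q _ => Submodule.smul_mem _ _ (Fil_mono ?_ (Psi_mem_mul hl (by norm_num)
    (Psi_pow_mem hl (by norm_num) (Psi_mem_Fil_natDegree P) _)
    (Psi_pow_mem hl (by norm_num) (Psi_mem_Fil_natDegree Q) _)))
  have h1 := Nat.mul_le_mul_right (Psi P).natDegree q.1.2.le
  have h2 := Nat.mul_le_mul_right (Psi Q).natDegree q.2.2.le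
  exact_mod_cast (by linarith : (q.1 : ℕ) * (Psi P).natDegree + q.2 * (Psi Q).natDegree
    ≤ n * ((Psi P).natDegree + (Psi Q).natDegree))

theorem exists_homog {α β : ℚ} (c : ℚ) (F : K[X]) (hF : ∀ k, F.coeff k ≠ 0 → ∃ i, wt l α β i k = c) :
    ∃ p : K[T;T⁻¹][X], hom K l α β c p = F ∧ ∀ i j, cf p i j ≠ 0 → wt l α β i j = c := by
  choose! i hi using hF
  refine ⟨∑ k ∈ F.support, mono (i k) k (F.coeff k), ?_, ?_⟩
  · conv_rhs => rw [F.as_sum_support]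
    rw [map_sum]
    refine Finset.sum_congr rfl fun k hk => ?_
    rw [hom_mono, if_pos (hi k (mem_support_iff.mp hk))]
  · have hneg : ∀ i j, wt l (-α) (-β) i j = -wt l α β i j := fun i j => by simp only [wt]; ring
    intro i' j hij
    refine le_antisymm ?_ ?_
    · have h1 : ∑ k ∈ F.support, mono (i k) k (F.coeff k) ∈ Fil K l α β c :=
        sum_mem fun k hk => mono_mem_Fil _ (hi k (mem_support_iff.mp hk)).le
      exact h1 i' j hij
    -- The filtration for the opposite weights supplies the lower bound.
    · have h1 : ∑ k ∈ F.support, mono (i k) k (F.coeff k) ∈ Fil K l (-α) (-β) (-c) :=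
        sum_mem fun k hk => mono_mem_Fil _ (by rw [hneg, hi k (mem_support_iff.mp hk)])
      have := h1 i' j hij
      rw [hneg] at this
      linarith

variable [CharZero K]

/-- Some polynomial in `P` and `Q` has a leading term which does not commute with the one of `P`. -/
theorem exists_wron_ne_zero (hl : 0 < l) (hd : 0 < d.1)
    (h : ⁅Q, P⁆ = 1) (hP : Lead l d (Psi P) u f) (hf : 0 < f.natDegree) :
    ∃ (c : K[X][X]) (w : ℚ) (g : K[X]), Lead l d (Psi (evalPQ K P Q c)) w g ∧ wron u w f g ≠ 0 := by
  by_contra hc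
  push Not at hc
  set a := (Psi P).natDegree + (Psi Q).natDegree with ha
  -- This makes `n² = n a + 2 n` exceed `n a + 1`, the dimension of the target of `Φ`.
  let n := a + 2
  -- If every leading polynomial `g` had zero Wronskian with `f`, its weight would be `u deg g / deg
  -- f`. One coefficient for each possible degree `k` would then detect every non-zero element.
  let Φ : A1 K l →ₗ[K] (Fin (n * a + 1) → K) := LinearMap.pi fun k =>
    (lcoeff K (k : ℕ)) ∘ₗ (hom K l d.1 d.2 (u * k / f.natDegree)) ∘ₗ
      (Ore.toPoly (der K l)).toLinearMap
  have hinj : Function.Injective (Φ ∘ₗ evalPQ K P Q ∘ₗ boxPoly K n) := by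
    rw [injective_iff_map_eq_zero]
    intro x hx
    by_contra hx0
    have hG : Psi (evalPQ K P Q (boxPoly K n x)) ≠ 0 := by
      rw [← Psi_zero, Psi_injective.ne_iff]
      rw [ne_eq, map_eq_zero_iff _ (evalPQ_injective h), map_eq_zero_iff _ (boxPoly_injective n)]
      exact hx0
    have hlead := lead_vL hl hd hG
    set w := vL l d (Psi (evalPQ K P Q (boxPoly K n x)))
    set g := hom K l d.1 d.2 w (Psi (evalPQ K P Q (boxPoly K n x))) with hg
    have hw := hc _ _ _ hlead
    have hdeg := natDegree_of_wron_eq_zero hP.ne_zero hlead.ne_zero hw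
    have hlc : g.coeff g.natDegree ≠ 0 := leadingCoeff_ne_zero.mpr hlead.ne_zero
    obtain ⟨i, -, hij⟩ := exists_of_hom_coeff_ne_zero _ _ hlc
    have hle := Psi_evalPQ_boxPoly_mem hl n x _ _ hij
    have hle : g.natDegree ≤ n * a := by
      simp only [wt, zero_mul, zero_add, one_mul] at hle
      exact_mod_cast hle
    have := congrFun hx ⟨g.natDegree, by omega⟩
    apply hlc
    have hf' : (f.natDegree : ℚ) ≠ 0 := by positivity
    have hww : w = u * g.natDegree / f.natDegree := by rw [← hdeg]; field_simp
    calc g.coeff g.natDegree = (hom K l d.1 d.2 (u * g.natDegree / f.natDegree)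
          (Psi (evalPQ K P Q (boxPoly K n x)))).coeff g.natDegree := by rw [← hww]
      _ = 0 := this
  have hfin := LinearMap.finrank_le_finrank_of_injective hinj
  rw [Module.finrank_fintype_fun_eq_card, Module.finrank_fintype_fun_eq_card, Fintype.card_prod,
    Fintype.card_fin, Fintype.card_fin] at hfin
  have : n * n = n * a + 2 * n := by simp only [n]; ring
  omega

/-- A polynomial in `P` and `Q` of least degree in `Q` with non-commuting leading term provides
`g₀`, and its bracket with `P` provides `g₁`; the solution is `g₀ f / g₁`, restricted to exponents
available in `A₁^(l)`. -/
theorem exists_homogeneous_solution [IsAlgClosed K] (hl : 0 < l) (hd : 0 < d.1)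
    (hd' : 0 < d.1 + d.2) (h : ⁅Q, P⁆ = 1) (hP : Lead l d (Psi P) u f) (hu : 0 < u)
    (hf : 0 < f.natDegree) :
    ∃ (F : A1 K l) (g : K[X]), IsHomog d F ∧ Lead l d (Psi F) (d.1 + d.2) g ∧
      wron u (d.1 + d.2) f g = ((d.1 : ℚ) : K) • f := by
  classical
  have hρ : (0 : ℚ) < d.1 := by exact_mod_cast hd
  have hs : (0 : ℚ) < d.1 + d.2 := by exact_mod_cast hd'
  obtain ⟨c₀, hc₀⟩ : ∃ c : K[X][X], ∃ (w : ℚ) (g : K[X]),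
    Lead l d (Psi (evalPQ K P Q c)) w g ∧ wron u w f g ≠ 0 := exists_wron_ne_zero hl hd h hP hf
  have hex : ∃ n, ∃ c : K[X][X], c.natDegree = n ∧ ∃ (w : ℚ) (g : K[X]),
    Lead l d (Psi (evalPQ K P Q c)) w g ∧ wron u w f g ≠ 0 := ⟨_, c₀, rfl, hc₀⟩
  obtain ⟨c, hcn, w, g₀, hG, hne⟩ := Nat.find_spec hex
  have hmin := fun m hm => Nat.find_min hex (m := m) hm
  rw [← hcn] at hmin
  have e := wron_of_lead hl hd' hP hG
  set g₁ := hom K l d.1 d.2 (u + w - (d.1 + d.2)) (Psi ⁅P, evalPQ K P Q c⁆) with hg₁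
  have hg₁0 : g₁ ≠ 0 := by
    intro h0
    rw [h0, smul_zero] at e
    exact hne e
  have hG₁ : Lead l d (Psi ⁅P, evalPQ K P Q c⁆) (u + w - (d.1 + d.2)) g₁ :=
    ⟨lie_mem_Fil hl hs.le hP.mem hG.mem, rfl, hg₁0⟩
  -- Otherwise `[P, G]`, of smaller degree in `Q`, would contradict minimality. The degree really
  -- drops, since a constant polynomial in `Q` would commute with `P`.
  have h1 : wron u (u + w - (d.1 + d.2)) f g₁ = 0 := by
    by_contra hne1
    rw [lie_evalPQ h] at hG₁
    refine hmin _ ?_ ⟨_, rfl, _, _, hG₁, hne1⟩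
    rw [natDegree_neg]
    refine natDegree_derivative_lt fun h0 => hG₁.p_ne_zero ?_
    rw [eq_C_of_natDegree_eq_zero h0, derivative_C, neg_zero, map_zero, Psi_zero]
  obtain ⟨F, hF⟩ := exists_wron_eq (c := d.1 + d.2) (r := d.1) hu hs.le hρ.ne' hP.ne_zero hg₁0
    (by rw [e]; simp) h1
  have hl' : (l : ℚ) ≠ 0 := by positivity
  -- A monomial `x^(i/l) yᵏ` of weight `u` has `u - σ k = ρ i / l`, so the admissible exponents are
  -- given by the subgroup generated by `ρ / l`.
  obtain ⟨F', hF', hH⟩ := exists_wron_eq_of_coset (s := d.2)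
    (AddSubgroup.zmultiples ((d.1 : ℚ) / l)) ⟨l, by simp; field_simp⟩ rfl (by
      intro k hk
      rw [← hP.hom_eq] at hk
      obtain ⟨i, hi, -⟩ := exists_of_hom_coeff_ne_zero _ _ hk
      refine ⟨i, ?_⟩
      rw [← hi]
      simp [wt]
      ring) hF
  obtain ⟨p, hp, hpw⟩ := exists_homog (l := l) (α := d.1) (β := d.2) (d.1 + d.2) F' (by
    intro k hk
    obtain ⟨i, hi⟩ := hH k hk
    refine ⟨i, ?_⟩
    simp only [zsmul_eq_mul] at hi
    rw [wt]
    linear_combination hi)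
  have hF'0 := ne_zero_of_wron_eq hρ.ne' hP.ne_zero hF'
  have hlead : Lead l d p (d.1 + d.2) F' := ⟨fun i j hij => (hpw i j hij).le, hp, hF'0⟩
  refine ⟨(Ore.toPoly (der K l)).symm p, F', Or.inr ?_, hlead, hF'⟩
  show p = ellL l d p
  apply cf_ext
  intro i j
  rw [cf_ellL, hlead.vL_eq]
  split_ifs with hij
  · rfl
  · by_contra hne
    exact hij (hpw i j hne)

end ExistsF

/-! ### The next direction -/

section NextDirection

variable {K : Type*} [Field K] {l : ℕ} {p : K[T;T⁻¹][X]} {u : ℚ} {f : K[X]}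

theorem Lead.trailing_mem {d : ℤ × ℤ} (h : Lead l d p u f) (hl : 0 < l) (hd : 0 < d.1) :
    ((u - d.2 * f.natTrailingDegree) / d.1, (f.natTrailingDegree : ℚ)) ∈ suppL l p :=
  (mem_suppL_ellL.mp ((h.mem_suppL_ellL_iff hl hd).mpr
    ⟨_, trailingCoeff_nonzero_iff_nonzero.mpr h.ne_zero, rfl⟩)).1

/-- This is maximality of the weight rescaled to `(1, σ/ρ)`. The inequality is strict below `(a,
m)`, the lowest point of the leading term. -/
theorem Lead.slope_lt {d : ℤ × ℤ} (h : Lead l d p u f) (hl : 0 < l) (hd : 0 < d.1) {a m z : ℚ}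
    (ha : a = (u - d.2 * f.natTrailingDegree) / d.1) (hm : m = f.natTrailingDegree)
    (hz : z = d.2 / d.1) {q : ℚ × ℚ} (hq : q ∈ suppL l p) :
    q.1 + z * q.2 ≤ a + z * m ∧ (q.2 < m → q.1 + z * q.2 < a + z * m) := by
  have hρ : (0 : ℚ) < d.1 := by exact_mod_cast hd
  have e : a + z * m = u / d.1 := by rw [ha, hm, hz]; field_simp; ring
  have e' : q.1 + z * q.2 = vPt d q / d.1 := by rw [hz, vPt]; field_simp
  rw [e, e']
  have hle := mem_Fil_iff_suppL.mp h.mem q hq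
  refine ⟨div_le_div_of_nonneg_right hle hρ.le, fun hlt =>
    div_lt_div_of_pos_right (lt_of_le_of_ne hle fun heq => ?_) hρ⟩
  have hq' : q ∈ suppL l (ellL l d p) := mem_suppL_ellL.mpr ⟨hq, by rw [heq, h.vL_eq]⟩
  obtain ⟨j, hj, rfl⟩ := (h.mem_suppL_ellL_iff hl hd).mp hq'
  have := natTrailingDegree_le_of_ne_zero hj
  simp only [hm, Nat.cast_lt] at hlt
  omega

/-- If the slopes of a point below `(a, m)` are at most `z < z₀`, then `(a, m)` stays maximal for the
slope `z`. -/
theorem slope_le {a m z z₀ : ℚ} {q : ℚ × ℚ} (h : q.1 + z₀ * q.2 ≤ a + z₀ * m) (hz : z < z₀)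
    (hq : q.2 < m → (q.1 - a) / (m - q.2) ≤ z) :
    q.1 + z * q.2 ≤ a + z * m ∧ (q.1 + z * q.2 = a + z * m → q.2 ≤ m) := by
  rcases lt_or_ge q.2 m with hlt | hge
  · have := (div_le_iff₀ (by linarith)).mp (hq hlt)
    exact ⟨by linarith, fun _ => hlt.le⟩
  · have h1 : 0 ≤ (z₀ - z) * (q.2 - m) := mul_nonneg (by linarith) (by linarith)
    refine ⟨by linarith, fun heq => ?_⟩
    by_contra hgt
    have h2 : 0 < (z₀ - z) * (q.2 - m) := mul_pos (by linarith) (by linarith)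
    linarith

theorem den_mul_add (z : ℚ) (q : ℚ × ℚ) :
    vPt ((z.den : ℤ), z.num) q = z.den * (q.1 + z * q.2) := by
  have h : (z.num : ℚ) = z.den * z := (Rat.den_mul_eq_num z).symm
  simp only [vPt, h]
  push_cast
  ring

/-- The coprime direction proportional to `(1, z)` is given by the denominator and numerator of `z`.
The second condition in `h` makes `(a, m)` the highest point of its leading term. -/
theorem lead_of_slope (hl : 0 < l) {a z : ℚ} {m : ℕ} (hA : (a, (m : ℚ)) ∈ suppL l p)
    (h : ∀ q ∈ suppL l p, q.1 + z * q.2 ≤ a + z * m ∧ (q.1 + z * q.2 = a + z * m → q.2 ≤ m)) :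
    ∃ f : K[X], Lead l ((z.den : ℤ), z.num) p (z.den * (a + z * m)) f ∧ f.natDegree = m ∧
      ((∃ q ∈ suppL l p, q.2 < m ∧ q.1 + z * q.2 = a + z * m) → 1 < f.support.card) := by
  set d : ℤ × ℤ := ((z.den : ℤ), z.num) with hd
  have hden : (0 : ℚ) < z.den := by exact_mod_cast z.den_pos
  have hα : (d.1 : ℚ) ≠ 0 := by simp [hd]
  have hmem : p ∈ Fil K l d.1 d.2 (z.den * (a + z * m)) := by
    refine mem_Fil_iff_suppL.mpr fun q hq => ?_
    rw [den_mul_add]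
    exact mul_le_mul_of_nonneg_left (h q hq).1 hden.le
  have hcoeff : ∀ q ∈ suppL l p, q.1 + z * q.2 = a + z * m → ∃ j : ℕ, q.2 = j ∧
      (hom K l d.1 d.2 (z.den * (a + z * m)) p).coeff j ≠ 0 := by
    intro q hq heq
    obtain ⟨i, j, hij, rfl⟩ := mem_suppL.mp hq
    refine ⟨j, rfl, ?_⟩
    rw [hom_coeff hl hα _ p]
    · exact hij
    · rw [← heq]
      exact den_mul_add z ((i : ℚ) / l, (j : ℚ))
  obtain ⟨m', hm', hc⟩ := hcoeff _ hA rfl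
  obtain rfl : m = m' := Nat.cast_injective (R := ℚ) hm'
  refine ⟨_, ⟨hmem, rfl, fun h0 => hc (by rw [h0, coeff_zero])⟩, ?_, ?_⟩
  · refine natDegree_eq_of_le_of_coeff_ne_zero ?_ hc
    rw [natDegree_le_iff_coeff_eq_zero]
    intro k hk
    by_contra hne
    obtain ⟨i, hi, hij⟩ := exists_of_hom_coeff_ne_zero _ _ hne
    have hq := (mem_suppL (l := l)).mpr ⟨i, k, hij, rfl⟩
    have e : vPt d ((i : ℚ) / l, (k : ℚ)) = z.den * (a + z * m) := hi
    rw [den_mul_add] at e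
    have := (h _ hq).2 (mul_left_cancel₀ hden.ne' e)
    have : k ≤ m := (Nat.cast_le (α := ℚ)).mp this
    omega
  · rintro ⟨q, hq, hlt, heq⟩
    obtain ⟨j, hj, hjc⟩ := hcoeff q hq heq
    rw [Finset.one_lt_card]
    refine ⟨m, mem_support_iff.mpr hc, j, mem_support_iff.mpr hjc, ?_⟩
    rintro rfl
    exact absurd hj hlt.ne

variable [CharZero K] {P Q : A1 K l}

/-- The Wronskian of the leading polynomials is constant. If only `f` were a monomial, it would have
degree one, and proportionality of degrees would make `w / u` the positive integer `deg g`. -/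
theorem one_lt_card_support_of_lie_eq_one {d : ℤ × ℤ} (hl : 0 < l) (hd' : 0 < d.1 + d.2)
    (h : ⁅Q, P⁆ = 1 ∨ ⁅Q, P⁆ = -1) {u w : ℚ} {f g : K[X]} (hP : Lead l d (Psi P) u f)
    (hQ : Lead l d (Psi Q) w g) (hu : 0 < u) (hw : 0 < w)
    (hdeg : w * f.natDegree = u * g.natDegree)
    (hwu : ∀ n : ℕ, 0 < n → w / u ≠ n) (hg : 1 < g.support.card) : 1 < f.support.card := by
  by_contra hle
  have hPQ := wron_of_lead hl hd' hQ hP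
  obtain ⟨κ, hκ⟩ : ∃ κ : K, wron u w f g = C κ := by
    obtain ⟨κ, hκ⟩ := hom_Psi_one (K := K) (l := l) (α := d.1) (β := d.2) (w + u - (d.1 + d.2))
    rw [← neg_neg (wron u w f g), ← wron_swap, hPQ]
    rcases h with h | h
    · rw [h, hκ]
      exact ⟨-(d.1 * κ), by rw [smul_C, ← C_neg]; rfl⟩
    · have : Psi (-1 : A1 K l) = -Psi 1 := rfl
      rw [h, this, map_neg, hκ]
      exact ⟨d.1 * κ, by rw [smul_neg, neg_neg, smul_C]; rfl⟩
  have h1 := natDegree_eq_one_of_wron_eq_C hu hP.ne_zero hdeg hκ (not_lt.mp hle) hg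
  rw [h1, Nat.cast_one, mul_one] at hdeg
  refine hwu g.natDegree ?_ (by rw [hdeg]; field_simp)
  rw [Nat.pos_iff_ne_zero]
  intro h0
  rw [h0, Nat.cast_zero, mul_zero] at hdeg
  exact hw.ne' hdeg

theorem exists_next_direction {d : ℤ × ℤ} (hl : 0 < l) (hd : 0 < d.1) (hd' : 0 < d.1 + d.2)
    (h : ⁅Q, P⁆ = 1) {u w : ℚ} {f g : K[X]} (hP : Lead l d (Psi P) u f)
    (hQ : Lead l d (Psi Q) w g) (hu : 0 < u) (hw : 0 < w)
    (htr : w * f.natTrailingDegree = u * g.natTrailingDegree)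
    (hlt : u < (d.1 + d.2) * f.natTrailingDegree)
    (hwu : ∀ n : ℕ, 0 < n → w / u ≠ n) (huw : ∀ n : ℕ, 0 < n → u / w ≠ n) :
    ∃ (d' : ℤ × ℤ) (u' w' : ℚ) (f' g' : K[X]), d' ∈ V ∧ 0 < d'.1 ∧ dirLT d' d ∧
      Lead l d' (Psi P) u' f' ∧ Lead l d' (Psi Q) w' g' ∧
      1 < f'.support.card ∧ 1 < g'.support.card ∧ 0 < u' ∧ 0 < w' ∧ w' * u = w * u' ∧
      f'.natDegree = f.natTrailingDegree ∧ g'.natDegree = g.natTrailingDegree ∧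
      (u' - d'.2 * f'.natDegree) / d'.1 = (u - d.2 * f.natTrailingDegree) / d.1 ∧
      (w' - d'.2 * g'.natDegree) / d'.1 = (w - d.2 * g.natTrailingDegree) / d.1 := by
  have hρ : (0 : ℚ) < d.1 := by exact_mod_cast hd
  have hs : (0 : ℚ) < d.1 + d.2 := by exact_mod_cast hd'
  set m := f.natTrailingDegree with hm
  set n := g.natTrailingDegree with hn
  set a : ℚ := (u - d.2 * m) / d.1 with ha
  set b : ℚ := (w - d.2 * n) / d.1 with hb
  set z₀ : ℚ := d.2 / d.1 with hz₀
  have hm0 : (0 : ℚ) < m := by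
    by_contra h0
    have := mul_nonpos_of_nonneg_of_nonpos hs.le (not_lt.mp h0)
    linarith
  have hn_eq : (n : ℚ) = w / u * m := by rw [div_mul_eq_mul_div, htr]; field_simp
  have hb_eq : b = w / u * a := by rw [hb, ha, hn_eq]; field_simp
  have ham : a < m := by rw [ha, div_lt_iff₀ hρ]; linarith
  have hau : a + z₀ * m = u / d.1 := by rw [ha, hz₀]; field_simp; ring
  have hAP : (a, (m : ℚ)) ∈ suppL l (Psi P) := hP.trailing_mem hl hd
  have hAQ : (b, (n : ℚ)) ∈ suppL l (Psi Q) := hQ.trailing_mem hl hd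
  have hSP := fun q hq => hP.slope_lt (q := q) hl hd ha (m := m) rfl hz₀ hq
  have hSQ := fun q hq => hQ.slope_lt (q := q) hl hd hb (m := n) rfl hz₀ hq
  -- The slopes at which a support point below `(a, m)` or `(b, n)` comes to lie on the line through
  -- it. The largest is the first reached when rotating down from `z₀`.
  let Z : Finset ℚ := (((suppL l (Psi P)).filter fun q => q.2 < (m : ℚ)).image
      fun q => (q.1 - a) / (m - q.2)) ∪
    (((suppL l (Psi Q)).filter fun q => q.2 < (n : ℚ)).image fun q => (q.1 - b) / (n - q.2))
  have hZ : ∀ z, z ∈ Z ↔ (∃ q ∈ suppL l (Psi P), q.2 < m ∧ (q.1 - a) / (m - q.2) = z) ∨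
      (∃ q ∈ suppL l (Psi Q), q.2 < n ∧ (q.1 - b) / (n - q.2) = z) := by
    intro z
    simp only [Z, Finset.mem_union, Finset.mem_image, Finset.mem_filter, and_assoc]
  have hmaxP : ∀ z, (∀ z' ∈ Z, z' ≤ z) → z < z₀ → ∀ q ∈ suppL l (Psi P),
      q.1 + z * q.2 ≤ a + z * m ∧ (q.1 + z * q.2 = a + z * m → q.2 ≤ m) := fun z hz hzz q hq =>
    slope_le (hSP q hq).1 hzz fun hlt => hz _ ((hZ _).mpr (Or.inl ⟨q, hq, hlt, rfl⟩))
  have hmaxQ : ∀ z, (∀ z' ∈ Z, z' ≤ z) → z < z₀ → ∀ q ∈ suppL l (Psi Q),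
      q.1 + z * q.2 ≤ b + z * n ∧ (q.1 + z * q.2 = b + z * n → q.2 ≤ n) := fun z hz hzz q hq =>
    slope_le (hSQ q hq).1 hzz fun hlt => hz _ ((hZ _).mpr (Or.inr ⟨q, hq, hlt, rfl⟩))
  have hζ₀ : -a / m < z₀ := by
    rw [div_lt_iff₀ hm0]
    have : 0 < u / d.1 := by positivity
    linarith
  have hζ₁ : -1 < -a / m := by rw [lt_div_iff₀ hm0]; linarith
  -- The slope `-a / m` gives weight `0` to `(a, m)` and to the proportional point `(b, n)`. Were no
  -- slope larger, `P` and `Q` would have degree at most `0` for the weights `(1, -a/m)`, whose sum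
  -- is positive since `a < m`, so `[Q, P] = 1` would have negative degree.
  obtain ⟨z₁, hz₁, hζz₁⟩ : ∃ z ∈ Z, -a / m < z := by
    by_contra hc
    push Not at hc
    have e1 : a + -a / m * m = 0 := by field_simp; ring
    have e2 : b + -a / m * n = 0 := by rw [hb_eq, hn_eq]; field_simp; ring
    have hPm : Psi P ∈ Fil K l 1 (-a / m) 0 := by
      intro i j hij
      have := (hmaxP _ hc hζ₀ _ (mem_suppL.mpr ⟨i, j, hij, rfl⟩)).1
      rw [e1] at this
      rw [wt, one_mul]
      exact this
    have hQm : Psi Q ∈ Fil K l 1 (-a / m) 0 := by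
      intro i j hij
      have := (hmaxQ _ hc hζ₀ _ (mem_suppL.mpr ⟨i, j, hij, rfl⟩)).1
      rw [e2] at this
      rw [wt, one_mul]
      exact this
    have := lie_mem_Fil hl (by linarith) hQm hPm
    rw [h] at this
    exact Psi_one_notMem_Fil (by linarith) this
  have hne : Z.Nonempty := ⟨z₁, hz₁⟩
  set z := Z.max' hne with hz
  have hζz : -a / m < z := hζz₁.trans_le (Z.le_max' _ hz₁)
  have hzZ : ∀ z' ∈ Z, z' ≤ z := fun z' hz' => Z.le_max' _ hz'
  have hzm : z ∈ Z := Z.max'_mem hne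
  have hzz₀ : z < z₀ := by
    rcases (hZ z).mp hzm with ⟨q, hq, hlt, heq⟩ | ⟨q, hq, hlt, heq⟩
    · rw [← heq, div_lt_iff₀ (by linarith)]
      have := (hSP q hq).2 hlt
      linarith
    · rw [← heq, div_lt_iff₀ (by linarith)]
      have := (hSQ q hq).2 hlt
      linarith
  obtain ⟨f', hP', hf'm, hf'1⟩ := lead_of_slope hl hAP (hmaxP z hzZ hzz₀)
  obtain ⟨g', hQ', hg'n, hg'1⟩ := lead_of_slope hl hAQ (hmaxQ z hzZ hzz₀)
  have hden : (0 : ℚ) < z.den := by exact_mod_cast z.den_pos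
  have hnum : (z.num : ℚ) = z.den * z := (Rat.den_mul_eq_num z).symm
  have hpos : 0 < a + z * m := by
    have := (div_lt_iff₀ hm0).mp hζz
    linarith
  have hposQ : b + z * n = w / u * (a + z * m) := by rw [hb_eq, hn_eq]; ring
  have hu' : 0 < z.den * (a + z * m) := by positivity
  have hw' : 0 < z.den * (b + z * n) := by rw [hposQ]; positivity
  have hsum : (0 : ℤ) < z.den + z.num := by
    have : (0 : ℚ) < z.den + z.num := by
      rw [hnum]
      have : 0 < z.den * (1 + z) := mul_pos hden (by linarith)
      linarith
    exact_mod_cast this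
  have hratio : z.den * (b + z * n) / (z.den * (a + z * m)) = w / u := by
    rw [hposQ]; field_simp
  have hratio' : z.den * (a + z * m) / (z.den * (b + z * n)) = u / w := by
    rw [hposQ]; field_simp
  have hdeg : z.den * (b + z * n) * (f'.natDegree : ℚ) = z.den * (a + z * m) * g'.natDegree := by
    rw [hf'm, hg'n, hposQ, hn_eq]; ring
  -- The maximal slope is attained in `P` or in `Q`, which gives a second term there. The other one
  -- follows because the ratio of degrees is unchanged and is not an integer.
  have hcard : 1 < f'.support.card ∧ 1 < g'.support.card := by
    have hlieQP : ⁅P, Q⁆ = -1 := by rw [← h, Ring.lie_def, Ring.lie_def, neg_sub]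
    have h1 : 1 < f'.support.card ∨ 1 < g'.support.card := by
      rcases (hZ z).mp hzm with ⟨q, hq, hlt, heq⟩ | ⟨q, hq, hlt, heq⟩
      · refine Or.inl (hf'1 ⟨q, hq, hlt, ?_⟩)
        have := (div_eq_iff (by linarith)).mp heq
        linarith
      · refine Or.inr (hg'1 ⟨q, hq, hlt, ?_⟩)
        have := (div_eq_iff (by linarith)).mp heq
        linarith
    rcases h1 with h1 | h1
    · exact ⟨h1, one_lt_card_support_of_lie_eq_one hl hsum (Or.inr hlieQP) hQ' hP' hw' hu' hdeg.symm
        (by rwa [hratio']) h1⟩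
    · exact ⟨one_lt_card_support_of_lie_eq_one hl hsum (Or.inl h) hP' hQ' hu' hw' hdeg
        (by rwa [hratio]) h1, h1⟩
  refine ⟨((z.den : ℤ), z.num), _, _, f', g', ⟨?_, hsum⟩, Int.natCast_pos.mpr z.den_pos, Or.inl ?_,
    hP', hQ', hcard.1, hcard.2, hu', hw', ?_, hf'm, hg'n, ?_, ?_⟩
  · rw [Int.gcd_comm]; exact z.reduced
  · have : (0 : ℚ) < z.den * d.2 - z.num * d.1 := by
      have h1 : z * d.1 < d.2 := by rwa [hz₀, lt_div_iff₀ hρ] at hzz₀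
      rw [hnum]
      have : 0 < (z.den : ℚ) * (d.2 - z * d.1) := mul_pos hden (by linarith)
      linarith
    exact_mod_cast this
  · rw [hposQ]; field_simp
  · rw [hf'm]
    simp only [hnum, Int.cast_natCast]
    field_simp
    ring
  · rw [hg'n]
    simp only [hnum, Int.cast_natCast]
    field_simp
    ring

end NextDirection

/-! ### The shear on `A₁` -/

/-- For `h = 1` divisibility forces `ρ = 1`, hence `σ ≥ 0`, so the shear adds a polynomial in `X`;
subtracting it recovers `Y`. -/
theorem weyl_map_shear {K : Type*} [Field K] {h : ℕ} (hh : h = 1) {ρ σ : ℤ} (hρ : 0 < ρ)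
    (hρσ : 0 < ρ + σ) (hdvd : ρ ∣ h) (lam : K) :
    (weyl K h).map (shear h ρ σ lam : A1 K h →ₐ[K] A1 K h) = weyl K h := by
  subst hh
  obtain rfl : ρ = 1 := Int.eq_one_of_dvd_one hρ.le (by exact_mod_cast hdvd)
  obtain ⟨k, rfl⟩ := Int.eq_ofNat_of_zero_le (by omega : 0 ≤ σ)
  set a : K[T;T⁻¹] := lam • LaurentPolynomial.T (((1 : ℕ) : ℤ) / 1 * (k : ℤ)) with ha
  have hX : Xpow 1 ((1 : ℕ) : ℤ) ∈ weyl K 1 := Algebra.subset_adjoin (by simp)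
  have hY : Ore.Y (der K 1) ∈ weyl K 1 := Algebra.subset_adjoin (by simp)
  have hA : Ore.ofA (der K 1) a ∈ weyl K 1 := by
    have e : Ore.ofA (der K 1) a = lam • (Xpow 1 ((1 : ℕ) : ℤ)) ^ k := by
      rw [ha, map_smul, Xpow, ← map_pow, LaurentPolynomial.T_pow]
      simp
    rw [e]
    exact Subalgebra.smul_mem _ (pow_mem hX k) _
  have hφX : shear 1 1 k lam (Xpow 1 ((1 : ℕ) : ℤ)) = Xpow 1 ((1 : ℕ) : ℤ) := Ore.shift_ofA _ _ _
  have hφY : shear 1 1 k lam (Ore.Y (der K 1)) = Ore.Y (der K 1) + Ore.ofA (der K 1) a :=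
    Ore.shift_Y _ _
  have hφA : shear 1 1 k lam (Ore.ofA (der K 1) a) = Ore.ofA (der K 1) a := Ore.shift_ofA _ _ _
  apply le_antisymm
  · rw [weyl, AlgHom.map_adjoin, Algebra.adjoin_le_iff]
    rintro _ ⟨x, rfl | rfl, rfl⟩
    · show shear 1 1 k lam (Xpow 1 ((1 : ℕ) : ℤ)) ∈ weyl K 1
      rw [hφX]
      exact hX
    · show shear 1 1 k lam (Ore.Y (der K 1)) ∈ weyl K 1
      rw [hφY]
      exact add_mem hY hA
  · conv_lhs => rw [weyl]
    rw [Algebra.adjoin_le_iff]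
    rintro x (rfl | rfl)
    · exact ⟨_, hX, hφX⟩
    · refine ⟨_, Subalgebra.sub_mem _ hY hA, ?_⟩
      show shear 1 1 k lam (Ore.Y (der K 1) - Ore.ofA (der K 1) a) = _
      rw [map_sub, hφY, hφA, add_sub_cancel_right]

/-! ### Leading terms beyond `(ρ, σ)` and the case of a single root -/

section Main

variable {K : Type*} [Field K] {l : ℕ} {u w : ℚ} {f g : K[X]}

/-- The shear does not change the leading terms for the directions `d > (ρ, σ)`. -/
theorem ell_shear {ρ σ : ℤ} (hl : 0 < l) (hρ : 0 < ρ) (hρσ : 0 < ρ + σ) (hdvd : ρ ∣ l) (lam : K)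
    {P : A1 K l} (hP : Psi P ≠ 0) {d : ℤ × ℤ} (hd : d ∈ Vbar) (hlt : dirLT (ρ, σ) d) :
    ell d (shear l ρ σ lam P) = ell d P := by
  have hαβ : (0 : ℚ) ≤ d.1 + d.2 := by exact_mod_cast hd.2
  have hρ' : (0 : ℚ) < ρ := by exact_mod_cast hρ
  -- Beyond `(ρ, σ)` the weight of `X^(σ/ρ)` is smaller than that of `Y`. The exceptional clause of
  -- the order would need `(ρ, σ) = (1, -1)`, excluded by `ρ + σ > 0`.
  have hpos : (d.1 : ℚ) * (σ / ρ) < d.2 := by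
    rcases hlt with hlt | ⟨h1, -⟩
    · have : (0 : ℚ) < ρ * d.2 - σ * d.1 := by exact_mod_cast hlt
      rw [mul_div_assoc', div_lt_iff₀ hρ']
      linarith
    · rw [Prod.mk.injEq] at h1
      omega
  obtain ⟨e, he⟩ := hdvd
  have hC : (C (lam • LaurentPolynomial.T ((l : ℤ) / ρ * σ)) : K[T;T⁻¹][X])
      = mono ((l : ℤ) / ρ * σ) 0 lam := by
    rw [mono, monomial_zero_left, LaurentPolynomial.T, AddMonoidAlgebra.smul_single, smul_eq_mul,
      mul_one]
  have hA : (C (lam • LaurentPolynomial.T ((l : ℤ) / ρ * σ)) : K[T;T⁻¹][X])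
      ∈ Fil K l d.1 d.2 ((d.1 : ℚ) * (σ / ρ)) := by
    rw [hC]
    refine mono_mem_Fil _ (le_of_eq ?_)
    have h1 : (l : ℚ) = ρ * e := by exact_mod_cast he
    have hl' : (l : ℚ) ≠ 0 := by positivity
    have he0 : (e : ℚ) ≠ 0 := by
      rintro h0
      rw [h0, mul_zero] at h1
      exact hl' h1
    rw [wt, h1, he, Int.mul_ediv_cancel_left _ hρ.ne']
    push_cast
    field_simp
    ring
  exact ellL_eq_of_sub_mem hP (by linarith) (shift_sub_mem_Fil hl hαβ hpos.le hA (vL_spec d hP).1)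

theorem natDegree_pos_of_one_lt_card {f : K[X]} (hf : 1 < f.support.card) : 0 < f.natDegree := by
  obtain ⟨k, hk, hne⟩ := Finset.exists_mem_ne hf 0
  have := le_natDegree_of_mem_supp k hk
  omega

/-- A polynomial with a root of multiplicity equal to its degree, which is not a monomial, has a
non-zero second coefficient. -/
theorem coeff_pred_ne_zero [CharZero K] {f : K[X]} (hf : 1 < f.support.card) {lam : K}
    (h : f.rootMultiplicity lam = f.natDegree) : f.coeff (f.natDegree - 1) ≠ 0 := by
  have hf0 : f ≠ 0 := by rintro rfl; simp at hf
  have hD := natDegree_pos_of_one_lt_card hf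
  obtain ⟨q, hq⟩ := pow_rootMultiplicity_dvd f lam
  rw [h] at hq
  have hdeg := congrArg natDegree hq
  have hq0 : q ≠ 0 := by rintro rfl; rw [mul_zero] at hq; exact hf0 hq
  rw [natDegree_mul (pow_ne_zero _ (X_sub_C_ne_zero lam)) hq0, natDegree_pow, natDegree_X_sub_C,
    mul_one] at hdeg
  rw [eq_C_of_natDegree_eq_zero (by omega : q.natDegree = 0)] at hq hq0
  set c := q.coeff 0
  have hc : c ≠ 0 := by rintro h0; rw [h0, C_0] at hq0; exact hq0 rfl
  -- Here `f = c (X - λ)^D`, which would be a monomial for `λ = 0`. Hence the coefficient `-D λ c`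
  -- is non-zero.
  have hlam : lam ≠ 0 := by
    rintro rfl
    rw [C_0, sub_zero, mul_comm, C_mul_X_pow_eq_monomial] at hq
    have : f.support.card ≤ 1 := card_support_le_one_iff_monomial.mpr ⟨_, _, hq⟩
    omega
  generalize f.natDegree = D at *
  rw [hq, coeff_mul_C, sub_eq_add_neg, ← C_neg, coeff_X_add_C_pow, show D - (D - 1) = 1 by omega]
  refine mul_ne_zero (mul_ne_zero (by simpa using hlam) ?_) hc
  exact_mod_cast (Nat.choose_pos (by omega)).ne'

end Main

end WeylFrac

end


theorem mainTheorem3 {K : Type*} [Field K] [CharZero K] [IsAlgClosed K]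
    (l : ℕ) (hl : 0 < l) (P Q : A1 K l)
    (ρ σ : ℤ) (hV : (ρ, σ) ∈ V) (hρ : 0 < ρ)
    -- `lam` is an element of `K` whose multiplicity as a root of `x^s f_{P,ρ,σ}(x)` is maximal
    (lam : K)
    (hlam : ∀ μ : K,
      (cutPoly (ρ, σ) P).rootMultiplicity μ ≤ (cutPoly (ρ, σ) P).rootMultiplicity lam)
    -- `φ` is the automorphism `Y ↦ Y + lam X^(σ/ρ)` of `A₁^(l')`, where `l' = lcm(l, ρ)`;
    -- `P₀, Q₀` are `P, Q` seen in `A₁^(l')`, and `P₁, Q₁` are their images under `φ`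
    (φ : A1 K (lvl l ρ) ≃ₐ[K] A1 K (lvl l ρ)) (hφ : φ = shear (lvl l ρ) ρ σ lam)
    (P₀ Q₀ P₁ Q₁ : A1 K (lvl l ρ))
    (hP₀ : P₀ = incl (dvd_lvl l ρ) (lvl_pos hl hρ) P)
    (hQ₀ : Q₀ = incl (dvd_lvl l ρ) (lvl_pos hl hρ) Q)
    (hP₁ : P₁ = φ P₀) (hQ₁ : Q₁ = φ Q₀)
    (ha : ⁅Q, P⁆ = 1)
    (hb : (ρ, σ) ∈ Dir P ∩ Dir Q)
    (hc : 0 < v (ρ, σ) P ∧ 0 < v (ρ, σ) Q)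
    (hd : bracket (ρ, σ) P Q = 0)
    (he : (∀ n : ℕ, 0 < n → v (ρ, σ) Q / v (ρ, σ) P ≠ n) ∧
      (∀ n : ℕ, 0 < n → v (ρ, σ) P / v (ρ, σ) Q ≠ n))
    (hf : vPt (1, -1) (en (ρ, σ) P) < 0 ∧ vPt (1, -1) (en (ρ, σ) Q) < 0) :
    (∃ ρ' σ' : ℤ, (ρ', σ') ∈ V ∧
      -- (1)
      (dirLT (ρ', σ') (ρ, σ) ∧ (ρ', σ') ∈ Dir P₁ ∩ Dir Q₁) ∧
      -- (2)
      (vPt (1, -1) (en (ρ', σ') P₁) < 0 ∧ vPt (1, -1) (en (ρ', σ') Q₁) < 0) ∧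
      -- (3)
      (0 < v (ρ', σ') P₁ ∧ 0 < v (ρ', σ') Q₁) ∧
      -- (4)
      v (ρ', σ') P₁ / v (ρ', σ') Q₁ = v (ρ, σ) P / v (ρ, σ) Q ∧
      -- (5)
      (∀ d ∈ Vbar, dirLT (ρ, σ) d → dirLT d (-1, 1) →
        ell d P₁ = ell d P₀ ∧ ell d Q₁ = ell d Q₀) ∧
      -- (6)
      (en (ρ', σ') P₁ = st (ρ, σ) P₁ ∧
        st (ρ, σ) P₁ =
          ((st (ρ, σ) P).1 + (st (ρ, σ) P).2 * (σ : ℚ) / (ρ : ℚ)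
              - ((cutPoly (ρ, σ) P).rootMultiplicity lam : ℚ) * ((σ : ℚ) / (ρ : ℚ)),
            ((cutPoly (ρ, σ) P).rootMultiplicity lam : ℚ))) ∧
      -- (7)
      (en (ρ', σ') Q₁ = st (ρ, σ) Q₁ ∧
        en (ρ', σ') P₁ = (v (ρ, σ) P / v (ρ, σ) Q) • en (ρ', σ') Q₁) ∧
      -- (8)
      ((vPt (0, 1) (en (ρ', σ') P₁) < vPt (0, 1) (en (ρ, σ) P) ∨
          en (ρ', σ') P₁ = en (ρ, σ) P) ∧
        (en (ρ', σ') P₁ = en (ρ, σ) P →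
          en (ρ, σ) P + ((σ : ℚ) / (ρ : ℚ), -1) ∈ supp P)) ∧
      -- (9)
      (v (ρ, σ) P₁ = v (ρ, σ) P ∧ v (ρ, σ) Q₁ = v (ρ, σ) Q) ∧
      -- (10)
      bracket (ρ, σ) Q₁ P₁ = 0 ∧
      -- (11), with the supplement that the end points of `F` are not the origin
      (∃ F : A1 K l, IsHomog (ρ, σ) F ∧ 1 < (supp F).card ∧
        bracket (ρ, σ) P F = ell (ρ, σ) P ∧ v (ρ, σ) F = (ρ : ℚ) + (σ : ℚ) ∧
        (en (ρ, σ) F = (1, 1) → st (ρ, σ) P₁ = en (ρ, σ) P) ∧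
        st (ρ, σ) F ≠ (0, 0) ∧ en (ρ, σ) F ≠ (0, 0)) ∧
      -- supplement: the first coordinate of the new direction is positive
      0 < ρ') ∧
    -- supplement: for `l' = 1` the automorphism `φ` induces an automorphism of `A₁`
    (lvl l ρ = 1 → (weyl K (lvl l ρ)).map (φ : A1 K (lvl l ρ) →ₐ[K] A1 K (lvl l ρ))
      = weyl K (lvl l ρ)) := by
  subst hφ hP₁ hQ₁ hP₀ hQ₀
  obtain ⟨hcP, hcQ⟩ := hc
  have hρσ : 0 < ρ + σ := hV.2
  have hρ' : (0 : ℚ) < ρ := by exact_mod_cast hρ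
  have hs : (0 : ℚ) < ρ + σ := by exact_mod_cast hρσ
  have hh := lvl_pos hl hρ
  have hdvd : ρ ∣ (lvl l ρ : ℤ) :=
    Int.dvd_natCast.mpr (Nat.dvd_lcm_right l ρ.natAbs)
  refine ⟨?_, fun h1 => weyl_map_shear h1 hρ hρσ hdvd lam⟩
  obtain ⟨f, hP⟩ := exists_lead (d := (ρ, σ)) hl hρ hcP.ne'
  obtain ⟨g, hQ⟩ := exists_lead (d := (ρ, σ)) hl hρ hcQ.ne'
  set u := v (ρ, σ) P with hu
  set w := v (ρ, σ) Q with hw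
  have hfcard := ((hP.mem_Dir_iff hl hρ).mp hb.1).2
  have hf0 := hP.ne_zero
  have hg0 := hQ.ne_zero
  have hD := natDegree_pos_of_one_lt_card hfcard
  rw [hP.cutPoly_eq hl hρ hρσ] at hlam ⊢
  -- the leading terms of `P` and `Q` commute
  have hPQ : ⁅P, Q⁆ = -1 := by rw [← ha, Ring.lie_def, Ring.lie_def, neg_sub]
  have hlt : (ρ + σ : ℚ) < u + w := (bracket_eq_zero_iff hu.symm hw.symm (Or.inr hPQ)).mp hd
  have hwron : wron u w f g = 0 := by
    -- The relevant weight `u + w - (ρ + σ)` is positive, whereas `1` has weight `0`.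
    have e := wron_of_lead hl hρσ hQ hP
    rw [ha, hom_eq_zero_of_mem _ Psi_one_mem_Fil, smul_zero, wron_swap, neg_eq_zero] at e
    · exact e
    · simp only; linarith
  -- the homogeneous element `F`
  obtain ⟨F, F', hFhom, hF, hFeq⟩ := exists_homogeneous_solution hl hρ hρσ ha hP hcP hD
  simp only at hFeq
  have hr : (ρ : ℚ) ≠ 0 := hρ'.ne'
  have hFcard := one_lt_card_support_of_wron_eq hs.ne' hr hfcard hFeq
  have henP := hP.en_eq hl hρ hρσ
  -- This is condition (f) for `P`, with the end point written through the degree of `f`.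
  have hfdeg : u < (ρ + σ) * f.natDegree := by
    have h1 := hf.1
    rw [henP] at h1
    simp only [vPt] at h1
    push_cast at h1
    have h2 : (u - σ * f.natDegree) / ρ < f.natDegree := by linarith
    rw [div_lt_iff₀ hρ'] at h2
    linarith
  obtain ⟨hM, hF1⟩ := lt_mul_rootMultiplicity_of_wron_eq hcP hs hr hf0 hFeq hfdeg hlam
  -- the images under the shear
  have hP₁ := (hP.lead_incl (dvd_lvl l ρ) hh).lead_shear hh hρ hρσ hdvd lam
  have hQ₁ := (hQ.lead_incl (dvd_lvl l ρ) hh).lead_shear hh hρ hρσ hdvd lam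
  have hPne := (hP.lead_incl (dvd_lvl l ρ) hh).p_ne_zero
  have hQne := (hQ.lead_incl (dvd_lvl l ρ) hh).p_ne_zero
  have hell : ∀ d ∈ Vbar, dirLT (ρ, σ) d → dirLT d (-1, 1) →
      ell d (shear (lvl l ρ) ρ σ lam (incl (dvd_lvl l ρ) hh P)) = ell d (incl (dvd_lvl l ρ) hh P) ∧
      ell d (shear (lvl l ρ) ρ σ lam (incl (dvd_lvl l ρ) hh Q)) = ell d (incl (dvd_lvl l ρ) hh Q) :=
    fun d hd hlt _ => ⟨ell_shear hh hρ hρσ hdvd lam hPne hd hlt,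
      ell_shear hh hρ hρσ hdvd lam hQne hd hlt⟩
  have hQP₁ : ⁅shear (lvl l ρ) ρ σ lam (incl (dvd_lvl l ρ) hh Q),
      shear (lvl l ρ) ρ σ lam (incl (dvd_lvl l ρ) hh P)⁆ = 1 := by
    rw [Ring.lie_def] at ha ⊢
    rw [← map_mul, ← map_mul, ← map_mul, ← map_mul, ← map_sub, ← map_sub, ha, map_one, map_one]
  generalize shear (lvl l ρ) ρ σ lam (incl (dvd_lvl l ρ) hh P) = P₁ at *
  generalize shear (lvl l ρ) ρ σ lam (incl (dvd_lvl l ρ) hh Q) = Q₁ at *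
  have hmul := rootMultiplicity_of_wron_eq_zero hf0 hg0 hwron lam
  have hstP := hP₁.st_eq hh hρ hρσ
  have hstQ := hQ₁.st_eq hh hρ hρσ
  rw [rootMultiplicity_eq_natTrailingDegree, rootMultiplicity_eq_natTrailingDegree] at hmul
  have hM' := hM
  rw [rootMultiplicity_eq_natTrailingDegree] at hM'
  obtain ⟨d', u', w', f', g', hV', hρ₁, hdlt, hP', hQ', hf'c, hg'c, hu', hw', hrat, hf'd, hg'd,
      hA, hB⟩ :=
    exists_next_direction hh hρ hρσ hQP₁ hP₁ hQ₁ hcP hcQ hmul hM' he.1 he.2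
  have henP' := hP'.en_eq hh hρ₁ hV'.2
  have henQ' := hQ'.en_eq hh hρ₁ hV'.2
  rw [hA, hf'd] at henP'
  rw [hB, hg'd] at henQ'
  rw [← rootMultiplicity_eq_natTrailingDegree] at henP' henQ' hstP hstQ
  rw [← rootMultiplicity_eq_natTrailingDegree, ← rootMultiplicity_eq_natTrailingDegree] at hmul
  have hMD : f.rootMultiplicity lam ≤ f.natDegree := by
    classical
    rw [← count_roots]
    exact (Multiset.count_le_card _ _).trans (card_roots' f)
  set m := f.rootMultiplicity lam
  set n := g.rootMultiplicity lam
  simp only at henP' henQ' hstP hstQ henP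
  have hn_eq : (n : ℚ) = w / u * m := by rw [div_mul_eq_mul_div, hmul]; field_simp
  -- The bound for `P` carries over to `Q`, as `(u, m)` and `(w, n)` are proportional.
  have hMQ : w < (ρ + σ) * n := by
    rw [hn_eq]
    have : w / u * u < w / u * ((ρ + σ) * m) := mul_lt_mul_of_pos_left hM (by positivity)
    rw [div_mul_cancel₀ _ hcP.ne'] at this
    linarith
  have hmD : m = f.natDegree → (((u - σ * m) / ρ, (m : ℚ)) : ℚ × ℚ) = en (ρ, σ) P := by
    intro h
    rw [henP, h]
  refine ⟨d'.1, d'.2, hV', ⟨hdlt, (hP'.mem_Dir_iff hh hρ₁).mpr ⟨hV', hf'c⟩,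
    (hQ'.mem_Dir_iff hh hρ₁).mpr ⟨hV', hg'c⟩⟩, ?_, ?_, ?_, hell, ?_, ?_, ?_,
    ⟨hP₁.v_eq, hQ₁.v_eq⟩, ?_, ?_, hρ₁⟩
  · have key : ∀ (a : ℚ) (k : ℕ), a < (ρ + σ) * k → vPt (1, -1) ((a - σ * k) / ρ, (k : ℚ)) < 0 := by
      intro a k hak
      have : (a - σ * k) / ρ < k := by rw [div_lt_iff₀ hρ']; linarith
      simp only [vPt]
      push_cast
      linarith
    exact ⟨henP' ▸ key _ _ hM, henQ' ▸ key _ _ hMQ⟩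
  · exact ⟨hP'.v_eq ▸ hu', hQ'.v_eq ▸ hw'⟩
  · rw [hP'.v_eq, hQ'.v_eq, div_eq_div_iff hw'.ne' hcQ.ne']
    linarith
  · refine ⟨henP'.trans hstP.symm, ?_⟩
    rw [hstP, hP.st_eq hl hρ hρσ]
    ext
    · simp only; field_simp; ring
    · rfl
  · refine ⟨henQ'.trans hstQ.symm, ?_⟩
    rw [henP', henQ', hn_eq]
    ext
    · simp only [Prod.smul_mk, smul_eq_mul]; field_simp
    · simp only [Prod.smul_mk, smul_eq_mul]; field_simp
  · refine ⟨?_, fun heq => ?_⟩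
    · rcases lt_or_eq_of_le hMD with h | h
      · left
        rw [henP', henP]
        have : (m : ℚ) < f.natDegree := by exact_mod_cast h
        simpa [vPt] using this
      · right
        rw [henP', hmD h]
    · have h : m = f.natDegree := by
        rw [henP', henP] at heq
        exact Nat.cast_injective (R := ℚ) (congrArg Prod.snd heq)
      refine (mem_suppL_ellL.mp ((hP.mem_suppL_ellL_iff hl hρ).mpr
        ⟨_, coeff_pred_ne_zero hfcard h, ?_⟩)).1
      rw [henP, Nat.cast_sub hD]
      ext
      · simp only [Prod.mk_add_mk]; push_cast; field_simp; ring
      · simp only [Prod.mk_add_mk]; push_cast; ring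
  · refine (bracket_eq_zero_iff hQ₁.v_eq hP₁.v_eq (Or.inl hQP₁)).mpr ?_
    simp only
    linarith
  · have hFv := hF.v_eq
    have hPF := wron_of_lead hl hρσ hP hF
    -- By the choice of `F` the Wronskian equals `ρ f`, and in general it is `ρ` times this
    -- component; cancel `ρ`.
    have hPF' : hom K l ((ρ, σ) : ℤ × ℤ).1 ((ρ, σ) : ℤ × ℤ).2 u (Psi ⁅P, F⁆) = f := by
      have hrK : (ρ : K) ≠ 0 := by exact_mod_cast hρ.ne'
      rw [show u + (((ρ, σ) : ℤ × ℤ).1 + ((ρ, σ) : ℤ × ℤ).2 : ℚ)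
        - (((ρ, σ) : ℤ × ℤ).1 + ((ρ, σ) : ℤ × ℤ).2) = u by ring] at hPF
      simp only at hPF
      rw [hFeq, Rat.cast_intCast] at hPF
      exact (smul_right_injective _ hrK hPF).symm
    have hlead : Lead l (ρ, σ) (Psi ⁅P, F⁆) u f := by
      refine ⟨?_, hPF', hf0⟩
      have := lie_mem_Fil hl (by exact_mod_cast hρσ.le) hP.mem hF.mem
      rwa [add_sub_cancel_right] at this
    have hsum : ∀ x y : ℚ, ρ * x + σ * y = ρ + σ → ((x, y) : ℚ × ℚ) ≠ (0, 0) := by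
      intro x y hxy h0
      rw [Prod.mk.injEq] at h0
      rw [h0.1, h0.2] at hxy
      linarith
    refine ⟨F, hFhom, ?_, ?_, hFv, ?_, ?_, ?_⟩
    · rw [← hF.card_suppL_ellL hl hρ] at hFcard
      exact hFcard.trans_le (Finset.card_le_card fun q hq => (mem_suppL_ellL.mp hq).1)
    · rw [bracket, if_neg]
      · exact ellL_eq_of_lead hl hρ hlead hP
      · rw [Proportional, hFv, deg, hlead.degL_eq, WithBot.coe_lt_coe, ← hu]
        simp
    · rw [hF.en_eq hl hρ hρσ, hstP]
      intro h1
      -- The end point `(1, 1)` means that the polynomial of `F` is linear. Then `λ` is the only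
      -- root of `f`, so `m = deg f`.
      exact hmD (hF1 (Nat.cast_eq_one.mp (congrArg Prod.snd h1)))
    · rw [hF.st_eq hl hρ hρσ]
      exact hsum _ _ (by field_simp; ring)
    · rw [hF.en_eq hl hρ hρσ]
      exact hsum _ _ (by field_simp; ring)
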